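/- Let $R$ be an excellent (in particular Noetherian) domain that satisfies the Uniform Briançon–Skoda Property: there is $B\in\mathbb N$ such that $\overline{I^{n+B}}\subseteq I^n$ for all ideals $I\subseteq R$ and all $n\in\mathbb N$, where $\overline{J}$ denotes the integral closure of an ideal $J$. Then the following are equivalent. 1. There exists a constant $E$ such that for every prime ideal $\mathfrak p\in\operatorname{Spec}(R)$, for all Rees valuations $\nu_1,\nu_2$ of the maximal ideal of $R_{\mathfrak p}$, and for all $0\neq f\in R$, $$\nu_1(f)\le E\,\nu_2(f).$$ 2. There exists a constant $C$ such that for every prime ideal $\mathfrak p\in\operatorname{Spec}(R)$ and all $0\neq f\in\mathfrak p$, $$e(R_{\mathfrak p}/fR_{\mathfrak p})\le C\operatorname{ord}_{\mathfrak p}(f).$$ Here the Rees valuations of an ideal $I$ of a domain $A$ with fraction field $K$ are the normalized discrete valuations of $K$ whose valuation rings are the degree-zero parts of the homogeneous localizations of $S=\overline{A[IT,T^{-1}]}$ (the integral closure of the extended Rees algebra in $K(T)$) at the associated primes of $T^{-1}S$ (for $I=0$ there are none); $e(R_{\mathfrak p}/fR_{\mathfrak p})$ is the Hilbert–Samuel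 multiplicity of the local ring $R_{\mathfrak p}/fR_{\mathfrak p}$ with respect to its maximal ideal; and $\operatorname{ord}_{\mathfrak p}(f)=\sup\{n\in\mathbb N: f\in\mathfrak p^{(n)}\}$ with $\mathfrak p^{(n)}=\mathfrak p^nR_{\mathfrak p}\cap R$. -/

import Mathlib

open Filter Topology TensorProduct

universe u

namespace IzumiRees

/-! ### Excellent rings -/

/-- An algebra `B` over a field `k` is geometrically regular if `L ⊗[k] B` is a regular (Noetherian)
ring for every finite field extension `L` of `k`. -/
def IsGeometricallyRegular (k : Type u) (B : Type u) [Field k] [CommRing B] [Algebra k B] : Prop :=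
  ∀ (L : Type u) [Field L] [Algebra k L] [Module.Finite k L], IsRegularRing (L ⊗[k] B)

/-- The formal fibres of a local ring `A`, i.e. the fibres `κ(q) ⊗[A] Â` of `A → Â`, where `Â` is
the completion of `A` at its maximal ideal, are geometrically regular. -/
def HasGeometricallyRegularFormalFibres (A : Type u) [CommRing A] [IsLocalRing A] : Prop :=
  ∀ (q : Ideal A) [q.IsPrime], IsGeometricallyRegular q.ResidueField
    (q.ResidueField ⊗[A] AdicCompletion (IsLocalRing.maximalIdeal A) A)

/-- The formal fibres of all localizations of `R` at prime ideals are geometrically regular. -/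
def IsGRing (R : Type u) [CommRing R] : Prop :=
  ∀ (p : Ideal R) [p.IsPrime], HasGeometricallyRegularFormalFibres (Localization.AtPrime p)

/-- The regular locus of `Spec S`. -/
def regularLocus (S : Type u) [CommRing S] : Set (PrimeSpectrum S) :=
  {p | IsRegularLocalRing (Localization.AtPrime p.asIdeal)}

/-- The regular locus of every `R`-algebra of finite type is open. -/
def IsJ2 (R : Type u) [CommRing R] : Prop :=
  ∀ (S : Type u) [CommRing S] [Algebra R S] [Algebra.FiniteType R S], IsOpen (regularLocus S)

/-- Any two saturated chains of prime ideals of `S` with the same end points have the same length.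
(In a Noetherian ring all chains of primes between two given primes have bounded length.) -/
def IsCatenary (S : Type u) [CommRing S] : Prop :=
  ∀ s t : RelSeries {(p, q) : PrimeSpectrum S × PrimeSpectrum S | p ⋖ q},
    s.head = t.head → s.last = t.last → s.length = t.length

/-- Every `R`-algebra of finite type is catenary. -/
def IsUniversallyCatenary (R : Type u) [CommRing R] : Prop :=
  ∀ (S : Type u) [CommRing S] [Algebra R S] [Algebra.FiniteType R S], IsCatenary S

/-- Excellent rings. -/
structure IsExcellent (R : Type u) [CommRing R] : Prop where
  isNoetherianRing : IsNoetherianRing R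
  isUniversallyCatenary : IsUniversallyCatenary R
  isGRing : IsGRing R
  isJ2 : IsJ2 R

/-! ### Integral closure of ideals and the Uniform Briançon–Skoda Property -/

/-- The integral closure of an ideal `I`: the elements `x` satisfying an equation
`x ^ t + a₁ x ^ (t - 1) + ⋯ + aₜ = 0` with `t ≥ 1` and `aᵢ ∈ I ^ i`. -/
def idealIntegralClosure {R : Type u} [CommRing R] (I : Ideal R) : Set R :=
  {x | ∃ t : ℕ, 0 < t ∧ ∃ a : ℕ → R, (∀ i ∈ Finset.Icc 1 t, a i ∈ I ^ i) ∧
    x ^ t + ∑ i ∈ Finset.Icc 1 t, a i * x ^ (t - i) = 0}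

/-- There is a natural number `B` such that the integral closure of `I ^ (n + B)` is contained
in `I ^ n` for all ideals `I` and all `n`. -/
def UniformBrianconSkoda (R : Type u) [CommRing R] : Prop :=
  ∃ B : ℕ, ∀ (I : Ideal R) (n : ℕ), idealIntegralClosure (I ^ (n + B)) ⊆ (I ^ n : Ideal R)

/-! ### Rees valuations -/

section Rees

variable {A : Type u} [CommRing A] [IsDomain A]

/-- The extended Rees algebra `A[IT, T⁻¹]`, as a subalgebra of `K(T)`, where `K` is the fraction
field of `A` and `T` is the variable `RatFunc.X`. -/
noncomputable def extendedRees (I : Ideal A) : Subalgebra A (RatFunc (FractionRing A)) :=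
  Algebra.adjoin A
    ({RatFunc.X⁻¹} ∪ {x | ∃ a ∈ I, x = RatFunc.C (algebraMap A (FractionRing A) a) * RatFunc.X})

/-- The normalized extended Rees algebra: the integral closure of `A[IT, T⁻¹]` in `K(T)`. -/
noncomputable def normalizedRees (I : Ideal A) : Subalgebra A (RatFunc (FractionRing A)) :=
  (integralClosure (extendedRees I) (RatFunc (FractionRing A))).restrictScalars A

/-- The element `T⁻¹` of the normalized extended Rees algebra. -/
noncomputable def tInv (I : Ideal A) : normalizedRees I :=
  ⟨RatFunc.X⁻¹, (integralClosure (extendedRees I) (RatFunc (FractionRing A))).algebraMap_mem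
    ⟨RatFunc.X⁻¹, Algebra.subset_adjoin (Or.inl rfl)⟩⟩

/-- The exceptional primes: the associated primes of the principal ideal generated by `T⁻¹` in the
normalized extended Rees algebra. -/
def exceptionalPrimes (I : Ideal A) : Set (Ideal (normalizedRees I)) :=
  associatedPrimes (normalizedRees I) (normalizedRees I ⧸ Ideal.span {tInv I})

/-- The degree zero part, inside `K`, of the homogeneous localization of the normalized extended
Rees algebra `S` at a prime `Q`: the fractions `c / d` with `c, d ∈ K` such that `c T ^ n ∈ S` and
`d T ^ n ∈ S ∖ Q` for some `n : ℤ`. -/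
def homogeneousLocalization (I : Ideal A) (Q : Ideal (normalizedRees I)) :
    Set (FractionRing A) :=
  {x | ∃ (n : ℤ) (c d : FractionRing A) (s t : normalizedRees I),
    (s : RatFunc (FractionRing A)) = RatFunc.C c * RatFunc.X ^ n ∧
    (t : RatFunc (FractionRing A)) = RatFunc.C d * RatFunc.X ^ n ∧ t ∉ Q ∧ x = c / d}

/-- `ν` is a Rees valuation of the ideal `I`: a valuation `ν : K → ℤ ∪ {∞}`, normalized to have
value group `ℤ`, whose valuation ring is the degree zero part of the homogeneous localization of the
normalized extended Rees algebra of `I` at an exceptional prime. -/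
def IsReesValuation (I : Ideal A) (ν : AddValuation (FractionRing A) (WithTop ℤ)) : Prop :=
  (∃ x, ν x = 1) ∧ ∃ Q ∈ exceptionalPrimes I, {x | 0 ≤ ν x} = homogeneousLocalization I Q

end Rees

/-! ### Multiplicity and order -/

/-- The Hilbert–Samuel multiplicity `e_I(M) = lim_n d! · length (M / Iⁿ M) / n ^ d` of a nonzero
finitely generated module `M` of Krull dimension `d` over a Noetherian local ring `A` with respect
to an ideal `I` primary to the maximal ideal. -/
noncomputable def hilbertSamuelMultiplicity (A : Type u) [CommRing A] (I : Ideal A)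
    (M : Type u) [AddCommGroup M] [Module A M] : ℝ :=
  let d : ℕ := ((Module.supportDim A M).unbotD 0).toNat
  limUnder atTop fun n : ℕ =>
    ((d.factorial : ℝ) * ((Module.length A (M ⧸ (I ^ n • (⊤ : Submodule A M)))).toNat : ℝ)) /
      (n : ℝ) ^ d

variable {R : Type u} [CommRing R]

/-- The multiplicity `e(R_p / f R_p)` with respect to the maximal ideal. -/
noncomputable def multiplicityAt (p : Ideal R) [p.IsPrime] (f : R) : ℝ :=
  hilbertSamuelMultiplicity (Localization.AtPrime p) (IsLocalRing.maximalIdeal (Localization.AtPrime p))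
    (Localization.AtPrime p ⧸ Ideal.span {algebraMap R (Localization.AtPrime p) f})

/-- The symbolic power `p⁽ⁿ⁾ = pⁿ R_p ∩ R`. -/
noncomputable def symbolicPower (p : Ideal R) [p.IsPrime] (n : ℕ) : Ideal R :=
  ((p ^ n).map (algebraMap R (Localization.AtPrime p))).comap
    (algebraMap R (Localization.AtPrime p))

/-- The order `ord_p(f) = sup {n | f ∈ p⁽ⁿ⁾}` of `f` at `p`. The supremum is finite if `R` is a
Noetherian domain and `f ≠ 0`. -/
noncomputable def ordAt (p : Ideal R) [p.IsPrime] (f : R) : ℕ :=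
  sSup {n : ℕ | f ∈ symbolicPower p n}

/-! ### The two criteria -/

/-- There is a constant `E` such that `ν₁(f) ≤ E ν₂(f)` for all primes `p`, all Rees valuations
`ν₁, ν₂` of the maximal ideal of `R_p` and all `f ≠ 0` in `R`. -/
def ValuationCriterion (R : Type u) [CommRing R] [IsDomain R] : Prop :=
  ∃ E : ℕ, ∀ (p : Ideal R) [p.IsPrime],
    ∀ ν₁ ν₂ : AddValuation (FractionRing (Localization.AtPrime p)) (WithTop ℤ),
      IsReesValuation (IsLocalRing.maximalIdeal (Localization.AtPrime p)) ν₁ →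
      IsReesValuation (IsLocalRing.maximalIdeal (Localization.AtPrime p)) ν₂ →
      ∀ f : R, f ≠ 0 →
        ν₁ (algebraMap (Localization.AtPrime p) _ (algebraMap R _ f)) ≤
          E • ν₂ (algebraMap (Localization.AtPrime p) _ (algebraMap R _ f))

/-- There is a constant `C` such that `e(R_p / f R_p) ≤ C ord_p(f)` for all primes `p` and all
`f ≠ 0` in `p`. -/
def MultiplicityCriterion (R : Type u) [CommRing R] : Prop :=
  ∃ C : ℕ, ∀ (p : Ideal R) [p.IsPrime], ∀ f ∈ p, f ≠ 0 →
    multiplicityAt p f ≤ (C : ℝ) * (ordAt p f : ℝ)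

end IzumiRees

/-!
Let `A = R_p` with maximal ideal `m` and fraction field `K`, and let `S ⊆ K[T, T⁻¹]` be the
normalized extended Rees algebra of `m`. Both criteria are compared with the discrete valuations
`w_Q` of `K(T)` at the exceptional primes `Q ⊆ S`, which are homogeneous of height one; each Rees
valuation of `m` is the restriction of some `w_Q` to `K`, divided by a positive integer
(`exceptionalVal_eq_mul`), and `x T ^ n ∈ S` if and only if `w_Q x ≥ n w_Q(T⁻¹)` for all `Q`
(`mem_normalizedRees_of_forall_le`). Uniformity in `p` comes from three sources.

* The uniform Briançon–Skoda property localizes (`idealIntegralClosure_localization_subset`), and it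
  gives `x ∈ m ^ (n - B)` whenever `x T ^ n ∈ S` (`mem_pow_of_mem_normalizedRees`).
* Applied to principal ideals, together with the openness of the regular locus, it gives a single
  nonzero conductor `c ∈ R` of the integral closure (`exists_conductor`). Hence `S` is finite over
  the extended Rees algebra (`normalizedRees_finite`) and in particular Noetherian.
* By Noetherian induction and the openness of the regular loci of all `R / q`, there is a number
  `k₀` such that each `R_p` has an ideal generated by `dim R_p` elements of colength at most `k₀`
  (`exists_hasParameterIdealOfColengthLE`).

Suppose that the Rees valuations of `m` are comparable with constant `E`, and that `f` has order `n`.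
Then `f T ^ (n + 1 + B) ∉ S`, so some `w_Q f`, and hence each of them, is at most linear in `n`
relative to `w_Q(T⁻¹)`. It follows that `(m ^ k : f) ⊆ m ^ (k - D)` with `D` linear in `n`
(`mem_pow_sub_of_mul_mem_pow`). The exact sequence of the multiplication by `f` on `A / m ^ k` then
shows `e(A / f) ≤ D k₀` (`exists_hasPoly_hilbertSamuelMultiplicity`).

Conversely, `w_Q f ≤ e(A / f)` for all `Q` (`exceptionalVal_le_factorial_mul_coeff`), whereas the Rees
valuations of an element of order `n` are at least `n`. To see the inequality, the bound at `Q` in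
the ideal `{x | w_Q' x ≥ k w_Q'(T⁻¹) for all Q'}` is lowered `w_Q f` times by one. Because of `c`,
each of these steps has, up to a shift, at least the length of the graded piece of degree `k` of the
extended Rees algebra modulo `Q` (`valHilbert_le_relLen_valuationIdeal`), and all of them are
multiplied by `f` into an ideal close to `m ^ k` (`sum_valHilbert_le`). The Hilbert polynomial of the
extended Rees algebra modulo `Q` is integer valued, so that it suffices to know that its degree is at
least `dim A - 1` (`exists_hasPoly_valHilbert_of_mem_exceptionalPrimes`). This follows from a chain of
primes of length `dim A` above `Q` (`exists_chain_of_mem_exceptionalPrimes`), which exists because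
`A` is universally catenary.
-/

namespace IzumiRees

/-! ### Eventually polynomial functions -/

section EventuallyPolynomial

open Polynomial

/-- The function `f` agrees with the rational polynomial `p` at all large natural numbers; in
particular it is finite there. -/
def HasPoly (f : ℕ → ℕ∞) (p : ℚ[X]) : Prop :=
  ∀ᶠ n in atTop, ∃ m : ℕ, f n = m ∧ (m : ℚ) = p.eval (n : ℚ)

/-- Every polynomial is a difference `q (x + 1) - q x`; for monomials `q` is a multiple of a
Bernoulli polynomial. -/
theorem exists_antidifference (p : ℚ[X]) :
    ∃ q : ℚ[X], ∀ x, q.eval (x + 1) - q.eval x = p.eval x := by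
  induction p using Polynomial.induction_on' with
  | add p q hp hq =>
    obtain ⟨p', hp'⟩ := hp
    obtain ⟨q', hq'⟩ := hq
    refine ⟨p' + q', fun x => ?_⟩
    rw [eval_add, eval_add, eval_add, ← hp', ← hq']
    ring
  | monomial n a =>
    refine ⟨C (a / (n + 1)) * Polynomial.bernoulli (n + 1), fun x => ?_⟩
    have h := Polynomial.bernoulli_eval_one_add (n + 1) x
    rw [eval_mul, eval_mul, eval_C, eval_C, add_comm x 1, h, eval_monomial]
    have : (n : ℚ) + 1 ≠ 0 := by positivity
    push_cast
    field_simp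
    ring

theorem HasPoly.congr {f g : ℕ → ℕ∞} {p : ℚ[X]} (hf : HasPoly f p) (h : ∀ᶠ n in atTop, f n = g n) :
    HasPoly g p := by
  filter_upwards [hf, h] with n hn h
  rwa [← h]

theorem HasPoly.add {f g : ℕ → ℕ∞} {p q : ℚ[X]} (hf : HasPoly f p) (hg : HasPoly g q) :
    HasPoly (fun n => f n + g n) (p + q) := by
  filter_upwards [hf, hg] with n ⟨m, hm, hm'⟩ ⟨k, hk, hk'⟩
  exact ⟨m + k, by simp [hm, hk], by simp [hm', hk']⟩

theorem HasPoly.sub {f g h : ℕ → ℕ∞} {p q : ℚ[X]} (hf : HasPoly f p) (hg : HasPoly g q)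
    (hh : ∀ᶠ n in atTop, h n + g n = f n) : HasPoly h (p - q) := by
  filter_upwards [hf, hg, hh] with n ⟨m, hm, hm'⟩ ⟨k, hk, hk'⟩ hn
  rw [hm, hk] at hn
  have hfin : h n ≠ ⊤ := by
    rintro h'
    rw [h', top_add] at hn
    exact ENat.top_ne_natCast _ hn
  lift h n to ℕ using hfin with l hl
  refine ⟨l, rfl, ?_⟩
  have : l + k = m := by exact_mod_cast hn
  rw [eval_sub, ← hm', ← hk', ← this]
  push_cast
  ring

theorem HasPoly.shift {f : ℕ → ℕ∞} {p : ℚ[X]} (hf : HasPoly f p) (c : ℕ) :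
    HasPoly (fun n => f (n + c)) (p.comp (X + C (c : ℚ))) := by
  filter_upwards [(tendsto_add_atTop_nat c).eventually hf] with n ⟨m, hm, hm'⟩
  exact ⟨m, hm, by simp [hm']⟩

theorem HasPoly.shift_sub {f : ℕ → ℕ∞} {p : ℚ[X]} (hf : HasPoly f p) (c : ℕ) :
    HasPoly (fun n => f (n - c)) (p.comp (X - C (c : ℚ))) := by
  filter_upwards [(tendsto_sub_atTop_nat c).eventually hf, eventually_ge_atTop c]
    with n ⟨m, hm, hm'⟩ hn
  exact ⟨m, hm, by simp [hm', Nat.cast_sub hn]⟩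

/-- A function whose difference is eventually polynomial is itself eventually polynomial. -/
theorem HasPoly.of_diff {f c k : ℕ → ℕ∞} {pc pk : ℚ[X]} (hfin : ∀ n, f n ≠ ⊤) (hc : HasPoly c pc)
    (hk : HasPoly k pk) (h : ∀ n, f (n + 1) + k n = c n + f n) : ∃ p, HasPoly f p := by
  obtain ⟨q, hq⟩ := exists_antidifference (pc - pk)
  obtain ⟨N, hN⟩ := eventually_atTop.1 (hc.and hk)
  refine ⟨q + C (((f N).toNat : ℚ) - q.eval (N : ℚ)), eventually_atTop.2 ⟨N, fun n hn => ?_⟩⟩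
  induction n, hn using Nat.le_induction with
  | base => exact ⟨(f N).toNat, (ENat.natCast_toNat (hfin N)).symm, by simp⟩
  | succ n hn ih =>
    obtain ⟨m, hm, hm'⟩ := ih
    obtain ⟨⟨a, ha, ha'⟩, ⟨b, hb, hb'⟩⟩ := hN n hn
    refine ⟨(f (n + 1)).toNat, (ENat.natCast_toNat (hfin _)).symm, ?_⟩
    have h1 := h n
    rw [← ENat.natCast_toNat (hfin (n + 1)), ha, hb, hm] at h1
    have h2 : (f (n + 1)).toNat + b = a + m := by exact_mod_cast h1
    have h3 : ((f (n + 1)).toNat : ℚ) = a + m - b := by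
      rw [eq_sub_iff_add_eq]
      exact_mod_cast h2
    rw [h3, hm', ha', hb']
    have h4 := hq n
    simp only [eval_add, eval_C, eval_sub] at h4 ⊢
    push_cast
    linarith

/-- The coefficient of degree `t` of a polynomial of degree at most `t` is the limit of `f n / n ^
t`. -/
theorem HasPoly.tendsto {f : ℕ → ℕ∞} {p : ℚ[X]} (hf : HasPoly f p) {t : ℕ} (ht : p.natDegree ≤ t) :
    Tendsto (fun n : ℕ => ((f n).toNat : ℝ) / (n : ℝ) ^ t) atTop (𝓝 (p.coeff t : ℝ)) := by
  have key : Tendsto (fun x : ℝ => (p.map (algebraMap ℚ ℝ)).eval x / ((X : ℝ[X]) ^ t).eval x) atTop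
      (𝓝 (p.coeff t : ℝ)) := by
    rcases ht.lt_or_eq with h | h
    · rw [coeff_eq_zero_of_natDegree_lt h, Rat.cast_zero]
      apply Polynomial.div_tendsto_atTop_zero_of_degree_lt
      rw [degree_X_pow]
      refine (degree_map_le).trans_lt ((degree_le_natDegree).trans_lt ?_)
      exact_mod_cast h
    · by_cases hp : p = 0
      · simp [hp]
      have := Polynomial.div_tendsto_atTop_leadingCoeff_div_of_degree_eq (p.map (algebraMap ℚ ℝ))
        ((X : ℝ[X]) ^ t) (by
          rw [degree_X_pow, degree_map, degree_eq_natDegree hp, h])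
      rw [leadingCoeff_map, leadingCoeff_X_pow, div_one, leadingCoeff, h] at this
      exact this
  refine (key.comp tendsto_natCast_atTop_atTop).congr' ?_
  filter_upwards [hf] with n ⟨m, hm, hm'⟩
  have : (m : ℝ) = ((p.eval (n : ℚ) : ℚ) : ℝ) := by
    rw [← hm']
    norm_cast
  simp only [Function.comp, eval_pow, eval_X, hm, ENat.toNat_natCast, this]
  congr 1
  rw [eval_map_algebraMap, ← eq_ratCast (algebraMap ℚ ℝ),
    ← aeval_algebraMap_apply_eq_algebraMap_eval,
    map_natCast]

theorem HasPoly.coeff_nonneg {f : ℕ → ℕ∞} {p : ℚ[X]} (hf : HasPoly f p) {t : ℕ}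
    (ht : p.natDegree ≤ t) : 0 ≤ p.coeff t := by
  have := ge_of_tendsto' (hf.tendsto ht) (fun n => by positivity)
  exact_mod_cast this

theorem HasPoly.coeff_le {f g : ℕ → ℕ∞} {p q : ℚ[X]} (hf : HasPoly f p) (hg : HasPoly g q)
    (h : ∀ᶠ n in atTop, f n ≤ g n) {t : ℕ} (hp : p.natDegree ≤ t) (hq : q.natDegree ≤ t) :
    p.coeff t ≤ q.coeff t := by
  have := le_of_tendsto_of_tendsto (hf.tendsto hp) (hg.tendsto hq) (by
    filter_upwards [h, hg] with n hn ⟨m, hm, _⟩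
    gcongr
    simp [hm])
  exact_mod_cast this

theorem HasPoly.natDegree_mono {f g : ℕ → ℕ∞} {p q : ℚ[X]} (hf : HasPoly f p) (hg : HasPoly g q)
    (h : ∀ᶠ n in atTop, f n ≤ g n) : p.natDegree ≤ q.natDegree := by
  by_contra! hlt
  have h1 := hf.coeff_le hg h le_rfl hlt.le
  rw [coeff_eq_zero_of_natDegree_lt hlt] at h1
  have h2 : p.leadingCoeff = 0 := le_antisymm h1 (hf.coeff_nonneg le_rfl)
  rw [leadingCoeff_eq_zero] at h2
  simp [h2] at hlt

/-- An integer-valued polynomial of degree `t` has leading coefficient a multiple of `1 / t!`, as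
its `t`-th difference is the integer `t! * leadingCoeff`. -/
theorem HasPoly.one_le_factorial_mul_leadingCoeff {f : ℕ → ℕ∞} {p : ℚ[X]} (hf : HasPoly f p)
    (hp : p ≠ 0) : 1 ≤ (p.natDegree.factorial : ℚ) * p.leadingCoeff := by
  have hpos : 0 < p.leadingCoeff :=
    lt_of_le_of_ne (hf.coeff_nonneg le_rfl) (Ne.symm (leadingCoeff_ne_zero.2 hp))
  obtain ⟨N, hN⟩ := eventually_atTop.1 hf
  have h1 := congrFun (Polynomial.fwdDiff_iter_degree_eq_factorial p) (N : ℚ)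
  rw [fwdDiff_iter_eq_sum_shift] at h1
  choose! m hm hm' using hN
  have h2 : ∃ z : ℤ, (z : ℚ) = (p.natDegree.factorial : ℚ) * p.leadingCoeff := by
    refine ⟨∑ k ∈ Finset.range (p.natDegree + 1),
      ((-1 : ℤ) ^ (p.natDegree - k) * p.natDegree.choose k) * (m (N + k) : ℤ), ?_⟩
    have h3 : (p.leadingCoeff • (p.natDegree.factorial : ℚ → ℚ)) (N : ℚ) =
      (p.natDegree.factorial : ℚ) * p.leadingCoeff := by
      simp [mul_comm]
    rw [← h3, ← h1]
    push_cast
    refine Finset.sum_congr rfl fun k _ => ?_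
    have := hm' (N + k) (Nat.le_add_right _ _)
    rw [this]
    simp [zsmul_eq_mul]
  obtain ⟨z, hz⟩ := h2
  have h4 : (0 : ℚ) < z := by
    rw [hz]
    positivity
  rw [← hz]
  exact_mod_cast h4

theorem natDegree_comp_X_add_C_sub_lt {p : ℚ[X]} {t : ℕ} (hp : p.natDegree ≤ t + 1) (a : ℚ) :
    (p - p.comp (X - C a)).natDegree ≤ t ∧
      (p - p.comp (X - C a)).coeff t = (t + 1) * a * p.coeff (t + 1) := by
  have h1 : p.comp (X - C a) = taylor (-a) p := by
    rw [taylor_apply, C_neg, sub_eq_add_neg]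
  have hcoeff : ∀ i, t + 1 < i → p.coeff i = 0 := fun i hi =>
    coeff_eq_zero_of_natDegree_lt (hp.trans_lt hi)
  have h2 : (taylor (-a) p).coeff (t + 1) = p.coeff (t + 1) := by
    rw [taylor_coeff]
    have : hasseDeriv (t + 1) p = C (p.coeff (t + 1)) := by
      ext i
      rw [hasseDeriv_coeff, coeff_C]
      split_ifs with h
      · simp [h]
      · rw [hcoeff _ (by omega), mul_zero]
    rw [this, eval_C]
  have h3 : (taylor (-a) p).coeff t = p.coeff t - (t + 1) * a * p.coeff (t + 1) := by
    rw [taylor_coeff]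
    have : hasseDeriv t p = C (p.coeff t) + C ((t + 1) * p.coeff (t + 1)) * X := by
      ext i
      rw [hasseDeriv_coeff, coeff_add, coeff_C, coeff_C_mul, coeff_X]
      rcases i with _ | _ | i
      · simp
      · simp [add_comm 1 t]
      · rw [hcoeff _ (by omega)]
        simp
    rw [this]
    simp
    ring
  have hdeg : (taylor (-a) p).natDegree ≤ t + 1 := by rwa [natDegree_taylor]
  constructor
  · rw [natDegree_le_iff_coeff_eq_zero]
    intro i hi
    rw [coeff_sub, h1]
    rcases (Nat.succ_le_of_lt hi).eq_or_lt with h | h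
    · subst h
      simp [h2]
    · rw [hcoeff i h, coeff_eq_zero_of_natDegree_lt (hdeg.trans_lt h), sub_zero]
  · rw [coeff_sub, h1, h3]
    ring

theorem coeff_comp_X_sub_C {p : ℚ[X]} {t : ℕ} (hp : p.natDegree ≤ t) (a : ℚ) :
    (p.comp (X - C a)).natDegree ≤ t ∧ (p.comp (X - C a)).coeff t = p.coeff t := by
  obtain ⟨h1, -⟩ := natDegree_comp_X_add_C_sub_lt (hp.trans t.le_succ) a
  have hdeg : (p.comp (X - C a)).natDegree ≤ t := by
    refine natDegree_comp_le.trans ?_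
    rwa [natDegree_X_sub_C, mul_one]
  refine ⟨hdeg, ?_⟩
  rcases t with _ | t
  · rw [Nat.le_zero, natDegree_eq_zero] at hp
    obtain ⟨c, rfl⟩ := hp
    simp
  · obtain ⟨h1, -⟩ := natDegree_comp_X_add_C_sub_lt hp a
    have := coeff_eq_zero_of_natDegree_lt (h1.trans_lt t.lt_succ_self)
    rw [coeff_sub, sub_eq_zero] at this
    exact this.symm

/-- The number of monomials of degree `< n + 1` in `s` variables is a polynomial in `n` with leading
term `n ^ s / s!`. -/
theorem hasPoly_multichoose (s K : ℕ) : ∃ p : ℚ[X],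
    HasPoly (fun n => (Nat.multichoose (s + 1) n * K : ℕ)) p ∧ p.natDegree ≤ s ∧
      p.coeff s = K / s.factorial := by
  refine ⟨C ((K : ℚ) / s.factorial) * (ascPochhammer ℚ s).comp (X + C 1), ?_, ?_, ?_⟩
  · refine Eventually.of_forall fun n => ⟨_, rfl, ?_⟩
    have h1 : Nat.multichoose (s + 1) n * s.factorial = (n + 1).ascFactorial s := by
      rw [Nat.multichoose_eq, Nat.ascFactorial_eq_factorial_mul_choose, mul_comm,
        show s + 1 + n - 1 = n + s by omega, Nat.choose_symm_add]
    have h2 : ((Nat.multichoose (s + 1) n : ℕ) : ℚ) * s.factorial =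
        (ascPochhammer ℚ s).eval ((n : ℚ) + 1) := by
      rw [← Nat.cast_mul, h1, ← ascPochhammer_nat_eq_ascFactorial, ascPochhammer_eval_cast]
      push_cast
      rfl
    have h3 : (s.factorial : ℚ) ≠ 0 := by positivity
    rw [eval_mul, eval_C, eval_comp, eval_add, eval_X, eval_C, ← h2]
    push_cast
    field_simp
  · refine (natDegree_C_mul_le _ _).trans (natDegree_comp_le.trans ?_)
    rw [natDegree_X_add_C, mul_one, ascPochhammer_natDegree]
  · have h := (coeff_comp_X_sub_C (p := ascPochhammer ℚ s) (t := s)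
      (ascPochhammer_natDegree ℚ s).le (-1)).2
    rw [C_neg, sub_neg_eq_add] at h
    rw [coeff_C_mul, h]
    have : (ascPochhammer ℚ s).coeff s = 1 := by
      have := (monic_ascPochhammer ℚ s).coeff_natDegree
      rwa [ascPochhammer_natDegree] at this
    rw [this, mul_one]

end EventuallyPolynomial

/-! ### Relative lengths and Hilbert functions of filtrations -/

section RelativeLength

variable {B : Type*} [CommRing B] {M M' : Type*} [AddCommGroup M] [Module B M] [AddCommGroup M']
  [Module B M']

/-- The length of `P / (N ∩ P)` for submodules `N`, `P` of a module. -/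
noncomputable def relLen (N P : Submodule B M) : ℕ∞ := Module.length B (P ⧸ N.submoduleOf P)

theorem relLen_eq_length_range {X : Type*} [AddCommGroup X] [Module B X] {N P : Submodule B M}
    (g : P →ₗ[B] X) (hg : LinearMap.ker g = N.submoduleOf P) :
    relLen N P = Module.length B (LinearMap.range g) := by
  rw [relLen, ← hg]
  exact g.quotKerEquivRange.length_eq

/-- Both sides are the length of the image of `P` in `M' / N`. -/
theorem relLen_sup_map (f : M →ₗ[B] M') (P : Submodule B M) (N : Submodule B M') :
    relLen N (N ⊔ P.map f) = relLen (P ⊓ N.comap f) P := by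
  rw [relLen_eq_length_range (N := N) (P := N ⊔ P.map f) (N.mkQ ∘ₗ (N ⊔ P.map f).subtype),
    relLen_eq_length_range (N := P ⊓ N.comap f) (P := P) (N.mkQ ∘ₗ f ∘ₗ P.subtype)]
  · have h : LinearMap.range (N.mkQ ∘ₗ (N ⊔ P.map f).subtype) =
        LinearMap.range (N.mkQ ∘ₗ f ∘ₗ P.subtype) := by
      rw [LinearMap.range_comp, LinearMap.range_comp, LinearMap.range_comp, Submodule.range_subtype,
        Submodule.range_subtype, Submodule.map_sup, Submodule.mkQ_map_self, bot_sup_eq]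
    rw [h]
  · ext x
    simp [Submodule.submoduleOf]
  · ext x
    simp [Submodule.submoduleOf]

theorem relLen_add {N P Q : Submodule B M} (h1 : N ≤ P) (h2 : P ≤ Q) :
    relLen N P + relLen P Q = relLen N Q := by
  symm
  refine Module.length_eq_add_of_exact
    (Submodule.mapQ (N.submoduleOf P) (N.submoduleOf Q) (Submodule.inclusion h2) ?_)
    (Submodule.factor (?_ : N.submoduleOf Q ≤ P.submoduleOf Q)) ?_ ?_ ?_
  · exact fun x hx => hx
  · exact fun x hx => h1 hx
  · rw [injective_iff_map_eq_zero]
    intro y hy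
    obtain ⟨y, rfl⟩ := Submodule.mkQ_surjective _ y
    exact (Submodule.Quotient.mk_eq_zero _).2
      ((Submodule.Quotient.mk_eq_zero (N.submoduleOf Q)).1 hy : _)
  · exact Submodule.factor_surjective _
  · intro y
    obtain ⟨y, rfl⟩ := Submodule.mkQ_surjective _ y
    constructor
    · intro hy
      have hy' : (y : M) ∈ P := (Submodule.Quotient.mk_eq_zero (P.submoduleOf Q)).1 hy
      exact ⟨Submodule.mkQ _ ⟨y, hy'⟩, rfl⟩
    · rintro ⟨x, hx⟩
      obtain ⟨x, rfl⟩ := Submodule.mkQ_surjective _ x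
      rw [← hx]
      exact (Submodule.Quotient.mk_eq_zero (P.submoduleOf Q)).2 x.2

theorem relLen_top (N : Submodule B M) : relLen N ⊤ = Module.length B (M ⧸ N) := by
  rw [relLen_eq_length_range (N := N) (P := ⊤) (N.mkQ ∘ₗ (⊤ : Submodule B M).subtype)]
  · rw [LinearMap.range_comp, Submodule.range_subtype, Submodule.map_top, Submodule.range_mkQ,
      Module.length_top]
  · ext x
    simp [Submodule.submoduleOf]

theorem relLen_eq_zero {N P : Submodule B M} (h : P ≤ N) : relLen N P = 0 := by
  rw [relLen, Module.length_eq_zero_iff, Submodule.Quotient.subsingleton_iff]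
  exact Submodule.submoduleOf_eq_top.2 h

theorem relLen_anti {N N' : Submodule B M} (P : Submodule B M) (h : N ≤ N') :
    relLen N' P ≤ relLen N P :=
  Module.length_le_of_surjective
    (Submodule.factor (fun _ hx => h hx : N.submoduleOf P ≤ N'.submoduleOf P))
    (Submodule.factor_surjective _)

theorem relLen_sup_right (N P : Submodule B M) : relLen N (N ⊔ P) = relLen N P := by
  have := relLen_sup_map LinearMap.id P N
  rw [Submodule.map_id, Submodule.comap_id] at this
  have h : (P ⊓ N).submoduleOf P = N.submoduleOf P := by
    ext x
    simp [Submodule.submoduleOf]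
  rw [this, relLen, relLen, h]

theorem relLen_mono (N : Submodule B M) {P P' : Submodule B M} (h : P ≤ P') :
    relLen N P ≤ relLen N P' := by
  rw [← relLen_sup_right N P, ← relLen_sup_right N P',
    ← relLen_add (le_sup_left : N ≤ N ⊔ P) (sup_le_sup_left h N)]
  exact le_self_add

/-- A module generated by `n` elements and killed by `I` has length at most `n * length (B / I)`. -/
theorem relLen_le_card_mul {I : Ideal B} {N P : Submodule B M} (s : Finset M)
    (hP : P ≤ N ⊔ Submodule.span B s) (hI : ∀ a ∈ s, ∀ u ∈ I, u • a ∈ N) :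
    relLen N P ≤ s.card * Module.length B (B ⧸ I) := by
  classical
  refine (relLen_mono N hP).trans ?_
  clear hP
  induction s using Finset.induction_on with
  | empty => simp [relLen_eq_zero]
  | insert a s ha ih =>
    have h1 : N ⊔ Submodule.span B ((insert a s : Finset M) : Set M) =
        (N ⊔ Submodule.span B s) ⊔ Submodule.map (LinearMap.toSpanSingleton B M a) ⊤ := by
      rw [Submodule.map_top, LinearMap.range_toSpanSingleton, Finset.coe_insert,
        Submodule.span_insert, sup_assoc, sup_comm (Submodule.span B ({a} : Set M))]
    rw [← relLen_add (le_sup_left : N ≤ N ⊔ Submodule.span B s) (by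
      rw [h1]; exact le_sup_left), h1, relLen_sup_map, Finset.card_insert_of_notMem ha]
    push_cast
    rw [add_mul, one_mul]
    refine add_le_add (ih fun b hb => hI b (Finset.mem_insert_of_mem hb)) ?_
    rw [← relLen_top I]
    refine relLen_anti _ fun u hu => ⟨trivial, ?_⟩
    exact le_sup_left (a := N) (hI a (Finset.mem_insert_self a s) u hu)

theorem relLen_pow_smul_ne_top [IsNoetherianRing B] [Module.Finite B M] {I : Ideal B}
    (hI : Module.length B (B ⧸ I) ≠ ⊤) (n : ℕ) :
    relLen (I ^ (n + 1) • (⊤ : Submodule B M)) (I ^ n • (⊤ : Submodule B M)) ≠ ⊤ := by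
  obtain ⟨s, hs⟩ := IsNoetherian.noetherian (I ^ n • (⊤ : Submodule B M))
  refine ne_top_of_le_ne_top ?_ (relLen_le_card_mul (I := I) s ?_ ?_)
  · exact WithTop.mul_ne_top (ENat.natCast_ne_top _) hI
  · rw [hs]
    exact le_sup_right
  · intro a ha u hu
    rw [pow_succ', mul_smul]
    refine Submodule.smul_mem_smul hu ?_
    rw [← hs]
    exact Submodule.subset_span ha

theorem length_quotient_pow_smul_succ (I : Ideal B) (n : ℕ) :
    Module.length B (M ⧸ (I ^ (n + 1) • (⊤ : Submodule B M))) =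
      relLen (I ^ (n + 1) • (⊤ : Submodule B M)) (I ^ n • (⊤ : Submodule B M)) +
        Module.length B (M ⧸ (I ^ n • (⊤ : Submodule B M))) := by
  rw [← relLen_top, ← relLen_top]
  exact (relLen_add (Submodule.smul_mono_left (Ideal.pow_le_pow_right n.le_succ)) le_top).symm

theorem length_quotient_pow_smul_ne_top [IsNoetherianRing B] [Module.Finite B M] {I : Ideal B}
    (hI : Module.length B (B ⧸ I) ≠ ⊤) (n : ℕ) :
    Module.length B (M ⧸ (I ^ n • (⊤ : Submodule B M))) ≠ ⊤ := by
  induction n with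
  | zero =>
    rw [← relLen_top, relLen_eq_zero (by simp)]
    exact ENat.zero_ne_top
  | succ n ih =>
    rw [length_quotient_pow_smul_succ]
    exact WithTop.add_ne_top.2 ⟨relLen_pow_smul_ne_top hI n, ih⟩

theorem length_quotient_pow_ne_top [IsNoetherianRing B] {I : Ideal B}
    (hI : Module.length B (B ⧸ I) ≠ ⊤) (n : ℕ) : Module.length B (B ⧸ I ^ n) ≠ ⊤ := by
  have := length_quotient_pow_smul_ne_top (M := B) hI n
  rwa [smul_eq_mul, Ideal.mul_top] at this

/-- The Hilbert function of the quotient `F / G` of filtrations is eventually polynomial. The set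
`T` generates `q` up to elements that map `F n` into `G (n + 1)`, and the induction on `T` uses the
exact sequence given by multiplication with `x ∈ T`, whose kernel is given by a filtration that is
stable because it is contained in `F`. -/
theorem exists_hasPoly_relLen [IsNoetherianRing B] [Module.Finite B M] {q : Ideal B}
    (T : Finset B) :
    ∀ (q' : Ideal B), q = q' ⊔ Ideal.span T → ∀ F G : q.Filtration M, F.Stable →
      (∀ n, G.N n ≤ F.N n) → (∀ n, ∀ u ∈ q', ∀ y ∈ F.N n, u • y ∈ G.N (n + 1)) →
      (∀ n, relLen (G.N n) (F.N n) ≠ ⊤) → ∃ p, HasPoly (fun n => relLen (G.N n) (F.N n)) p := by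
  classical
  induction T using Finset.induction_on with
  | empty =>
    intro q' hq F G hF hGF hu _
    obtain ⟨n₀, hn₀⟩ := hF
    refine ⟨0, eventually_atTop.2 ⟨n₀ + 1, fun n hn => ⟨0, ?_, by simp⟩⟩⟩
    obtain ⟨n, rfl⟩ : ∃ k, n = k + 1 := ⟨n - 1, by omega⟩
    have : q = q' := by simpa using hq
    refine relLen_eq_zero ?_
    rw [← hn₀ n (by omega), Submodule.smul_le]
    intro u hu' y hy
    exact hu n u (this ▸ hu') y hy
  | insert x T hx ih =>
    intro q' hq F G hF hGF hu hfin
    have hxq : x ∈ q := by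
      rw [hq]
      exact le_sup_right (a := q') (Ideal.subset_span (by simp))
    have hq2 : q = (q' ⊔ Ideal.span {x}) ⊔ Ideal.span T := by
      rw [hq, Finset.coe_insert, Ideal.span_insert, sup_assoc]
    let m : M →ₗ[B] M := LinearMap.lsmul B M x
    -- `K / G` and `F (· + 1) / C` are the kernel and the cokernel of the multiplication with `x`
    -- from `F / G` to its shift by one; on both of them `x` acts as zero.
    let K : q.Filtration M :=
      { N := fun n => F.N n ⊓ (G.N (n + 1)).comap m
        mono := fun n => inf_le_inf (F.mono n) (Submodule.comap_mono (G.mono _))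
        smul_le := fun n => by
          rw [Submodule.smul_le]
          rintro u hu' y ⟨hy1, hy2⟩
          refine ⟨F.smul_le n (Submodule.smul_mem_smul hu' hy1), ?_⟩
          have := G.smul_le (n + 1) (Submodule.smul_mem_smul hu' hy2)
          change x • u • y ∈ G.N (n + 1 + 1)
          rw [smul_comm]
          exact this }
    let F' : q.Filtration M :=
      { N := fun n => F.N (n + 1)
        mono := fun n => F.mono _
        smul_le := fun n => F.smul_le _ }
    let C : q.Filtration M :=
      { N := fun n => G.N (n + 1) ⊔ (F.N n).map m
        mono := fun n => sup_le_sup (G.mono _) (Submodule.map_mono (F.mono _))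
        smul_le := fun n => by
          rw [Submodule.smul_sup, ← Submodule.map_smul'']
          exact sup_le_sup (G.smul_le _) (Submodule.map_mono (F.smul_le _)) }
    have hF' : F'.Stable := by
      obtain ⟨n₀, hn₀⟩ := hF
      exact ⟨n₀, fun n hn => hn₀ (n + 1) (by omega)⟩
    have hGK : ∀ n, G.N n ≤ K.N n := fun n y hy =>
      ⟨hGF n hy, G.smul_le n (Submodule.smul_mem_smul hxq hy)⟩
    have hKF : ∀ n, K.N n ≤ F.N n := fun n => inf_le_left
    have hGC : ∀ n, G.N (n + 1) ≤ C.N n := fun n => le_sup_left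
    have hCF : ∀ n, C.N n ≤ F.N (n + 1) := fun n => sup_le (hGF _) (by
      rintro _ ⟨y, hy, rfl⟩
      exact F.smul_le n (Submodule.smul_mem_smul hxq hy))
    have hmul : ∀ n, ∀ u ∈ q' ⊔ Ideal.span {x}, ∀ y ∈ F.N n, u • y ∈ C.N n := by
      intro n u hu' y hy
      obtain ⟨u, hu'', v, hv, rfl⟩ := Submodule.mem_sup.1 hu'
      obtain ⟨b, rfl⟩ := Ideal.mem_span_singleton'.1 hv
      rw [add_smul, mul_comm, mul_smul]
      exact add_mem (le_sup_left (a := G.N (n + 1)) (hu n u hu'' y hy))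
        (le_sup_right (a := G.N (n + 1)) ⟨b • y, Submodule.smul_mem _ _ hy, rfl⟩)
    obtain ⟨pk, hpk⟩ := ih _ hq2 K G (hF.of_le hKF) hGK (by
      intro n u hu' y hy
      obtain ⟨u, hu'', v, hv, rfl⟩ := Submodule.mem_sup.1 hu'
      obtain ⟨b, rfl⟩ := Ideal.mem_span_singleton'.1 hv
      rw [add_smul, mul_smul]
      exact add_mem (hu n u hu'' y hy.1) (Submodule.smul_mem _ _ hy.2))
      (fun n => ne_top_of_le_ne_top (hfin n) (relLen_mono _ (hKF n)))
    obtain ⟨pc, hpc⟩ := ih _ hq2 F' C hF' hCF (fun n u hu' y hy => hmul (n + 1) u hu' y hy)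
      (fun n => ne_top_of_le_ne_top (hfin (n + 1)) (relLen_anti _ (hGC n)))
    refine HasPoly.of_diff hfin hpc hpk fun n => ?_
    have h1 := relLen_add (hGK n) (hKF n)
    have h2 := relLen_add (hGC n) (hCF n)
    have h3 : relLen (G.N (n + 1)) (C.N n) = relLen (K.N n) (F.N n) := relLen_sup_map m _ _
    rw [← h1, ← h2, h3]
    change _ = relLen (C.N n) (F.N (n + 1)) + _
    ring

/-- The Hilbert–Samuel function of a finitely generated module is eventually polynomial. -/
theorem exists_hasPoly_length [IsNoetherianRing B] [Module.Finite B M] {I : Ideal B}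
    (hI : Module.length B (B ⧸ I) ≠ ⊤) :
    ∃ p, HasPoly (fun n => Module.length B (M ⧸ (I ^ n • (⊤ : Submodule B M)))) p := by
  obtain ⟨T, hT⟩ := IsNoetherian.noetherian I
  let F := I.stableFiltration (⊤ : Submodule B M)
  let G : I.Filtration M :=
    { N := fun n => F.N (n + 1)
      mono := fun n => F.mono _
      smul_le := fun n => F.smul_le _ }
  obtain ⟨p, hp⟩ := exists_hasPoly_relLen T ⊥ (by rw [bot_sup_eq]; exact hT.symm) F G
    (I.stableFiltration_stable ⊤) (fun n => F.mono n) (by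
      intro n u hu y _
      rw [(Submodule.mem_bot B).1 hu, zero_smul]
      exact zero_mem _) (fun n => relLen_pow_smul_ne_top hI n)
  refine HasPoly.of_diff (length_quotient_pow_smul_ne_top hI) hp
    (k := fun _ => 0) (pk := 0) (Eventually.of_forall fun n => ⟨0, by simp, by simp⟩) fun n => ?_
  rw [length_quotient_pow_smul_succ, add_zero]
  rfl

/-! ### The dimension of a ring and the growth of its Hilbert–Samuel function -/

theorem pow_smul_top_quotient (I J : Ideal B) (n : ℕ) :
    (I ^ n • ⊤ : Submodule B (B ⧸ J)) = Submodule.map J.mkQ (J ⊔ I ^ n) := by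
  have := Submodule.map_smul'' (I ^ n) (⊤ : Submodule B B) J.mkQ
  rw [smul_eq_mul, Ideal.mul_top, Submodule.map_top, Submodule.range_mkQ] at this
  rw [Submodule.map_sup, Submodule.mkQ_map_self, bot_sup_eq]
  exact this.symm

theorem length_quotient_quotient_pow_smul (I J : Ideal B) (n : ℕ) :
    Module.length B ((B ⧸ J) ⧸ (I ^ n • (⊤ : Submodule B (B ⧸ J)))) =
      Module.length B (B ⧸ (J ⊔ I ^ n)) := by
  rw [pow_smul_top_quotient]
  exact (Submodule.quotientQuotientEquivQuotient J (J ⊔ I ^ n) le_sup_left).length_eq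

theorem exists_hasPoly_length_sup [IsNoetherianRing B] {I : Ideal B}
    (hI : Module.length B (B ⧸ I) ≠ ⊤) (J : Ideal B) :
    ∃ p, HasPoly (fun n => Module.length B (B ⧸ (J ⊔ I ^ n))) p := by
  obtain ⟨p, hp⟩ := exists_hasPoly_length (M := B ⧸ J) hI
  refine ⟨p, hp.congr (Eventually.of_forall fun n => ?_)⟩
  rw [← length_quotient_quotient_pow_smul]

/-- If `b` is generated by `s` elements then `b ^ i / b ^ (i + 1)` is generated by the monomials of
degree `i` in them. -/
theorem length_quotient_pow_succ_le {b : Ideal B} (S : Finset B) (hS : Ideal.span S = b) (n : ℕ) :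
    Module.length B (B ⧸ b ^ (n + 1)) ≤
      (Nat.multichoose (S.card + 1) n : ℕ) * Module.length B (B ⧸ b) := by
  classical
  induction n with
  | zero =>
    have h : b ^ (0 + 1) = b := by rw [zero_add, pow_one]
    rw [h, Nat.multichoose_zero_right, Nat.cast_one, one_mul]
  | succ n ih =>
    have h1 := relLen_add (Ideal.pow_le_pow_right (I := b) (n + 1).le_succ) le_top
    rw [relLen_top, relLen_top] at h1
    rw [← h1, Nat.multichoose_succ_succ]
    push_cast
    rw [add_mul]
    refine add_le_add ?_ ih
    -- the monomials of degree `n + 1`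
    let s : Finset B := (Finset.univ : Finset (Sym {x // x ∈ S} (n + 1))).image
      fun z : Sym {x // x ∈ S} (n + 1) => (z.1.map Subtype.val).prod
    have hs : s.card ≤ Nat.multichoose S.card (n + 1) := by
      refine Finset.card_image_le.trans ?_
      rw [Finset.card_univ, Sym.card_sym_eq_multichoose, Fintype.card_coe]
    refine (relLen_le_card_mul (I := b) s ?_ ?_).trans (by gcongr)
    · refine le_sup_of_le_right ?_
      rw [← hS, Ideal.span, Submodule.span_pow, Submodule.span_le]
      intro x hx
      obtain ⟨f, rfl⟩ := Set.mem_pow.1 hx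
      refine Submodule.subset_span ?_
      simp only [s, Finset.coe_image, Finset.coe_univ, Set.image_univ, Set.mem_range]
      refine ⟨⟨Multiset.ofList (List.ofFn f), by simp⟩, ?_⟩
      simp [List.map_ofFn, Function.comp_def]
    · intro a ha u hu
      rw [smul_eq_mul, pow_succ' b (n + 1)]
      refine Ideal.mul_mem_mul hu ?_
      obtain ⟨z, -, rfl⟩ := Finset.mem_image.1 ha
      have : ∀ m : Multiset {x // x ∈ S}, (m.map Subtype.val).prod ∈ b ^ (Multiset.card m) := by
        intro m
        induction m using Multiset.induction_on with
        | empty => simp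
        | cons a m ih =>
          rw [Multiset.map_cons, Multiset.prod_cons, Multiset.card_cons, pow_succ']
          exact Ideal.mul_mem_mul (hS ▸ Ideal.subset_span a.2) ih
      have h2 := this z.1
      rwa [z.2] at h2

/-- A consequence of the Artin–Rees lemma: modulo a prime `P` not containing `x`, the ideals
`(I ^ n : x)` lie in `I ^ (n - c)`. -/
theorem exists_colon_le_pow_sub [IsNoetherianRing B] (I : Ideal B) {P : Ideal B} [P.IsPrime] {x : B}
    (hx : x ∉ P) : ∃ c : ℕ, ∀ n y, x * y ∈ P ⊔ I ^ n → y ∈ P ⊔ I ^ (n - c) := by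
  obtain ⟨c, hc⟩ := I.exists_pow_inf_eq_pow_smul
    (Submodule.span B {Ideal.Quotient.mk P x} : Submodule B (B ⧸ P))
  have hmem : ∀ (n : ℕ) (z : B), Ideal.Quotient.mk P z ∈ (I ^ n • ⊤ : Submodule B (B ⧸ P)) ↔
      z ∈ P ⊔ I ^ n := by
    intro n z
    rw [pow_smul_top_quotient]
    change z ∈ (Submodule.map P.mkQ (P ⊔ I ^ n)).comap P.mkQ ↔ _
    rw [Submodule.comap_map_mkQ, ← sup_assoc, sup_idem]
  refine ⟨c, fun n y hy => ?_⟩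
  rcases lt_or_ge n c with hn | hn
  · rw [Nat.sub_eq_zero_of_le hn.le]
    simp
  have h2 : Ideal.Quotient.mk P (x * y) ∈
      (I ^ (n - c) • (Submodule.span B {Ideal.Quotient.mk P x}) : Submodule B (B ⧸ P)) := by
    refine Submodule.smul_mono le_rfl (inf_le_right (a := I ^ c • ⊤)) ?_
    rw [← hc n hn]
    refine ⟨(hmem _ _).2 hy, Submodule.mem_span_singleton.2 ⟨y, ?_⟩⟩
    rw [mul_comm, map_mul]
    exact Algebra.smul_def _ _
  obtain ⟨z, hz, hz'⟩ := Submodule.mem_smul_span_singleton.1 h2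
  have h3 : x * (y - z) ∈ P := by
    rw [← Ideal.Quotient.eq_zero_iff_mem, mul_sub, map_sub, ← hz', sub_eq_zero, mul_comm x z,
      map_mul]
    exact Algebra.smul_def _ _
  rw [← sub_add_cancel y z]
  exact add_mem (le_sup_left (a := P) (((Ideal.IsPrime.mem_or_mem ‹_› h3).resolve_left hx)))
    (le_sup_right (a := P) hz)

theorem monotone_chain (P : ℕ → Ideal B) (r : ℕ) (h : ∀ i < r, P i < P (i + 1)) :
    ∀ i ≤ r, P i ≤ P r := by
  induction r with
  | zero =>
    intro i hi
    rw [Nat.le_zero.1 hi]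
  | succ r ih =>
    intro i hi
    rcases hi.lt_or_eq with hi | rfl
    · exact (ih (fun j hj => h j (by omega)) i (by omega)).trans (h r (by omega)).le
    · exact le_rfl

/-- The growth of the Hilbert–Samuel function of an ideal `I` bounds the length of the chains of
primes inside `I`: if `P₀ < P₁` is the bottom of the chain and `x ∈ P₁ \ P₀`, then passing from
`B / P₀` to `B / (P₀, x)` lowers the degree. -/
theorem length_le_natDegree_of_chain [IsNoetherianRing B] {I : Ideal B} (hItop : I ≠ ⊤)
    (hI : Module.length B (B ⧸ I) ≠ ⊤) (r : ℕ) :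
    ∀ (P : ℕ → Ideal B) (J : Ideal B), (∀ i ≤ r, (P i).IsPrime) → (∀ i < r, P i < P (i + 1)) →
      J ≤ P 0 → P r ≤ I → ∀ p,
      HasPoly (fun n => Module.length B (B ⧸ (J ⊔ I ^ n))) p → r ≤ p.natDegree := by
  induction r with
  | zero => exact fun _ _ _ _ _ _ _ _ => Nat.zero_le _
  | succ r ih =>
    intro P J hP hlt hJ hPI p hp
    have := hP 0 (Nat.zero_le _)
    -- Compare `B / J` with `B / P₀`, and `B / P₀` with `B / (P₀, x)`, where `x ∈ P₁ \ P₀`.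
    obtain ⟨x, hx1, hx0⟩ := SetLike.exists_of_lt (hlt 0 r.succ_pos)
    obtain ⟨p0, hp0⟩ := exists_hasPoly_length_sup hI (P 0)
    obtain ⟨p1, hp1⟩ := exists_hasPoly_length_sup hI (P 0 ⊔ Ideal.span {x})
    obtain ⟨c, hc⟩ := exists_colon_le_pow_sub I hx0
    have hfin : ∀ n, Module.length B (B ⧸ (P 0 ⊔ I ^ n)) ≠ ⊤ := by
      intro n
      rw [← length_quotient_quotient_pow_smul]
      exact length_quotient_pow_smul_ne_top hI n
    have h0 : p0.natDegree ≤ p.natDegree := by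
      refine hp0.natDegree_mono hp (Eventually.of_forall fun n => ?_)
      rw [← relLen_top, ← relLen_top]
      exact relLen_anti _ (sup_le_sup_right hJ _)
    have h1 : r ≤ p1.natDegree := by
      refine ih (fun i => P (i + 1)) (P 0 ⊔ Ideal.span {x}) (fun i hi => hP _ (by omega))
        (fun i hi => hlt _ (by omega)) ?_ hPI p1 hp1
      refine sup_le (hlt 0 r.succ_pos).le ?_
      rwa [Ideal.span_singleton_le_iff_mem]
    have hd : HasPoly (fun n => Module.length B (B ⧸ (P 0 ⊔ I ^ n)) -
        Module.length B (B ⧸ (P 0 ⊔ I ^ (n - c))))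
        (p0 - p0.comp (Polynomial.X - Polynomial.C (c : ℚ))) := by
      refine hp0.sub (hp0.shift_sub c) (Eventually.of_forall fun n => ?_)
      refine tsub_add_cancel_of_le ?_
      rw [← relLen_top, ← relLen_top]
      exact relLen_anti _ (sup_le_sup_left (Ideal.pow_le_pow_right (Nat.sub_le _ _)) _)
    -- multiplication by `x` on `B / P₀` and the inclusion `(I ^ n : x) ≤ I ^ (n - c)` modulo `P₀`
    have hle : ∀ n, Module.length B (B ⧸ (P 0 ⊔ Ideal.span {x} ⊔ I ^ n)) ≤
        Module.length B (B ⧸ (P 0 ⊔ I ^ n)) - Module.length B (B ⧸ (P 0 ⊔ I ^ (n - c))) := by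
      intro n
      have h2 : P 0 ⊔ Ideal.span {x} ⊔ I ^ n =
          (P 0 ⊔ I ^ n) ⊔ Submodule.map (LinearMap.toSpanSingleton B B x) ⊤ := by
        rw [Submodule.map_top, LinearMap.range_toSpanSingleton, sup_right_comm]
      have h3 := relLen_add (N := P 0 ⊔ I ^ n) (P := P 0 ⊔ Ideal.span {x} ⊔ I ^ n) (Q := ⊤)
        (by rw [h2]; exact le_sup_left) le_top
      rw [relLen_top, relLen_top] at h3
      rw [← h3]
      have h4 : Module.length B (B ⧸ (P 0 ⊔ I ^ (n - c))) ≤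
          relLen (P 0 ⊔ I ^ n) (P 0 ⊔ Ideal.span {x} ⊔ I ^ n) := by
        rw [h2, relLen_sup_map, ← relLen_top]
        refine relLen_anti _ fun y hy => hc n y ?_
        rw [mul_comm]
        exact hy.2
      refine ENat.le_sub_of_add_le_left ?_ ?_
      · exact ne_top_of_le_ne_top (hfin n) ((h4.trans (h3 ▸ le_self_add)))
      · rw [add_comm (relLen _ _)]
        rw [add_comm]
        gcongr
    have h5 := hp1.natDegree_mono hd (Eventually.of_forall hle)
    rcases Nat.eq_zero_or_pos p0.natDegree with h6 | h6
    · -- a bounded Hilbert–Samuel function would have difference zero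
      exfalso
      have h7 : p0 - p0.comp (Polynomial.X - Polynomial.C (c : ℚ)) = 0 := by
        rw [Polynomial.natDegree_eq_zero] at h6
        obtain ⟨a, rfl⟩ := h6
        simp
      rw [h7] at hd
      obtain ⟨n, ⟨m, hm, hm'⟩, hn⟩ := (hd.and (eventually_gt_atTop 0)).exists
      have h8 := (hle n).trans_eq hm
      have hm0 : m = 0 := by
        rw [Polynomial.eval_zero] at hm'
        exact_mod_cast hm'
      rw [hm0, Nat.cast_zero, nonpos_iff_eq_zero, Module.length_eq_zero_iff,
        Submodule.Quotient.subsingleton_iff] at h8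
      refine hItop (top_le_iff.1 ?_)
      rw [← h8]
      refine sup_le (sup_le ?_ ?_) (Ideal.pow_le_self hn.ne')
      · refine le_trans ?_ hPI
        exact (monotone_chain P (r + 1) hlt 0 (Nat.zero_le _))
      · rw [Ideal.span_singleton_le_iff_mem]
        exact (monotone_chain P (r + 1) hlt 1 (by omega)).trans hPI hx1
    · obtain ⟨t, ht⟩ : ∃ t, p0.natDegree = t + 1 := ⟨p0.natDegree - 1, by omega⟩
      have := (natDegree_comp_X_add_C_sub_lt ht.le (c : ℚ)).1
      omega

end RelativeLength

/-! ### Regular local rings are domains -/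

section Regular

open IsLocalRing

theorem withBot_enat_cancel {x : WithBot ℕ∞} {n : ℕ} (h : ((n + 1 : ℕ) : WithBot ℕ∞) ≤ x + 1) :
    (n : WithBot ℕ∞) ≤ x := by
  induction x using WithBot.recBotCoe with
  | bot =>
    rw [WithBot.bot_add] at h
    exact absurd (le_bot_iff.1 h) (by exact WithBot.coe_ne_bot (a := ((n + 1 : ℕ) : ℕ∞)))
  | coe x =>
    have h' : ((n + 1 : ℕ) : ℕ∞) ≤ x + 1 := by exact_mod_cast h
    have : (n : ℕ∞) ≤ x := by
      induction x using ENat.recTopCoe with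
      | top => exact le_top
      | coe x =>
        have : n + 1 ≤ x + 1 := by exact_mod_cast h'
        exact_mod_cast (show n ≤ x by omega)
    exact_mod_cast this

/-- Dividing a regular local ring by an element of a regular system of parameters. -/
theorem isRegularLocalRing_quotient_span_singleton {A : Type u} [CommRing A] [IsRegularLocalRing A]
    {t : A} (ht : t ∈ maximalIdeal A) (ht2 : t ∉ maximalIdeal A ^ 2) :
    ∃ _ : IsRegularLocalRing (A ⧸ Ideal.span {t}),
      (maximalIdeal (A ⧸ Ideal.span {t})).spanFinrank < (maximalIdeal A).spanFinrank := by
  classical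
  have hne : Ideal.span {t} ≠ ⊤ := fun h => (maximalIdeal.isMaximal A).ne_top
    (top_le_iff.1 (h ▸ (Ideal.span_singleton_le_iff_mem _).2 ht))
  have : Nontrivial (A ⧸ Ideal.span {t}) := Ideal.Quotient.nontrivial_iff.2 hne
  have hloc : IsLocalRing (A ⧸ Ideal.span {t}) :=
    .of_surjective' (Ideal.Quotient.mk _) Ideal.Quotient.mk_surjective
  obtain ⟨s, hs, hsm⟩ := Submodule.FG.exists_span_finset_card_eq_spanFinrank
    (IsNoetherian.noetherian (maximalIdeal A))
  have hts : t ∈ Submodule.span A (s : Set A) := hsm ▸ ht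
  obtain ⟨f, -, hf⟩ := Submodule.mem_span_finset.1 hts
  -- some generator can be replaced by `t`
  obtain ⟨a, has, hfa⟩ : ∃ a ∈ s, IsUnit (f a) := by
    by_contra! hcon
    refine ht2 ?_
    rw [← hf, pow_two]
    refine sum_mem fun a ha => Ideal.mul_mem_mul ?_ ?_
    · exact (mem_maximalIdeal _).2 (hcon a ha)
    · rw [← hsm]
      exact Submodule.subset_span ha
  have hgen : maximalIdeal (A ⧸ Ideal.span {t}) =
      Submodule.span _ (((s.erase a).image (Ideal.Quotient.mk (Ideal.span {t})) : Finset _) :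
        Set (A ⧸ Ideal.span {t})) := by
    rw [Finset.coe_image]
    change _ = Ideal.span _
    rw [← Ideal.map_span]
    refine le_antisymm ?_ ?_
    · intro x hx
      obtain ⟨y, rfl⟩ := Ideal.Quotient.mk_surjective x
      have hy : y ∈ maximalIdeal A := by
        rw [mem_maximalIdeal] at hx ⊢
        exact fun h => hx (h.map _)
      rw [← hsm] at hy
      refine Submodule.span_induction (p := fun y _ => Ideal.Quotient.mk (Ideal.span {t}) y ∈
        Ideal.map (Ideal.Quotient.mk (Ideal.span {t})) (Ideal.span (s.erase a : Finset A)))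
        ?_ ?_ ?_ ?_ hy
      · intro b hb
        by_cases hba : b = a
        · obtain ⟨v, hv⟩ := hfa
          have hb' : b = ↑v⁻¹ * t - ∑ i ∈ s.erase a, ↑v⁻¹ * (f i * i) := by
            rw [hba, ← hf, ← Finset.add_sum_erase s _ has, mul_add, Finset.mul_sum]
            simp only [smul_eq_mul]
            rw [← hv, Units.inv_mul_cancel_left, add_sub_cancel_right]
          rw [hb', map_sub, map_mul, Ideal.Quotient.eq_zero_iff_mem.2
            (Ideal.mem_span_singleton_self t), mul_zero, zero_sub, neg_mem_iff]
          refine Ideal.mem_map_of_mem _ (sum_mem fun i hi => ?_)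
          exact Ideal.mul_mem_left _ _ (Ideal.mul_mem_left _ _
            (Ideal.subset_span (Finset.mem_coe.2 hi)))
        · exact Ideal.mem_map_of_mem _ (Ideal.subset_span (Finset.mem_erase.2 ⟨hba, hb⟩))
      · rw [map_zero]
        exact zero_mem _
      · intro x y _ _ hx hy
        rw [map_add]
        exact add_mem hx hy
      · intro r x _ hx
        rw [smul_eq_mul, map_mul]
        exact Ideal.mul_mem_left _ _ hx
    · rw [Ideal.map_le_iff_le_comap, Ideal.span_le]
      intro b hb
      have hb' : b ∈ maximalIdeal A := by
        rw [← hsm]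
        exact Submodule.subset_span (Finset.mem_of_mem_erase hb)
      have : (Ideal.span {t}) ≤ maximalIdeal A := (Ideal.span_singleton_le_iff_mem _).2 ht
      rw [SetLike.mem_coe, Ideal.mem_comap, mem_maximalIdeal]
      intro hu
      obtain ⟨c, hc⟩ := hu.exists_right_inv
      obtain ⟨c, rfl⟩ := Ideal.Quotient.mk_surjective c
      rw [← map_mul, ← map_one (Ideal.Quotient.mk _), Ideal.Quotient.eq] at hc
      refine (maximalIdeal.isMaximal A).ne_top ((Ideal.eq_top_iff_one _).2 ?_)
      have := sub_mem (Ideal.mul_mem_right c _ hb') (this hc)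
      rwa [sub_sub_cancel] at this
  have hcard : (maximalIdeal (A ⧸ Ideal.span {t})).spanFinrank + 1 ≤
      (maximalIdeal A).spanFinrank := by
    have h1 := Submodule.spanFinrank_span_le_ncard_of_finite (R := A ⧸ Ideal.span {t})
      ((s.erase a).image (Ideal.Quotient.mk (Ideal.span {t}))).finite_toSet
    rw [← hgen, Set.ncard_coe_finset] at h1
    have h2 := Finset.card_image_le (s := s.erase a) (f := Ideal.Quotient.mk (Ideal.span {t}))
    have h3 := Finset.card_erase_add_one has
    omega
  have hdim := ringKrullDim_le_ringKrullDim_quotient_add_card (R := A) {t} (by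
    rw [Finset.coe_singleton, Set.singleton_subset_iff, IsLocalRing.ringJacobson_eq_maximalIdeal]
    exact ht)
  rw [← IsRegularLocalRing.spanFinrank_maximalIdeal, Finset.coe_singleton,
    Finset.card_singleton, Nat.cast_one] at hdim
  have hle : (((maximalIdeal (A ⧸ Ideal.span {t})).spanFinrank + 1 : ℕ) : WithBot ℕ∞) ≤
      ringKrullDim (A ⧸ Ideal.span {t}) + 1 := le_trans (by exact_mod_cast hcard) hdim
  exact ⟨.of_spanFinrank_maximalIdeal_le _ (withBot_enat_cancel hle), hcard⟩

/-- A regular local ring is a domain: by induction on the dimension, some `t ∉ m²` outside all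
minimal primes generates a prime ideal, and the minimal prime below it vanishes by Nakayama. -/
theorem isDomain_of_isRegularLocalRing (A : Type u) [CommRing A] [IsRegularLocalRing A] :
    IsDomain A := by
  classical
  induction h : (maximalIdeal A).spanFinrank using Nat.strong_induction_on generalizing A with
  | _ n ih =>
    by_cases h0 : maximalIdeal A = ⊥
    · exact (IsLocalRing.isField_iff_maximalIdeal_eq.2 h0).isDomain
    have hfin := minimalPrimes.finite_of_isNoetherianRing A
    have hmin : maximalIdeal A ∉ minimalPrimes A := by
      intro hm
      have h1 := IsLocalRing.maximalIdeal_height_eq_ringKrullDim (R := A)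
      rw [Ideal.height_eq_zero_iff.2 hm,
        ← IsRegularLocalRing.spanFinrank_maximalIdeal] at h1
      have h2 : (maximalIdeal A).spanFinrank = 0 := by exact_mod_cast h1.symm
      exact h0 ((Submodule.spanFinrank_eq_zero_iff_eq_bot
        (IsNoetherian.noetherian _)).1 h2)
    -- prime avoidance; one of the ideals, `m²`, need not be prime
    obtain ⟨t, ht, ht2, htP⟩ : ∃ t ∈ maximalIdeal A, t ∉ maximalIdeal A ^ 2 ∧
        ∀ P ∈ minimalPrimes A, t ∉ P := by
      by_contra! hcon
      have hsub : ((maximalIdeal A : Set A) ⊆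
          ⋃ i ∈ ((insert (maximalIdeal A ^ 2) hfin.toFinset : Finset (Ideal A)) : Set (Ideal A)),
            (id i : Ideal A)) := by
        intro t ht
        by_cases ht2 : t ∈ maximalIdeal A ^ 2
        · exact Set.mem_biUnion (x := maximalIdeal A ^ 2) (by simp) ht2
        · obtain ⟨P, hP, htP⟩ := hcon t ht ht2
          exact Set.mem_biUnion (x := P) (by simp [hP]) htP
      rw [Ideal.subset_union_prime (maximalIdeal A ^ 2) (maximalIdeal A ^ 2)] at hsub
      · obtain ⟨i, hi, hle⟩ := hsub
        rw [Finset.mem_insert, Set.Finite.mem_toFinset] at hi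
        rcases hi with rfl | hi
        · refine h0 (Submodule.eq_bot_of_le_smul_of_le_jacobson_bot (maximalIdeal A) _
            (IsNoetherian.noetherian _) ?_ (IsLocalRing.maximalIdeal_le_jacobson _))
          rw [smul_eq_mul, ← pow_two]
          exact hle
        · have := hi.1.1
          have h1 : maximalIdeal A = i := le_antisymm hle (IsLocalRing.le_maximalIdeal this.ne_top)
          exact hmin (h1 ▸ hi)
      · intro i hi hne _
        rw [Finset.mem_insert, Set.Finite.mem_toFinset] at hi
        exact (hi.resolve_left hne).1.1
    obtain ⟨hreg, hlt⟩ := isRegularLocalRing_quotient_span_singleton ht ht2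
    have hdom := ih _ (h ▸ hlt) (A ⧸ Ideal.span {t}) rfl
    have hprime : (Ideal.span {t}).IsPrime := (Ideal.Quotient.isDomain_iff_prime _).1 hdom
    obtain ⟨P, hP, hPt⟩ := Ideal.exists_minimalPrimes_le (bot_le (a := Ideal.span {t}))
    have hP' : P ∈ minimalPrimes A := hP
    -- `P ⊆ (t)` and `t ∉ P` give `P = t P`.
    have hPbot : P = ⊥ := by
      refine Submodule.eq_bot_of_le_smul_of_le_jacobson_bot (maximalIdeal A) _
        (IsNoetherian.noetherian _) ?_ (IsLocalRing.maximalIdeal_le_jacobson _)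
      intro x hx
      obtain ⟨b, rfl⟩ := Ideal.mem_span_singleton.1 (hPt hx)
      exact Submodule.smul_mem_smul ht ((hP.1.1.mem_or_mem hx).resolve_left (htP P hP'))
    have : (⊥ : Ideal A).IsPrime := hPbot ▸ hP.1.1
    exact IsDomain.of_bot_isPrime A

end Regular

/-! ### A uniform conductor -/

section Conductor

open IsLocalRing

/-- A regular local ring is integrally closed, in the form: no element outside `A` which is integral
over `A` is multiplied into `A` by the maximal ideal. -/
theorem mem_range_of_maximalIdeal_mul {A : Type u} {L : Type*} [CommRing A] [IsRegularLocalRing A]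
    [Field L] [Algebra A L] [IsFractionRing A L] {x : L} (hx : IsIntegral A x)
    (hm : ∀ r ∈ maximalIdeal A, ∃ b, algebraMap A L r * x = algebraMap A L b) :
    ∃ b, algebraMap A L b = x := by
  have := isDomain_of_isRegularLocalRing A
  have hinj := IsFractionRing.injective A L
  by_contra! hcon
  -- Otherwise the maximal ideal is principal: `w = t x` lies outside the prime ideal `(t)`, and
  -- `r w = t (r x)` shows that each `r` of the maximal ideal lies in `(t)`. So `A` is a discrete
  -- valuation ring or a field, hence integrally closed.
  have hprinc : (maximalIdeal A).IsPrincipal := by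
    by_cases h0 : maximalIdeal A = ⊥
    · rw [h0]
      exact bot_isPrincipal
    obtain ⟨t, ht, ht2⟩ : ∃ t ∈ maximalIdeal A, t ∉ maximalIdeal A ^ 2 := by
      by_contra! hle
      refine h0 (Submodule.eq_bot_of_le_smul_of_le_jacobson_bot (maximalIdeal A) _
        (IsNoetherian.noetherian _) ?_ (IsLocalRing.maximalIdeal_le_jacobson _))
      rw [smul_eq_mul, ← pow_two]
      exact hle
    have ht0 : t ≠ 0 := fun h => ht2 (h ▸ zero_mem _)
    have ht0' : algebraMap A L t ≠ 0 := by rwa [Ne, map_eq_zero_iff _ hinj]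
    obtain ⟨hreg, -⟩ := isRegularLocalRing_quotient_span_singleton ht ht2
    have hdom := isDomain_of_isRegularLocalRing (A ⧸ Ideal.span {t})
    have hprime : (Ideal.span {t}).IsPrime := (Ideal.Quotient.isDomain_iff_prime _).1 hdom
    obtain ⟨w, hw⟩ := hm t ht
    have hwt : w ∉ Ideal.span {t} := by
      intro h
      obtain ⟨b, rfl⟩ := Ideal.mem_span_singleton.1 h
      rw [map_mul] at hw
      exact hcon b (mul_left_cancel₀ ht0' hw).symm
    refine ⟨t, le_antisymm (fun r hr => ?_) ?_⟩
    · obtain ⟨b, hb⟩ := hm r hr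
      have : r * w = t * b := hinj (by rw [map_mul, map_mul, ← hw, ← hb]; ring)
      have h1 : r * w ∈ Ideal.span {t} := Ideal.mem_span_singleton.2 ⟨b, this⟩
      exact (hprime.mem_or_mem h1).resolve_right hwt
    · exact (Ideal.span_singleton_le_iff_mem _).2 ht
  have hPIR : IsPrincipalIdealRing A :=
    ((tfae_of_isNoetherianRing_of_isLocalRing_of_isDomain A).out 4 0).1 hprinc
  obtain ⟨b, hb⟩ := IsIntegrallyClosed.isIntegral_iff.1 hx
  exact hcon b hb

variable {R : Type u} [CommRing R] [IsDomain R]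

/-- If all localizations at primes not containing `a` are regular, then every element of the
fraction field which is integral over `R` is multiplied into `R` by a power of `a`. -/
theorem exists_pow_mul_mem_of_isIntegral [IsNoetherianRing R] {L : Type*} [Field L] [Algebra R L]
    [IsFractionRing R L] {a : R}
    (ha : ∀ (P : Ideal R) [P.IsPrime], a ∉ P → IsRegularLocalRing (Localization.AtPrime P))
    {x : L} (hx : IsIntegral R x) :
    ∃ (N : ℕ) (b : R), algebraMap R L (a ^ N) * x = algebraMap R L b := by
  by_contra! hcon
  let M := L ⧸ LinearMap.range (Algebra.linearMap R L)
  have hmk : ∀ z : L, (Submodule.Quotient.mk z : M) = 0 ↔ ∃ b, algebraMap R L b = z := fun z =>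
    (Submodule.Quotient.mk_eq_zero _)
  -- the annihilators of the classes of `aⁿ x` stabilize
  let ann : ℕ →o Ideal R := ⟨fun n => Submodule.colon ⊥ {a ^ n • (Submodule.Quotient.mk x : M)}, by
    refine monotone_nat_of_le_succ fun n r hr => ?_
    rw [Submodule.mem_colon_singleton, Submodule.mem_bot] at hr ⊢
    rw [pow_succ', mul_smul, smul_comm, hr, smul_zero]⟩
  obtain ⟨n, hn⟩ := monotone_stabilizes_iff_noetherian.2 ‹IsNoetherianRing R› ann
  have hy : (a ^ n • (Submodule.Quotient.mk x : M)) ≠ 0 := by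
    intro h
    rw [← Submodule.Quotient.mk_smul, hmk] at h
    obtain ⟨b, hb⟩ := h
    exact hcon n b (by rw [hb, Algebra.smul_def])
  set y := a ^ n • (Submodule.Quotient.mk x : M) with hydef
  let N := Submodule.span R {y}
  obtain ⟨P, hP, hPle⟩ := exists_le_isAssociatedPrime_of_isNoetherianRing R
    (⟨y, Submodule.mem_span_singleton_self y⟩ : N) (fun h => hy (congrArg Subtype.val h))
  obtain ⟨hPp, ⟨z, hz⟩, hPz⟩ := isAssociatedPrime_iff.1 hP
  obtain ⟨r, rfl⟩ := Submodule.mem_span_singleton.1 hz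
  have hPmem : ∀ s, s ∈ P ↔ s • r • y = 0 := by
    intro s
    rw [hPz, Submodule.mem_colon_singleton, Submodule.mem_bot]
    exact ⟨fun h => congrArg Subtype.val h, fun h => Subtype.ext h⟩
  have haP : a ∉ P := by
    intro haP
    have h1 : r ∈ ann (n + 1) := by
      change r ∈ Submodule.colon ⊥ _
      rw [Submodule.mem_colon_singleton, Submodule.mem_bot, pow_succ', mul_smul, smul_comm]
      exact (hPmem a).1 haP
    rw [← hn (n + 1) (by omega)] at h1
    change r ∈ Submodule.colon ⊥ _ at h1
    rw [Submodule.mem_colon_singleton, Submodule.mem_bot] at h1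
    exact hPp.ne_top ((Ideal.eq_top_iff_one P).2 ((hPmem 1).2 (by rw [h1, smul_zero])))
  have hreg := ha P haP
  -- now `P` is the conductor of `x' = r aⁿ x`
  set x' : L := algebraMap R L (r * a ^ n) * x with hx'
  have hx'int : IsIntegral R x' := (isIntegral_algebraMap).mul hx
  have hPx : ∀ s, s ∈ P ↔ ∃ b, algebraMap R L b = algebraMap R L s * x' := by
    intro s
    rw [hPmem, hydef, ← mul_smul, ← mul_smul, ← Submodule.Quotient.mk_smul, hmk, Algebra.smul_def,
      hx']
    simp only [map_mul, mul_assoc]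
  let A := Localization.AtPrime P
  have hle : P.primeCompl ≤ nonZeroDivisors R := P.primeCompl_le_nonZeroDivisors
  let : Algebra A L := (IsLocalization.lift (M := P.primeCompl) (g := algebraMap R L) (fun s =>
    IsUnit.mk0 _ (by
      rw [Ne, map_eq_zero_iff _ (IsFractionRing.injective R L)]
      exact nonZeroDivisors.ne_zero (hle s.2)))).toAlgebra
  have : IsScalarTower R A L := .of_algebraMap_eq fun r =>
    (IsLocalization.lift_eq (M := P.primeCompl) (S := A) _ r).symm
  have : IsFractionRing A L :=
    IsFractionRing.isFractionRing_of_isDomain_of_isLocalization P.primeCompl A L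
  obtain ⟨b, hb⟩ := mem_range_of_maximalIdeal_mul (A := A) (L := L) (x := x') hx'int.tower_top (by
    intro s hs
    obtain ⟨s, t, rfl⟩ := IsLocalization.exists_mk'_eq P.primeCompl s
    have hsP : s ∈ P := (IsLocalization.AtPrime.mk'_mem_maximal_iff A P s t).1 hs
    obtain ⟨b, hb⟩ := (hPx s).1 hsP
    refine ⟨IsLocalization.mk' A b t, ?_⟩
    have ht : algebraMap R L t ≠ 0 := by
      rw [Ne, map_eq_zero_iff _ (IsFractionRing.injective R L)]
      exact nonZeroDivisors.ne_zero (hle t.2)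
    have key : ∀ c : R, algebraMap A L (IsLocalization.mk' A c t) * algebraMap R L t =
        algebraMap R L c := by
      intro c
      rw [IsScalarTower.algebraMap_apply R A L, ← map_mul, IsLocalization.mk'_spec,
        ← IsScalarTower.algebraMap_apply]
    apply mul_right_cancel₀ ht
    rw [key, mul_right_comm, key, hb])
  obtain ⟨b, t, rfl⟩ := IsLocalization.exists_mk'_eq P.primeCompl b
  refine t.2 ((hPx t).2 ⟨b, ?_⟩)
  rw [← hb, IsScalarTower.algebraMap_apply R A L, IsScalarTower.algebraMap_apply R A L, ← map_mul,
    IsLocalization.mk'_spec']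

omit [IsDomain R] in
theorem exists_equation_of_isIntegral {L : Type*} [Field L] [Algebra R L] {x : L}
    (hx : IsIntegral R x) : ∃ t : ℕ, 0 < t ∧ ∃ c : ℕ → R,
      x ^ t + ∑ i ∈ Finset.Icc 1 t, algebraMap R L (c i) * x ^ (t - i) = 0 := by
  obtain ⟨p, hp, hp'⟩ := hx
  have ht : 0 < p.natDegree := by
    by_contra h0
    rw [hp.natDegree_eq_zero.1 (by omega), Polynomial.eval₂_one] at hp'
    exact one_ne_zero hp'
  refine ⟨p.natDegree, ht, fun i => p.coeff (p.natDegree - i), ?_⟩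
  rw [Polynomial.eval₂_eq_sum_range, Finset.sum_range_succ, hp.coeff_natDegree, map_one, one_mul,
    add_comm] at hp'
  rw [← hp']
  congr 1
  refine Finset.sum_nbij' (fun i => p.natDegree - i) (fun i => p.natDegree - i) ?_ ?_ ?_ ?_ ?_
  · intro i hi
    rw [Finset.mem_Icc] at hi
    rw [Finset.mem_range]
    omega
  · intro i hi
    rw [Finset.mem_range] at hi
    rw [Finset.mem_Icc]
    omega
  · intro i hi
    rw [Finset.mem_Icc] at hi
    omega
  · intro i hi
    rw [Finset.mem_range] at hi
    omega
  · intro i _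
    rfl

/-- Over an excellent domain with the uniform Briançon–Skoda property, a single nonzero element
multiplies every integral element of the fraction field into the ring. -/
theorem exists_conductor (hR : IsExcellent R) {B : ℕ}
    (hB : ∀ (J : Ideal R) (n : ℕ), idealIntegralClosure (J ^ (n + B)) ⊆ (J ^ n : Ideal R)) :
    ∃ c : R, c ≠ 0 ∧ ∀ (L : Type u) [Field L] [Algebra R L] [IsFractionRing R L] (x : L),
      IsIntegral R x → ∃ b, algebraMap R L c * x = algebraMap R L b := by
  have := hR.isNoetherianRing
  have hopen := hR.isJ2 R
  have hgen : (⟨⊥, Ideal.isPrime_bot⟩ : PrimeSpectrum R) ∈ regularLocus R := by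
    have : IsField (Localization.AtPrime (⊥ : Ideal R)) := by
      rw [isField_iff_maximalIdeal_eq, ← Localization.AtPrime.map_eq_maximalIdeal, Ideal.map_bot]
    let := this.toField
    change IsRegularLocalRing (Localization.AtPrime (⊥ : Ideal R))
    infer_instance
  obtain ⟨U, ⟨a, rfl⟩, haU, hU⟩ :=
    PrimeSpectrum.isTopologicalBasis_basic_opens.exists_subset_of_mem_open hgen hopen
  have ha0 : a ≠ 0 := by
    rintro rfl
    exact haU (Ideal.zero_mem _)
  refine ⟨a ^ B, pow_ne_zero _ ha0, fun L _ _ _ x hx => ?_⟩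
  obtain ⟨N, b, hb⟩ := exists_pow_mul_mem_of_isIntegral (a := a) (L := L)
    (fun P hP haP => hU (show (⟨P, hP⟩ : PrimeSpectrum R) ∈ _ from haP)) hx
  have hinj := IsFractionRing.injective R L
  obtain ⟨t, ht, d, hd⟩ := exists_equation_of_isIntegral hx
  -- `a ^ (N + B) x` is integral over the ideal `(a) ^ (N + B)`, hence a multiple of `a ^ N`
  have hb' : algebraMap R L (a ^ B * b) = algebraMap R L (a ^ (N + B)) * x := by
    rw [map_mul, ← hb, pow_add, map_mul]
    ring
  have hcl : a ^ B * b ∈ idealIntegralClosure (Ideal.span {a} ^ (N + B)) := by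
    refine ⟨t, ht, fun i => (a ^ (N + B)) ^ i * d i, fun i _ => ?_, hinj ?_⟩
    · refine Ideal.mul_mem_right _ _ (Ideal.pow_mem_pow (Ideal.pow_mem_pow ?_ _) _)
      exact Ideal.mem_span_singleton_self a
    · have h1 : algebraMap R L (a ^ (N + B)) ^ t *
          (x ^ t + ∑ i ∈ Finset.Icc 1 t, algebraMap R L (d i) * x ^ (t - i)) = 0 := by
        rw [hd, mul_zero]
      rw [map_zero, ← h1, map_add, map_pow, hb', mul_add, mul_pow, map_sum, Finset.mul_sum]
      congr 1
      refine Finset.sum_congr rfl fun i hi => ?_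
      rw [Finset.mem_Icc] at hi
      rw [map_mul, map_mul, map_pow _ (a ^ (N + B)), map_pow _ (a ^ B * b), hb', mul_pow]
      conv_rhs => rw [← Nat.add_sub_cancel' hi.2, pow_add]
      rw [Nat.add_sub_cancel_left]
      ring
  have h1 : a ^ B * b ∈ Ideal.span {a} ^ N := hB _ _ hcl
  rw [Ideal.span_singleton_pow, Ideal.mem_span_singleton] at h1
  obtain ⟨r, hr⟩ := h1
  refine ⟨r, ?_⟩
  have ha : algebraMap R L (a ^ N) ≠ 0 := by
    rw [Ne, map_eq_zero_iff _ hinj]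
    exact pow_ne_zero _ ha0
  apply mul_left_cancel₀ ha
  rw [← map_mul, ← hr, hb', pow_add, map_mul, mul_assoc]

variable (p : Ideal R) [p.IsPrime]

/-- The conductor property passes to localizations. -/
theorem conductor_localization {c : R} (hc : ∀ (L : Type u) [Field L] [Algebra R L]
      [IsFractionRing R L] (x : L), IsIntegral R x → ∃ b, algebraMap R L c * x = algebraMap R L b)
    {L : Type u} [Field L] [Algebra (Localization.AtPrime p) L]
    [IsFractionRing (Localization.AtPrime p) L] (x : L)
    (hx : IsIntegral (Localization.AtPrime p) x) :
    ∃ b, algebraMap (Localization.AtPrime p) L (algebraMap R (Localization.AtPrime p) c) * x =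
      algebraMap (Localization.AtPrime p) L b := by
  let A := Localization.AtPrime p
  let : Algebra R L := ((algebraMap A L).comp (algebraMap R A)).toAlgebra
  have : IsScalarTower R A L := .of_algebraMap_eq fun _ => rfl
  have : FaithfulSMul R L := (faithfulSMul_iff_algebraMap_injective R L).2
    ((IsFractionRing.injective A L).comp
      (IsLocalization.injective A p.primeCompl_le_nonZeroDivisors))
  have hne : ∀ s : p.primeCompl, algebraMap R L s ≠ 0 := fun s => by
    rw [Ne, map_eq_zero_iff _ (FaithfulSMul.algebraMap_injective R L)]
    exact nonZeroDivisors.ne_zero (p.primeCompl_le_nonZeroDivisors s.2)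
  have hfr : IsFractionRing R L := by
    refine IsFractionRing.of_field R L fun z => ?_
    obtain ⟨a, b, hb, rfl⟩ := IsFractionRing.div_surjective (A := A) z
    obtain ⟨a, s, rfl⟩ := IsLocalization.exists_mk'_eq p.primeCompl a
    obtain ⟨b, t, rfl⟩ := IsLocalization.exists_mk'_eq p.primeCompl b
    have key : ∀ (c : R) (t : p.primeCompl), algebraMap A L (IsLocalization.mk' A c t) =
        algebraMap R L c / algebraMap R L t := by
      intro c t
      rw [eq_div_iff (hne t), IsScalarTower.algebraMap_apply R A L t, ← map_mul,
        IsLocalization.mk'_spec, ← IsScalarTower.algebraMap_apply]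
    refine ⟨a * t, b * s, ?_⟩
    rw [key, key, div_div_div_eq, ← map_mul, ← map_mul, mul_comm (s : R)]
  obtain ⟨s, hs⟩ := IsIntegral.exists_multiple_integral_of_isLocalization (R := R)
    (S := L) p.primeCompl x hx
  obtain ⟨b, hb⟩ := hc L _ hs
  refine ⟨IsLocalization.mk' A b s, ?_⟩
  apply mul_right_cancel₀ (hne s)
  rw [IsScalarTower.algebraMap_apply R A L s, ← map_mul, IsLocalization.mk'_spec,
    ← IsScalarTower.algebraMap_apply R A L c, ← IsScalarTower.algebraMap_apply R A L b, ← hb,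
    Submonoid.smul_def, Algebra.smul_def, IsScalarTower.algebraMap_apply R A L s]
  ring

/-- The uniform Briançon–Skoda property passes to localizations, with the same exponent. -/
theorem idealIntegralClosure_localization_subset {B : ℕ}
    (hB : ∀ (J : Ideal R) (n : ℕ), idealIntegralClosure (J ^ (n + B)) ⊆ (J ^ n : Ideal R))
    (J : Ideal (Localization.AtPrime p)) (n : ℕ) :
    idealIntegralClosure (J ^ (n + B)) ⊆ (J ^ n : Ideal (Localization.AtPrime p)) := by
  classical
  rintro x ⟨t, ht, a, ha, hax⟩
  let A := Localization.AtPrime p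
  have hinj : Function.Injective (algebraMap R A) :=
    IsLocalization.injective A p.primeCompl_le_nonZeroDivisors
  set I := J.comap (algebraMap R A) with hI
  have hJ : J = I.map (algebraMap R A) := (IsLocalization.map_under p.primeCompl A J).symm
  have hJpow : ∀ k, J ^ k = (I ^ k).map (algebraMap R A) := fun k => by rw [Ideal.map_pow, ← hJ]
  have h1 : ∀ i, ∃ (s : p.primeCompl) (b : R), i ∈ Finset.Icc 1 t →
      b ∈ (I ^ (n + B)) ^ i ∧ a i * algebraMap R A s = algebraMap R A b := by
    intro i
    by_cases hi : i ∈ Finset.Icc 1 t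
    · have h2 := ha i hi
      rw [← pow_mul, hJpow, IsLocalization.mem_map_algebraMap_iff p.primeCompl] at h2
      obtain ⟨⟨b, s⟩, h⟩ := h2
      exact ⟨s, b, fun _ => ⟨by rw [← pow_mul]; exact b.2, h⟩⟩
    · exact ⟨1, 0, fun h => absurd h hi⟩
  choose s b hsb using h1
  obtain ⟨y, s₀, rfl⟩ := IsLocalization.exists_mk'_eq p.primeCompl x
  -- a common denominator
  set σ : p.primeCompl := s₀ * ∏ i ∈ Finset.Icc 1 t, s i with hσ
  have hσx : algebraMap R A σ * IsLocalization.mk' A y s₀ =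
      algebraMap R A (y * (∏ i ∈ Finset.Icc 1 t, s i : p.primeCompl)) := by
    rw [hσ, Submonoid.coe_mul, map_mul, mul_right_comm, IsLocalization.mk'_spec', map_mul]
  set z := y * ((∏ i ∈ Finset.Icc 1 t, s i : p.primeCompl) : R) with hz
  have hdiv : ∀ i ∈ Finset.Icc 1 t, ∃ r : R, (σ : R) = r * s i := by
    intro i hi
    refine ⟨s₀ * (∏ j ∈ (Finset.Icc 1 t).erase i, s j : p.primeCompl), ?_⟩
    rw [hσ, ← Finset.mul_prod_erase _ _ hi]
    push_cast
    ring
  have hc : ∀ i, ∃ c : R, i ∈ Finset.Icc 1 t →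
      c ∈ (I ^ (n + B)) ^ i ∧ algebraMap R A c = algebraMap R A σ ^ i * a i := by
    intro i
    by_cases hi : i ∈ Finset.Icc 1 t
    · obtain ⟨r, hr⟩ := hdiv i hi
      refine ⟨σ ^ (i - 1) * r * b i, fun _ => ⟨Ideal.mul_mem_left _ _ (hsb i hi).1, ?_⟩⟩
      rw [Finset.mem_Icc] at hi
      have h2 : algebraMap R A σ ^ i = algebraMap R A σ ^ (i - 1) * (algebraMap R A r *
          algebraMap R A (s i)) := by
        rw [← map_mul, ← hr, ← pow_succ, Nat.sub_add_cancel hi.1]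
      rw [map_mul, map_mul, map_pow, h2, ← (hsb i (Finset.mem_Icc.2 hi)).2]
      ring
    · exact ⟨0, fun h => absurd h hi⟩
  choose c hc using hc
  have hcl : z ∈ idealIntegralClosure (I ^ (n + B)) := by
    refine ⟨t, ht, c, fun i hi => (hc i hi).1, hinj ?_⟩
    have h1 : algebraMap R A σ ^ t * _ = algebraMap R A σ ^ t * _ := congrArg _ hax
    rw [mul_zero] at h1
    rw [map_zero, ← h1, map_add, map_pow, ← hσx, mul_add, mul_pow, map_sum, Finset.mul_sum]
    congr 1
    refine Finset.sum_congr rfl fun i hi => ?_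
    rw [map_mul, (hc i hi).2, map_pow, ← hσx, mul_pow]
    rw [Finset.mem_Icc] at hi
    conv_rhs => rw [← Nat.add_sub_cancel' hi.2, pow_add]
    rw [Nat.add_sub_cancel_left]
    ring
  have hzI : z ∈ I ^ n := hB I n hcl
  have hzJ : algebraMap R A z ∈ J ^ n := by
    rw [hJpow]
    exact Ideal.mem_map_of_mem _ hzI
  rw [← hσx] at hzJ
  exact (Ideal.unit_mul_mem_iff_mem _ (IsLocalization.map_units A σ)).1 hzJ

end Conductor

/-! ### Parameter ideals of bounded colength -/

section BoundedColength

open IsLocalRing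

theorem length_quotient_sup_pow_le {A : Type u} [CommRing A] (b q : Ideal A) (T : ℕ → Finset A)
    (hT : ∀ j, Ideal.span (T j : Set A) = q ^ j) (n : ℕ) :
    Module.length A (A ⧸ (b ⊔ q ^ n)) ≤
      ((∑ j ∈ Finset.range n, (T j).card : ℕ) : ℕ∞) * Module.length A (A ⧸ (b ⊔ q)) := by
  induction n with
  | zero =>
    rw [pow_zero, Ideal.one_eq_top, sup_top_eq, ← relLen_top, relLen_eq_zero le_top]
    exact zero_le
  | succ n ih =>
    rw [← relLen_top, ← relLen_add (N := b ⊔ q ^ (n + 1)) (P := b ⊔ q ^ n)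
      (sup_le_sup_left (Ideal.pow_le_pow_right n.le_succ) b) le_top, relLen_top,
      Finset.sum_range_succ, Nat.cast_add, add_mul, add_comm]
    refine add_le_add ih (relLen_le_card_mul (T n) ?_ ?_)
    · refine sup_le (le_sup_left.trans le_sup_left) (le_sup_of_le_right ?_)
      exact (hT n).ge
    · intro a ha u hu
      have ha' : a ∈ q ^ n := by
        rw [← hT]
        exact Ideal.subset_span ha
      obtain ⟨v, hv, w, hw, rfl⟩ := Submodule.mem_sup.1 hu
      rw [add_smul]
      refine add_mem (Ideal.mem_sup_left (Ideal.mul_mem_right _ _ hv)) (Ideal.mem_sup_right ?_)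
      rw [pow_succ']
      exact Ideal.mul_mem_mul hw ha'

variable {R : Type u} [CommRing R]

theorem exists_notMem_mul_pow_le_of_mem_minimalPrimes [IsNoetherianRing R] {I q : Ideal R}
    (hq : q ∈ I.minimalPrimes) : ∃ n : ℕ, ∃ g ∉ q, ∀ x ∈ q ^ n, g * x ∈ I := by
  classical
  obtain ⟨n, hn⟩ := I.exists_radical_pow_le_of_fg (IsNoetherian.noetherian _)
  have h := I.finite_minimalPrimes_of_isNoetherianRing R
  have hq' := hq.1.1
  rw [← I.sInf_minimalPrimes, ← h.coe_toFinset, ← h.toFinset.inf_id_eq_sInf,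
    ← Finset.insert_erase (h.mem_toFinset.mpr hq), Finset.inf_insert, id_eq] at hn
  obtain ⟨g, hg, hgq⟩ : ∃ g ∈ (h.toFinset.erase q).inf id, g ∉ q := by
    refine SetLike.not_le_iff_exists.1 fun hle => ?_
    obtain ⟨P, hP, hPq⟩ := (hq'.inf_le').1 hle
    rw [Finset.mem_erase, Set.Finite.mem_toFinset] at hP
    exact hP.1 (le_antisymm hPq (hq.2 hP.2.1 hPq))
  refine ⟨n, g ^ n, fun h => hgq (hq'.mem_of_pow_mem n h), fun x hx => hn ?_⟩
  refine Ideal.pow_right_mono (Ideal.mul_le_inf) n ?_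
  rw [mul_pow, mul_comm (g ^ n)]
  exact Ideal.mul_mem_mul hx (Ideal.pow_mem_pow hg n)

theorem height_add_le_height_comap_mk (q : Ideal R) [q.IsPrime] (n : ℕ) :
    ∀ (P : Ideal (R ⧸ q)) [P.IsPrime], (n : ℕ∞) ≤ P.height →
      q.height + n ≤ (P.comap (Ideal.Quotient.mk q)).height := by
  induction n with
  | zero =>
    intro P _ _
    rw [Nat.cast_zero, add_zero]
    refine Ideal.height_mono fun x hx => ?_
    rw [Ideal.mem_comap, Ideal.Quotient.eq_zero_iff_mem.2 hx]
    exact zero_mem _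
  | succ n ih =>
    intro P hP hn
    obtain ⟨P', hP', hlt, hn'⟩ : ∃ P' : Ideal (R ⧸ q), P'.IsPrime ∧ P' < P ∧ n ≤ P'.height := by
      by_contra! hcon
      have := hn.trans (Ideal.height_le_iff.2 hcon)
      have : n + 1 ≤ n := by exact_mod_cast this
      omega
    have hlt' : P'.comap (Ideal.Quotient.mk q) < P.comap (Ideal.Quotient.mk q) := by
      refine lt_of_le_of_ne (Ideal.comap_mono hlt.le) fun h => hlt.ne ?_
      exact Ideal.comap_injective_of_surjective _ Ideal.Quotient.mk_surjective h
    calc q.height + (n + 1 : ℕ) = q.height + n + 1 := by push_cast; rw [add_assoc]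
      _ ≤ (P'.comap (Ideal.Quotient.mk q)).height + 1 := by gcongr; exact ih P' hn'
      _ ≤ _ := Ideal.height_add_one_le_of_lt_of_isPrime hlt'

/-- `K` bounds the colength of some ideal of `R_p` inside the maximal ideal which is generated by at
most `dim R_p` elements. -/
def HasParameterIdealOfColengthLE (K : ℕ) (p : Ideal R) [p.IsPrime] : Prop :=
  ∃ S : Finset (Localization.AtPrime p),
    (S.card : WithBot ℕ∞) ≤ ringKrullDim (Localization.AtPrime p) ∧
    Ideal.span (S : Set (Localization.AtPrime p)) ≤ maximalIdeal _ ∧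
    Module.length (Localization.AtPrime p)
      (Localization.AtPrime p ⧸ Ideal.span (S : Set (Localization.AtPrime p))) ≤ K

/-- On a neighbourhood of a prime `q` in `V(q)`, the elements that generate `q` up to radical,
together with a regular system of parameters modulo `q`, generate an ideal of bounded colength. -/
theorem exists_hasParameterIdealOfColengthLE_of_isPrime [IsNoetherianRing R] (hJ : IsJ2 R)
    (q : Ideal R) [q.IsPrime] : ∃ g ∉ q, ∃ K, ∀ (p : Ideal R) [p.IsPrime], q ≤ p → g ∉ p →
      HasParameterIdealOfColengthLE K p := by
  classical
  obtain ⟨Y, hqY, hYcard⟩ := Ideal.exists_finset_card_eq_height_of_isNoetherianRing q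
  obtain ⟨N, g₁, hg₁, hg₁Y⟩ := exists_notMem_mul_pow_le_of_mem_minimalPrimes hqY
  have hopen := hJ (R ⧸ q)
  have hgen : (⟨⊥, Ideal.isPrime_bot⟩ : PrimeSpectrum (R ⧸ q)) ∈ regularLocus (R ⧸ q) := by
    have : IsField (Localization.AtPrime (⊥ : Ideal (R ⧸ q))) := by
      rw [isField_iff_maximalIdeal_eq, ← Localization.AtPrime.map_eq_maximalIdeal, Ideal.map_bot]
    let := this.toField
    change IsRegularLocalRing (Localization.AtPrime (⊥ : Ideal (R ⧸ q)))
    infer_instance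
  -- a basic open set on which `R / q` is regular
  obtain ⟨U, ⟨a, rfl⟩, haU, hU⟩ :=
    PrimeSpectrum.isTopologicalBasis_basic_opens.exists_subset_of_mem_open hgen hopen
  obtain ⟨g₂, rfl⟩ := Ideal.Quotient.mk_surjective a
  have hg₂ : g₂ ∉ q := by
    intro h
    refine haU ?_
    rw [Ideal.Quotient.eq_zero_iff_mem.2 h]
    exact zero_mem _
  choose T hT using fun j => IsNoetherian.noetherian (q ^ j)
  refine ⟨g₁ * g₂, fun h => (Ideal.IsPrime.mem_or_mem ‹_› h).elim hg₁ hg₂,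
    ∑ j ∈ Finset.range N, (T j).card, fun p hp hqp hgp => ?_⟩
  have hg₁p : g₁ ∉ p := fun h => hgp (p.mul_mem_right _ h)
  have hg₂p : g₂ ∉ p := fun h => hgp (p.mul_mem_left _ h)
  let A := Localization.AtPrime p
  let P : Ideal (R ⧸ q) := p.map (Ideal.Quotient.mk q)
  have hPcomap : P.comap (Ideal.Quotient.mk q) = p := by
    rw [Ideal.comap_map_of_surjective _ Ideal.Quotient.mk_surjective, ← RingHom.ker_eq_comap_bot,
      Ideal.mk_ker, sup_eq_left.2 hqp]
  have hP : P.IsPrime := Ideal.map_isPrime_of_surjective Ideal.Quotient.mk_surjective (by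
    rwa [Ideal.mk_ker])
  have hmemP : ∀ x, Ideal.Quotient.mk q x ∈ P ↔ x ∈ p := fun x => by
    rw [← Ideal.mem_comap, hPcomap]
  have hreg : IsRegularLocalRing (Localization.AtPrime P) :=
    hU (show (⟨P, hP⟩ : PrimeSpectrum (R ⧸ q)) ∈ _ from fun h => hg₂p ((hmemP g₂).1 h))
  let C := Localization.AtPrime P
  -- a regular system of parameters of `(R / q)_p`, lifted to `R`
  obtain ⟨s, hs, hsm⟩ := Submodule.FG.exists_span_finset_card_eq_spanFinrank
    (IsNoetherian.noetherian (maximalIdeal C))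
  have hnum : ∀ c : C, ∃ x : R, c ∈ maximalIdeal C → x ∈ p ∧
      c ∈ Ideal.span {algebraMap (R ⧸ q) C (Ideal.Quotient.mk q x)} := by
    intro c
    obtain ⟨x, t, rfl⟩ := IsLocalization.exists_mk'_eq P.primeCompl c
    obtain ⟨x, rfl⟩ := Ideal.Quotient.mk_surjective x
    refine ⟨x, fun h =>
      ⟨(hmemP x).1 ((IsLocalization.AtPrime.mk'_mem_maximal_iff C P _ t).1 h), ?_⟩⟩
    rw [Ideal.mem_span_singleton]
    exact ⟨IsLocalization.mk' C 1 t, IsLocalization.mk'_eq_mul_mk'_one _ _⟩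
  choose x hx using hnum
  let X : Finset R := s.image x
  have hsm' : ∀ c ∈ s, c ∈ maximalIdeal C := fun c hc => by
    rw [← hsm]
    exact Submodule.subset_span hc
  have hXp : ∀ y ∈ X, y ∈ p := by
    intro y hy
    obtain ⟨c, hc, rfl⟩ := Finset.mem_image.1 hy
    exact (hx c (hsm' c hc)).1
  have hYq : ∀ y ∈ Y, y ∈ q := fun y hy => hqY.1.2 (Ideal.subset_span hy)
  have hpX : ∀ a ∈ p, ∃ t ∉ p, t * a ∈ q ⊔ Ideal.span (X : Set R) := by
    intro a ha
    have h1 : algebraMap (R ⧸ q) C (Ideal.Quotient.mk q a) ∈ maximalIdeal C :=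
      (IsLocalization.AtPrime.to_map_mem_maximal_iff C P _).2 ((hmemP a).2 ha)
    have h2 : maximalIdeal C ≤ ((Ideal.span (X : Set R)).map (Ideal.Quotient.mk q)).map
        (algebraMap (R ⧸ q) C) := by
      rw [← hsm]
      refine Submodule.span_le.2 fun c hc => ?_
      refine (Ideal.span_singleton_le_iff_mem _).2 ?_ (hx c (hsm' c hc)).2
      exact Ideal.mem_map_of_mem _ (Ideal.mem_map_of_mem _
        (Ideal.subset_span (Finset.mem_coe.2 (Finset.mem_image_of_mem x hc))))
    obtain ⟨⟨⟨b, hb⟩, ⟨t, ht⟩⟩, hbt⟩ :=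
      (IsLocalization.mem_map_algebraMap_iff P.primeCompl C).1 (h2 h1)
    obtain ⟨t, rfl⟩ := Ideal.Quotient.mk_surjective t
    obtain ⟨b, hb', rfl⟩ := (Ideal.mem_map_iff_of_surjective _ Ideal.Quotient.mk_surjective).1 hb
    refine ⟨t, fun h => ht ((hmemP t).2 h), ?_⟩
    have h3 : Ideal.Quotient.mk q (t * a) = Ideal.Quotient.mk q b := by
      apply IsLocalization.injective C P.primeCompl_le_nonZeroDivisors
      rw [map_mul, mul_comm, map_mul]
      exact hbt
    rw [Ideal.Quotient.eq] at h3
    have := add_mem (Ideal.mem_sup_left h3)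
      (Ideal.mem_sup_right hb' : b ∈ q ⊔ Ideal.span (X : Set R))
    rwa [sub_add_cancel] at this
  let S : Finset A := (Y ∪ X).image (algebraMap R A)
  have hspan : Ideal.span (S : Set A) = (Ideal.span (Y : Set R) ⊔ Ideal.span (X : Set R)).map
      (algebraMap R A) := by
    rw [Finset.coe_image, ← Ideal.map_span, Finset.coe_union, Ideal.span_union]
  have hSm : Ideal.span (S : Set A) ≤ maximalIdeal A := by
    rw [hspan, ← Localization.AtPrime.map_eq_maximalIdeal]
    refine Ideal.map_mono (sup_le (Ideal.span_le.2 fun y hy => hqp (hYq y hy))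
      (Ideal.span_le.2 hXp))
  have hunit : ∀ t ∉ p, ∀ (J : Ideal A) (a : A), algebraMap R A t * a ∈ J → a ∈ J :=
    fun t ht J a h => (Ideal.unit_mul_mem_iff_mem J
      (IsLocalization.map_units A (⟨t, ht⟩ : p.primeCompl))).1 h
  refine ⟨S, ?_, hSm, ?_⟩
  · have h1 : S.card ≤ Y.card + s.card := Finset.card_image_le.trans
      ((Finset.card_union_le _ _).trans (by gcongr; exact Finset.card_image_le))
    have h2 : (s.card : WithBot ℕ∞) = P.height := by
      rw [hs, IsRegularLocalRing.spanFinrank_maximalIdeal,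
        IsLocalization.AtPrime.ringKrullDim_eq_height P C]
    have h3 := height_add_le_height_comap_mk q s.card P (le_of_eq (by exact_mod_cast h2))
    rw [hPcomap, ← hYcard] at h3
    rw [IsLocalization.AtPrime.ringKrullDim_eq_height p A]
    refine le_trans (?_ : (S.card : WithBot ℕ∞) ≤ ((Y.card + s.card : ℕ∞) : WithBot ℕ∞)) ?_
    · exact_mod_cast h1
    · exact_mod_cast h3
  -- Filter `R_p / (S)` by the powers of `q`: the quotients are generated by the images of the `T j`
  -- and are killed by `p`.
  · have h1 := length_quotient_sup_pow_le (Ideal.span (S : Set A)) (q.map (algebraMap R A))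
      (fun j => (T j).image (algebraMap R A)) (fun j => by
        rw [Finset.coe_image, ← Ideal.map_span, ← Ideal.map_pow, Ideal.span, hT]) N
    have h2 : (q.map (algebraMap R A)) ^ N ≤ Ideal.span (S : Set A) := by
      rw [← Ideal.map_pow, hspan]
      refine Ideal.map_le_iff_le_comap.2 fun y hy => Ideal.mem_comap.2 (hunit g₁ hg₁p _ _ ?_)
      rw [← map_mul]
      exact Ideal.mem_map_of_mem _ (Ideal.mem_sup_left (hg₁Y y hy))
    have h3 : Ideal.span (S : Set A) ⊔ q.map (algebraMap R A) = maximalIdeal A := by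
      refine le_antisymm (sup_le hSm ?_) ?_
      · rw [← Localization.AtPrime.map_eq_maximalIdeal]
        exact Ideal.map_mono hqp
      · rw [← Localization.AtPrime.map_eq_maximalIdeal, hspan, ← Ideal.map_sup]
        refine Ideal.map_le_iff_le_comap.2 fun y hy => ?_
        obtain ⟨t, ht, hty⟩ := hpX y hy
        refine Ideal.mem_comap.2 (hunit t ht _ _ ?_)
        rw [← map_mul]
        refine Ideal.mem_map_of_mem _ ((?_ : q ⊔ Ideal.span (X : Set R) ≤ _) hty)
        exact sup_le le_sup_right (le_sup_right.trans le_sup_left)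
    have h4 : Module.length A (A ⧸ maximalIdeal A) = 1 :=
      Module.length_eq_one_iff.2 (isSimpleModule_iff_isCoatom.2 (maximalIdeal.isMaximal A).out)
    rw [sup_eq_left.2 h2, h3, h4, mul_one] at h1
    refine h1.trans ?_
    exact_mod_cast Finset.sum_le_sum fun j _ => Finset.card_image_le

/-- Noetherian induction on the closed subset `V(J)`. -/
theorem exists_hasParameterIdealOfColengthLE (hR : IsExcellent R) :
    ∃ K, ∀ (p : Ideal R) [p.IsPrime], HasParameterIdealOfColengthLE K p := by
  have := hR.isNoetherianRing
  have hmono : ∀ {K K' : ℕ} {p : Ideal R} [p.IsPrime], K ≤ K' → HasParameterIdealOfColengthLE K p →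
      HasParameterIdealOfColengthLE K' p := by
    rintro K K' p _ h ⟨S, h1, h2, h3⟩
    exact ⟨S, h1, h2, h3.trans (by exact_mod_cast h)⟩
  suffices h : ∀ J : Ideal R, ∃ K, ∀ (p : Ideal R) [p.IsPrime], J ≤ p →
      HasParameterIdealOfColengthLE K p by
    obtain ⟨K, hK⟩ := h ⊥
    exact ⟨K, fun p _ => hK p bot_le⟩
  intro J
  induction J using IsNoetherian.induction with
  | hgt J ih =>
    by_cases htop : J = ⊤
    · exact ⟨0, fun p hp hJp => absurd (top_le_iff.1 (htop ▸ hJp)) hp.ne_top⟩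
    by_cases hJ : Ideal.IsPrime J
    -- The primes above `J` that avoid `g` are treated by the local statement at `J`.
    · obtain ⟨g, hg, K, hK⟩ := exists_hasParameterIdealOfColengthLE_of_isPrime hR.isJ2 J
      obtain ⟨K', hK'⟩ := ih (J ⊔ Ideal.span {g}) (lt_of_le_of_ne le_sup_left fun h => hg (by
        rw [h]
        exact Ideal.mem_sup_right (Ideal.mem_span_singleton_self g)))
      refine ⟨max K K', fun p hp hJp => ?_⟩
      by_cases hgp : g ∈ p
      · exact hmono (le_max_right _ _)
          (hK' p (sup_le hJp ((Ideal.span_singleton_le_iff_mem _).2 hgp)))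
      · exact hmono (le_max_left _ _) (hK p hJp hgp)
    -- If `a b ∈ J`, then each prime above `J` contains `(J, a)` or `(J, b)`.
    · obtain ⟨a, b, hab, ha, hb⟩ : ∃ a b, a * b ∈ J ∧ a ∉ J ∧ b ∉ J := by
        by_contra! hcon
        refine hJ ⟨htop, fun {a b} hab => ?_⟩
        by_cases ha : a ∈ J
        · exact Or.inl ha
        · exact Or.inr (hcon a b hab ha)
      have hlt : ∀ c ∉ J, J < J ⊔ Ideal.span {c} := fun c hc =>
        lt_of_le_of_ne le_sup_left fun h => hc (by
          rw [h]
          exact Ideal.mem_sup_right (Ideal.mem_span_singleton_self c))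
      obtain ⟨K, hK⟩ := ih _ (hlt a ha)
      obtain ⟨K', hK'⟩ := ih _ (hlt b hb)
      refine ⟨max K K', fun p hp hJp => ?_⟩
      rcases hp.mem_or_mem (hJp hab) with h | h
      · exact hmono (le_max_left _ _) (hK p (sup_le hJp ((Ideal.span_singleton_le_iff_mem _).2 h)))
      · exact hmono (le_max_right _ _)
          (hK' p (sup_le hJp ((Ideal.span_singleton_le_iff_mem _).2 h)))

end BoundedColength

/-! ### Laurent polynomials inside the field of rational functions -/

section Laurent

open LaurentPolynomial

variable {K : Type u} [Field K]

/-- The embedding of the ring of Laurent polynomials into the field of rational functions. -/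
noncomputable def laurentToRatFunc (K : Type u) [Field K] : LaurentPolynomial K →+* RatFunc K :=
  LaurentPolynomial.eval₂ RatFunc.C (Units.mk0 RatFunc.X RatFunc.X_ne_zero)

theorem laurentToRatFunc_C_mul_T (c : K) (n : ℤ) :
    laurentToRatFunc K (LaurentPolynomial.C c * T n) = RatFunc.C c * RatFunc.X ^ n := by
  rw [laurentToRatFunc, eval₂_C_mul_T]
  simp

theorem laurentToRatFunc_single (c : K) (n : ℤ) :
    laurentToRatFunc K (.single n c) = RatFunc.C c * RatFunc.X ^ n := by
  rw [single_eq_C_mul_T, laurentToRatFunc_C_mul_T]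

theorem laurentToRatFunc_toLaurent (p : Polynomial K) :
    laurentToRatFunc K (Polynomial.toLaurent p) = algebraMap _ _ p := by
  rw [laurentToRatFunc, eval₂_toLaurent]
  induction p using Polynomial.induction_on' with
  | add p q hp hq => rw [Polynomial.eval₂_add, hp, hq, map_add]
  | monomial n a =>
    rw [Polynomial.eval₂_monomial, ← Polynomial.C_mul_X_pow_eq_monomial, map_mul, map_pow,
      RatFunc.algebraMap_C, RatFunc.algebraMap_X]
    rfl

theorem laurentToRatFunc_injective : Function.Injective (laurentToRatFunc K) := by
  rw [injective_iff_map_eq_zero]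
  intro f hf
  obtain ⟨n, p, hp⟩ := exists_T_pow f
  have h1 : laurentToRatFunc K (Polynomial.toLaurent p) = 0 := by
    rw [hp, map_mul, hf, zero_mul]
  rw [laurentToRatFunc_toLaurent, map_eq_zero_iff _ (RatFunc.algebraMap_injective K)] at h1
  rw [h1, map_zero] at hp
  have h2 := congrArg (· * T (-(n : ℤ))) hp
  simpa using h2.symm

/-- The ring of Laurent polynomials over a field is integrally closed. -/
theorem mem_range_laurentToRatFunc_of_isIntegral {x : RatFunc K}
    (hx : (laurentToRatFunc K).IsIntegralElem x) : x ∈ (laurentToRatFunc K).range := by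
  let : Algebra (LaurentPolynomial K) (RatFunc K) := (laurentToRatFunc K).toAlgebra
  have : IsScalarTower (Polynomial K) (LaurentPolynomial K) (RatFunc K) := by
    refine IsScalarTower.of_algebraMap_eq fun p => ?_
    rw [algebraMap_eq_toLaurent]
    exact (laurentToRatFunc_toLaurent p).symm
  have hle : Submonoid.powers (Polynomial.X : Polynomial K) ≤ nonZeroDivisors _ :=
    powers_le_nonZeroDivisors_of_noZeroDivisors Polynomial.X_ne_zero
  have : IsFractionRing (LaurentPolynomial K) (RatFunc K) :=
    IsFractionRing.isFractionRing_of_isDomain_of_isLocalization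
      (Submonoid.powers (Polynomial.X : Polynomial K)) _ _
  have : IsIntegrallyClosed (LaurentPolynomial K) :=
    isIntegrallyClosed_of_isLocalization _
      (Submonoid.powers (Polynomial.X : Polynomial K)) hle
  obtain ⟨y, hy⟩ := IsIntegrallyClosed.isIntegral_iff.1
    (show IsIntegral (LaurentPolynomial K) x from hx)
  exact ⟨y, hy⟩

/-- The product of the leading terms is the leading term of the product. -/
theorem coeff_mul_of_top {f g : LaurentPolynomial K} {m n : ℤ} (hf : ∀ i, m < i → f.coeff i = 0)
    (hg : ∀ i, n < i → g.coeff i = 0) :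
    (f * g).coeff (m + n) = f.coeff m * g.coeff n ∧ ∀ i, m + n < i → (f * g).coeff i = 0 := by
  have hf' : ∀ i ∈ f.coeff.support, i ≤ m := fun i hi => by
    by_contra! h
    exact (Finsupp.mem_support_iff.1 hi) (hf i h)
  have hg' : ∀ i ∈ g.coeff.support, i ≤ n := fun i hi => by
    by_contra! h
    exact (Finsupp.mem_support_iff.1 hi) (hg i h)
  constructor
  · refine AddMonoidAlgebra.coeff_mul_add_of_uniqueAdd ?_
    intro a b ha hb hab
    have := hf' a ha
    have := hg' b hb
    omega
  · intro i hi
    by_contra h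
    refine h ?_
    rw [AddMonoidAlgebra.coeff_mul]
    refine Finset.sum_eq_zero fun a ha => Finset.sum_eq_zero fun b hb => if_neg ?_
    have := hf' a ha
    have := hg' b hb
    omega

theorem coeff_pow_of_top {f : LaurentPolynomial K} {m : ℤ} (hf : ∀ i, m < i → f.coeff i = 0)
    (k : ℕ) : (f ^ k).coeff (k * m) = f.coeff m ^ k ∧ ∀ i, k * m < i → (f ^ k).coeff i = 0 := by
  induction k with
  | zero =>
    simp only [pow_zero, Nat.cast_zero, zero_mul]
    rw [← LaurentPolynomial.T_zero]
    exact ⟨by rw [T_apply, if_pos rfl], fun i hi => by rw [T_apply, if_neg hi.ne]⟩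
  | succ k ih =>
    have := coeff_mul_of_top ih.2 hf
    rw [pow_succ, pow_succ, ← ih.1, ← this.1]
    push_cast
    rw [add_mul, one_mul]
    exact ⟨rfl, this.2⟩

end Laurent

/-! ### The extended Rees algebra as a ring of Laurent polynomials -/

section ReesStructure

variable {A : Type u} [CommRing A] [IsDomain A] {I : Ideal A}

local notation "K" => FractionRing A

theorem extendedRees_smul (a : A) (x : RatFunc K) :
    a • x = RatFunc.C (algebraMap A K a) * x := by
  rw [Algebra.smul_def, IsScalarTower.algebraMap_apply A K (RatFunc K)]
  rfl

/-- The degree `n` part `I ^ n` of the extended Rees algebra, as a submodule of the fraction field;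
it is the image of `A` if `n ≤ 0`. -/
noncomputable def reesPiece (I : Ideal A) (n : ℤ) : Submodule A K :=
  Submodule.map (Algebra.linearMap A K) (I ^ n.toNat)

omit [IsDomain A] in
theorem mem_reesPiece {n : ℤ} {x : K} :
    x ∈ reesPiece I n ↔ ∃ a ∈ I ^ n.toNat, algebraMap A K a = x := Iff.rfl

omit [IsDomain A] in
theorem mul_mem_reesPiece {m n : ℤ} {x y : K} (hx : x ∈ reesPiece I m) (hy : y ∈ reesPiece I n) :
    x * y ∈ reesPiece I (m + n) := by
  obtain ⟨a, ha, rfl⟩ := mem_reesPiece.1 hx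
  obtain ⟨b, hb, rfl⟩ := mem_reesPiece.1 hy
  refine ⟨a * b, ?_, map_mul (algebraMap A K) _ _⟩
  refine Ideal.pow_le_pow_right (m := (m + n).toNat) (n := m.toNat + n.toNat) (by omega) ?_
  rw [pow_add]
  exact Ideal.mul_mem_mul ha hb

/-- The Laurent polynomials in `A[IT, T⁻¹]`: those whose coefficient at `n` lies in `I ^ n`. -/
noncomputable def laurentRees (I : Ideal A) : Subalgebra A (LaurentPolynomial K) where
  carrier := {f | ∀ n : ℤ, f.coeff n ∈ reesPiece I n}
  mul_mem' := by
    intro f g hf hg n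
    rw [AddMonoidAlgebra.coeff_mul]
    refine sum_mem fun a _ => sum_mem fun b _ => ?_
    dsimp only
    split_ifs with h
    · rw [← h]
      exact mul_mem_reesPiece (hf a) (hg b)
    · exact zero_mem _
  add_mem' := by
    intro f g hf hg n
    exact add_mem (hf n) (hg n)
  algebraMap_mem' := by
    intro a n
    rw [LaurentPolynomial.algebraMap_apply, LaurentPolynomial.C_apply]
    split_ifs with h
    · subst h
      exact ⟨a, by simp, rfl⟩
    · exact zero_mem _

omit [IsDomain A] in
theorem mem_laurentRees {f : LaurentPolynomial K} :
    f ∈ laurentRees I ↔ ∀ n : ℤ, f.coeff n ∈ reesPiece I n := Iff.rfl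

theorem X_inv_mem_extendedRees : (RatFunc.X⁻¹ : RatFunc K) ∈ extendedRees I :=
  Algebra.subset_adjoin (Or.inl rfl)

theorem C_mem_extendedRees (a : A) : RatFunc.C (algebraMap A K a) ∈ extendedRees I := by
  have := (extendedRees I).smul_mem (one_mem _) a
  rwa [extendedRees_smul, mul_one] at this

theorem C_mul_X_pow_mem_extendedRees (n : ℕ) {a : A} (ha : a ∈ I ^ n) :
    RatFunc.C (algebraMap A K a) * RatFunc.X ^ n ∈ extendedRees I := by
  induction n generalizing a with
  | zero =>
    rw [pow_zero, mul_one]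
    exact C_mem_extendedRees a
  | succ n ih =>
    rw [pow_succ] at ha
    refine Submodule.mul_induction_on ha ?_ ?_
    · intro x hx y hy
      have h1 : RatFunc.C (algebraMap A K y) * RatFunc.X ∈ extendedRees I :=
        Algebra.subset_adjoin (Or.inr ⟨y, hy, rfl⟩)
      have := mul_mem (ih hx) h1
      rw [map_mul, map_mul, pow_succ]
      convert this using 1
      ring
    · intro x y hx hy
      rw [map_add, map_add, add_mul]
      exact add_mem hx hy

theorem laurentToRatFunc_single_mem_extendedRees {n : ℤ} {c : K} (hc : c ∈ reesPiece I n) :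
    RatFunc.C c * RatFunc.X ^ n ∈ extendedRees I := by
  obtain ⟨a, ha, rfl⟩ := mem_reesPiece.1 hc
  rcases le_or_gt 0 n with hn | hn
  · obtain ⟨k, rfl⟩ := Int.eq_ofNat_of_zero_le hn
    rw [zpow_natCast]
    exact C_mul_X_pow_mem_extendedRees k ha
  · obtain ⟨k, rfl⟩ : ∃ k : ℕ, n = -k := ⟨n.natAbs, by omega⟩
    rw [zpow_neg, zpow_natCast, ← inv_pow]
    exact mul_mem (C_mem_extendedRees a) (pow_mem X_inv_mem_extendedRees k)

theorem laurent_eq_sum (f : LaurentPolynomial K) :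
    laurentToRatFunc K f = ∑ n ∈ f.coeff.support, RatFunc.C (f.coeff n) * RatFunc.X ^ n := by
  conv_lhs => rw [← AddMonoidAlgebra.sum_coeff_single f]
  rw [Finsupp.sum, map_sum]
  exact Finset.sum_congr rfl fun n _ => laurentToRatFunc_single _ _

theorem mem_extendedRees_iff {x : RatFunc K} :
    x ∈ extendedRees I ↔ ∃ f ∈ laurentRees I, laurentToRatFunc K f = x := by
  constructor
  · intro hx
    refine Algebra.adjoin_induction (p := fun x _ => ∃ f ∈ laurentRees I, laurentToRatFunc K f = x)
      ?_ ?_ ?_ ?_ hx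
    · rintro x (rfl | ⟨a, ha, rfl⟩)
      · refine ⟨.single (-1) 1, fun n => ?_, ?_⟩
        · rw [AddMonoidAlgebra.coeff_single, Finsupp.single_apply]
          split_ifs with h
          · subst h
            exact ⟨1, by simp, map_one (algebraMap A K)⟩
          · exact zero_mem _
        · rw [laurentToRatFunc_single]
          simp
      · refine ⟨.single 1 (algebraMap A K a), fun n => ?_, ?_⟩
        · rw [AddMonoidAlgebra.coeff_single, Finsupp.single_apply]
          split_ifs with h
          · subst h
            exact ⟨a, by simpa using ha, rfl⟩
          · exact zero_mem _
        · rw [laurentToRatFunc_single, zpow_one]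
    · intro a
      refine ⟨algebraMap A _ a, Subalgebra.algebraMap_mem _ a, ?_⟩
      rw [LaurentPolynomial.algebraMap_apply, ← LaurentPolynomial.single_eq_C,
        laurentToRatFunc_single, zpow_zero, ← extendedRees_smul, Algebra.smul_def, mul_one]
    · rintro x y _ _ ⟨f, hf, rfl⟩ ⟨g, hg, rfl⟩
      exact ⟨f + g, add_mem hf hg, map_add _ _ _⟩
    · rintro x y _ _ ⟨f, hf, rfl⟩ ⟨g, hg, rfl⟩
      exact ⟨f * g, mul_mem hf hg, map_mul _ _ _⟩
  · rintro ⟨f, hf, rfl⟩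
    rw [laurent_eq_sum]
    exact sum_mem fun n _ => laurentToRatFunc_single_mem_extendedRees (hf n)

theorem extendedRees_finiteType [IsNoetherianRing A] (I : Ideal A) :
    Algebra.FiniteType A (extendedRees I) := by
  classical
  obtain ⟨s, hs⟩ := IsNoetherian.noetherian I
  rw [← Subalgebra.fg_iff_finiteType]
  refine ⟨insert RatFunc.X⁻¹
    (s.image fun a => RatFunc.C (algebraMap A K a) * RatFunc.X), le_antisymm ?_ ?_⟩
  · refine Algebra.adjoin_mono ?_
    intro x hx
    rw [Finset.coe_insert, Finset.coe_image] at hx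
    rcases hx with rfl | ⟨a, ha, rfl⟩
    · exact Or.inl rfl
    · exact Or.inr ⟨a, hs ▸ Submodule.subset_span ha, rfl⟩
  · refine Algebra.adjoin_le ?_
    rintro x (rfl | ⟨a, ha, rfl⟩)
    · exact Algebra.subset_adjoin (by simp)
    · rw [← hs] at ha
      refine Submodule.span_induction ?_ ?_ ?_ ?_ ha
      · intro x hx
        refine Algebra.subset_adjoin ?_
        rw [Finset.coe_insert, Finset.coe_image]
        exact Or.inr ⟨x, hx, rfl⟩
      · simp
      · intro x y _ _ hx hy
        rw [map_add, map_add, add_mul]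
        exact add_mem hx hy
      · intro a x _ hx
        rw [smul_eq_mul, map_mul, map_mul, mul_assoc, ← extendedRees_smul]
        exact Subalgebra.smul_mem _ hx a

instance extendedRees_isNoetherianRing [IsNoetherianRing A] (I : Ideal A) :
    IsNoetherianRing (extendedRees I) := by
  have := extendedRees_finiteType I
  exact Algebra.FiniteType.isNoetherianRing A _

theorem mem_normalizedRees_iff {x : RatFunc K} :
    x ∈ normalizedRees I ↔ IsIntegral (extendedRees I) x := Iff.rfl

theorem exists_laurent_of_mem_normalizedRees {x : RatFunc K} (hx : x ∈ normalizedRees I) :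
    ∃ f, laurentToRatFunc K f = x := by
  refine mem_range_laurentToRatFunc_of_isIntegral ?_
  obtain ⟨p, hp, hp'⟩ := mem_normalizedRees_iff.1 hx
  have h1 : p.map (algebraMap (extendedRees I) (RatFunc K)) ∈
      Polynomial.lifts (laurentToRatFunc K) := by
    rw [Polynomial.lifts_iff_coeff_lifts]
    intro n
    rw [Polynomial.coeff_map]
    obtain ⟨f, -, hf⟩ := mem_extendedRees_iff.1 (p.coeff n).2
    exact ⟨f, hf⟩
  obtain ⟨q, hq, -, hq'⟩ := Polynomial.lifts_and_natDegree_eq_and_monic h1 (hp.map _)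
  refine ⟨q, hq', ?_⟩
  rw [← Polynomial.eval_map, hq, Polynomial.eval_map, hp']

/-- A homogeneous element `x T ^ n` is integral over the extended Rees algebra only if `x` satisfies
an integral equation with coefficients in the powers of `I ^ n`: take the homogeneous component of
an integral equation. -/
theorem exists_equation_of_mem_normalizedRees {c : K} {n : ℤ}
    (h : RatFunc.C c * RatFunc.X ^ n ∈ normalizedRees I) :
    ∃ t : ℕ, 0 < t ∧ ∃ a : ℕ → K, (∀ i ∈ Finset.Icc 1 t, a i ∈ reesPiece I (i * n)) ∧
      c ^ t + ∑ i ∈ Finset.Icc 1 t, a i * c ^ (t - i) = 0 := by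
  obtain ⟨p, hp, hp'⟩ := mem_normalizedRees_iff.1 h
  rw [← Polynomial.aeval_def, Polynomial.aeval_eq_sum_range' (n := p.natDegree + 1)
    (by omega)] at hp'
  choose f hf hf' using fun i => mem_extendedRees_iff.1 (p.coeff i).2
  set t := p.natDegree with ht
  have ht0 : 0 < t := by
    by_contra h0
    have h1 : p = 1 := hp.natDegree_eq_zero.1 (by omega)
    rw [show t = 0 by omega] at hp'
    simp [h1] at hp'
  have h1 : ∑ i ∈ Finset.range (t + 1), f i * .single (i * n) (c ^ i) = 0 := by
    apply laurentToRatFunc_injective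
    rw [map_zero, ← hp', map_sum]
    refine Finset.sum_congr rfl fun i _ => ?_
    rw [map_mul, hf' i, laurentToRatFunc_single, mul_pow, map_pow, ← zpow_natCast (RatFunc.X ^ n),
      ← zpow_mul, mul_comm (n : ℤ)]
    rfl
  have h2 : ∀ i, (f i * .single (i * n) (c ^ i) : LaurentPolynomial K).coeff (t * n) =
      (f i).coeff ((t - i) * n) * c ^ i := by
    intro i
    exact AddMonoidAlgebra.coeff_mul_single_eq_coeff_mul ((t - i) * n)
      (by intro a _; constructor <;> intro h <;> linarith)
  -- the homogeneous component of degree `t n` of the equation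
  have h3 := congrArg (fun g : LaurentPolynomial K => g.coeff (t * n)) h1
  simp only [AddMonoidAlgebra.coeff_sum, Finsupp.finsetSum_apply, h2] at h3
  refine ⟨t, ht0, fun i => (f (t - i)).coeff (i * n), fun i hi => ?_, ?_⟩
  · exact hf _ _
  · have h4 : (f t).coeff 0 = 1 := by
      have h5 : (p.coeff t : RatFunc K) = 1 := by
        have : p.coeff t = 1 := hp
        rw [this]
        rfl
      have h6 : f t = 1 := by
        apply laurentToRatFunc_injective
        rw [hf', h5, map_one]
      rw [h6, ← LaurentPolynomial.T_zero, LaurentPolynomial.T_apply, if_pos rfl]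
    rw [Finset.sum_range_succ] at h3
    simp only [sub_self, zero_mul, h4, one_mul] at h3
    rw [add_comm]
    refine Eq.trans ?_ (h3.trans rfl)
    congr 1
    refine Finset.sum_nbij' (fun i => t - i) (fun i => t - i) ?_ ?_ ?_ ?_ ?_
    · intro i hi
      rw [Finset.mem_Icc] at hi
      rw [Finset.mem_range]
      omega
    · intro i hi
      rw [Finset.mem_range] at hi
      rw [Finset.mem_Icc]
      omega
    · intro i hi
      rw [Finset.mem_Icc] at hi
      omega
    · intro i hi
      rw [Finset.mem_range] at hi
      omega
    · intro i hi
      rw [Finset.mem_Icc] at hi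
      rw [Nat.cast_sub hi.2, sub_sub_cancel]

end ReesStructure

/-! ### Discrete valuations at associated primes of principal ideals -/

section DiscreteAt

variable {A L : Type u} [CommRing A] [Field L] [Algebra A L] {S : Subalgebra A L}

/-- `w` is a discrete valuation of the field `L`, nonnegative on `S` with centre `Q`, whose
valuation ring is the localization of `S` at `Q`. The value at `0` is irrelevant. -/
structure IsDiscreteAt (S : Subalgebra A L) (Q : Ideal S) (w : L → ℤ) : Prop where
  map_mul : ∀ x y, x ≠ 0 → y ≠ 0 → w (x * y) = w x + w y
  min_le_map_add : ∀ x y, x ≠ 0 → y ≠ 0 → x + y ≠ 0 → min (w x) (w y) ≤ w (x + y)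
  nonneg : ∀ s : S, s ≠ 0 → 0 ≤ w s
  pos_iff : ∀ s : S, s ≠ 0 → (0 < w s ↔ s ∈ Q)
  exists_frac : ∀ y, y ≠ 0 → 0 ≤ w y → ∃ s t : S, t ∉ Q ∧ y * t = s
  exists_eq_one : ∃ y, y ≠ 0 ∧ w y = 1

namespace IsDiscreteAt

variable {Q : Ideal S} {w : L → ℤ}

theorem map_one (h : IsDiscreteAt S Q w) : w 1 = 0 := by
  have := h.map_mul 1 1 one_ne_zero one_ne_zero
  rw [one_mul] at this
  omega

theorem map_inv (h : IsDiscreteAt S Q w) {x : L} (hx : x ≠ 0) : w x⁻¹ = -w x := by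
  have := h.map_mul x x⁻¹ hx (inv_ne_zero hx)
  rw [mul_inv_cancel₀ hx, h.map_one] at this
  omega

theorem map_div (h : IsDiscreteAt S Q w) {x y : L} (hx : x ≠ 0) (hy : y ≠ 0) :
    w (x / y) = w x - w y := by
  rw [div_eq_mul_inv, h.map_mul _ _ hx (inv_ne_zero hy), h.map_inv hy, sub_eq_add_neg]

theorem map_pow (h : IsDiscreteAt S Q w) {x : L} (hx : x ≠ 0) (n : ℕ) : w (x ^ n) = n * w x := by
  induction n with
  | zero => simp [h.map_one]
  | succ n ih =>
    rw [pow_succ, h.map_mul _ _ (pow_ne_zero n hx) hx, ih]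
    push_cast
    ring

theorem map_zpow (h : IsDiscreteAt S Q w) {x : L} (hx : x ≠ 0) (n : ℤ) : w (x ^ n) = n * w x := by
  obtain ⟨k, rfl | rfl⟩ := n.eq_nat_or_neg
  · rw [zpow_natCast, h.map_pow hx]
  · rw [zpow_neg, zpow_natCast, h.map_inv (pow_ne_zero k hx), h.map_pow hx]
    ring

theorem map_eq_zero (h : IsDiscreteAt S Q w) {s : S} (hs : s ∉ Q) : w s = 0 := by
  have h0 : s ≠ 0 := fun h => hs (h ▸ Q.zero_mem)
  have h1 := h.nonneg s h0
  have h2 := mt (h.pos_iff s h0).1 hs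
  omega

theorem exists_mem_eq_one (h : IsDiscreteAt S Q w) : ∃ q ∈ Q, q ≠ 0 ∧ w (q : L) = 1 := by
  obtain ⟨y, hy, hy1⟩ := h.exists_eq_one
  obtain ⟨s, t, ht, hst⟩ := h.exists_frac y hy (by omega)
  have ht0 : (t : L) ≠ 0 := fun h => ht (by
    rw [show t = 0 from Subtype.ext h]
    exact Q.zero_mem)
  have hs0 : s ≠ 0 := fun h => mul_ne_zero hy ht0 (by rw [hst, h]; rfl)
  have h1 := h.map_mul y t hy ht0
  rw [hst, hy1, h.map_eq_zero ht] at h1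
  exact ⟨s, (h.pos_iff s hs0).1 (by omega), hs0, h1⟩

theorem nonneg_of_mul_eq (h : IsDiscreteAt S Q w) {y : L} (hy : y ≠ 0) {s t : S} (ht : t ∉ Q)
    (hst : y * t = s) : 0 ≤ w y := by
  have ht0 : (t : L) ≠ 0 := fun h => ht (by
    rw [show t = 0 from Subtype.ext h]
    exact Q.zero_mem)
  have hs0 : s ≠ 0 := fun h => mul_ne_zero hy ht0 (by rw [hst, h]; rfl)
  have h1 := h.map_mul y t hy ht0
  rw [h.map_eq_zero ht, hst] at h1
  have := h.nonneg s hs0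
  omega

theorem le_map_add (h : IsDiscreteAt S Q w) {x y : L} {n : ℤ} (hx : x ≠ 0 → n ≤ w x)
    (hy : y ≠ 0 → n ≤ w y) (hxy : x + y ≠ 0) : n ≤ w (x + y) := by
  by_cases hx0 : x = 0
  · subst hx0
    rw [zero_add] at hxy ⊢
    exact hy hxy
  by_cases hy0 : y = 0
  · subst hy0
    rw [add_zero] at hxy ⊢
    exact hx hxy
  exact (le_min (hx hx0) (hy hy0)).trans (h.min_le_map_add x y hx0 hy0 hxy)

theorem le_map_sum (h : IsDiscreteAt S Q w) {ι : Type*} (s : Finset ι) (f : ι → L) {n : ℤ}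
    (hf : ∀ i ∈ s, f i ≠ 0 → n ≤ w (f i)) : ∑ i ∈ s, f i ≠ 0 → n ≤ w (∑ i ∈ s, f i) := by
  classical
  induction s using Finset.induction_on with
  | empty => simp
  | insert a s ha ih =>
    rw [Finset.sum_insert ha]
    exact fun h0 => h.le_map_add (hf a (Finset.mem_insert_self a s))
      (ih fun i hi => hf i (Finset.mem_insert_of_mem hi)) h0

end IsDiscreteAt

theorem exists_colon_of_mem_associatedPrimes {B : Type u} [CommRing B] [IsNoetherianRing B] {τ : B}
    {Q : Ideal B} (hQ : Q ∈ associatedPrimes B (B ⧸ Ideal.span {τ})) :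
    Q.IsPrime ∧ ∃ u : B, ∀ a, a ∈ Q ↔ τ ∣ a * u := by
  obtain ⟨hp, x, hx⟩ := isAssociatedPrime_iff.1 hQ
  obtain ⟨u, rfl⟩ := Ideal.Quotient.mk_surjective x
  refine ⟨hp, u, fun a => ?_⟩
  rw [hx, Submodule.mem_colon_singleton, Submodule.mem_bot, ← Ideal.mem_span_singleton,
    ← Ideal.Quotient.eq_zero_iff_mem, map_mul]
  rfl

/-- An element that is almost integral over a Noetherian integrally closed `S` lies in `S`. -/
theorem mem_of_forall_mul_pow_mem [IsNoetherianRing S] (hint : ∀ z : L, IsIntegral S z → z ∈ S)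
    {x : L} {s : S} (hs : s ≠ 0) (h : ∀ n : ℕ, ∃ b : S, s * x ^ n = (b : L)) : x ∈ S := by
  refine hint x (IsAlmostIntegral.isIntegral ⟨s, mem_nonZeroDivisors_of_ne_zero hs, fun n => ?_⟩)
  obtain ⟨b, hb⟩ := h n
  exact ⟨b, hb.symm⟩

/-- A Noetherian integrally closed domain has a discrete valuation at each associated prime of a
nonzero principal ideal `(τ)`: if the prime is the colon ideal `(τ) : u`, then `τ / u` is a
uniformizer. -/
theorem exists_isDiscreteAt [IsNoetherianRing S] (hint : ∀ z : L, IsIntegral S z → z ∈ S)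
    (hfrac : ∀ z : L, ∃ s t : S, t ≠ 0 ∧ z * t = (s : L)) {τ : S} (hτ : τ ≠ 0) {Q : Ideal S}
    (hp : Q.IsPrime) {u : S} (hu : ∀ a, a ∈ Q ↔ τ ∣ a * u) :
    ∃ w : L → ℤ, IsDiscreteAt S Q w := by
  have hτ' : (τ : L) ≠ 0 := fun h => hτ (Subtype.ext h)
  have hne : ∀ t : S, t ∉ Q → (t : L) ≠ 0 := fun t ht h => ht (by
    rw [show t = 0 from Subtype.ext h]
    exact Q.zero_mem)
  have h1Q : (1 : S) ∉ Q := Q.ne_top_iff_one.1 hp.ne_top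
  have hu0 : u ≠ 0 := by
    rintro rfl
    exact h1Q ((hu 1).2 (by simp))
  set x : L := u / τ with hx
  have hx0 : x ≠ 0 := div_ne_zero (fun h => hu0 (Subtype.ext h)) hτ'
  -- `Q` consists of the elements multiplied into `S` by `x = u / τ`
  have hQx : ∀ a : S, a ∈ Q ↔ ∃ b : S, a * x = (b : L) := by
    intro a
    rw [hu a]
    constructor
    · rintro ⟨b, hb⟩
      refine ⟨b, ?_⟩
      have : (a : L) * u = τ * b := by exact_mod_cast congrArg Subtype.val hb
      rw [hx, ← mul_div_assoc, this, mul_div_cancel_left₀ _ hτ']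
    · rintro ⟨b, hb⟩
      refine ⟨b, Subtype.ext ?_⟩
      push_cast
      rw [← hb, hx]
      field_simp
  have hxS : x ∉ S := fun h => h1Q ((hQx 1).2 ⟨⟨x, h⟩, by simp⟩)
  have hτQ : τ ∈ Q := (hQx τ).2 ⟨u, by rw [hx]; field_simp⟩
  -- If `x Q ⊆ Q`, then `x` is almost integral, hence lies in `S`, which is false. So `x q = v` for
  -- some `q ∈ Q` and `v ∉ Q`, and `x⁻¹ = q / v` will be the uniformizer.
  obtain ⟨q, hq, v, hv, hqv⟩ : ∃ q ∈ Q, ∃ v ∉ Q, (q : L) * x = (v : L) := by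
    by_contra! hcon
    refine hxS (mem_of_forall_mul_pow_mem hint hτ fun n => ?_)
    have : ∃ b ∈ Q, (τ : L) * x ^ n = (b : L) := by
      induction n with
      | zero => exact ⟨τ, hτQ, by simp⟩
      | succ n ih =>
        obtain ⟨b, hb, hb'⟩ := ih
        obtain ⟨b', hb''⟩ := (hQx b).1 hb
        refine ⟨b', by_contra fun h => hcon b hb b' h hb'', ?_⟩
        rw [pow_succ, ← mul_assoc, hb', hb'']
    obtain ⟨b, -, hb⟩ := this
    exact ⟨b, hb⟩
  have hv0 := hne v hv
  -- the units of the localization of `S` at `Q`; each nonzero `y` has exactly one `n` with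
  -- `U (x ^ n * y)`, and this `n` will be its value
  let U : L → Prop := fun y => ∃ s t : S, s ∉ Q ∧ t ∉ Q ∧ y * t = (s : L)
  have hmulQ : ∀ {s t : S}, s ∉ Q → t ∉ Q → s * t ∉ Q := fun hs ht h =>
    (hp.mem_or_mem h).elim hs ht
  have hpowQ : ∀ (k : ℕ) {s : S}, s ∉ Q → s ^ k ∉ Q := fun k s hs h => hs (hp.mem_of_pow_mem k h)
  have hUmul : ∀ {y z}, U y → U z → U (y * z) := by
    rintro y z ⟨s, t, hs, ht, h⟩ ⟨s', t', hs', ht', h'⟩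
    refine ⟨s * s', t * t', hmulQ hs hs', hmulQ ht ht', ?_⟩
    push_cast
    rw [← h, ← h']
    ring
  have hUinv : ∀ {y}, U y → U y⁻¹ := by
    rintro y ⟨s, t, hs, ht, h⟩
    refine ⟨t, s, ht, hs, ?_⟩
    have hy0 : y ≠ 0 := by
      rintro rfl
      exact hne s hs (by rw [← h, zero_mul])
    rw [← h]
    field_simp
  have hUS : ∀ {s : S}, s ∉ Q → U s := fun {s} hs => ⟨s, 1, hs, h1Q, by simp⟩
  have hpos : ∀ k : ℕ, 0 < k → ¬ U (x ^ k) := by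
    rintro k hk ⟨s, t, hs, ht, h⟩
    refine hmulQ (hpowQ k hv) ht ?_
    have : v ^ k * t = q ^ k * s := by
      apply Subtype.ext
      push_cast
      rw [← h, ← hqv]
      ring
    rw [this]
    exact Q.mul_mem_right _ (Q.pow_mem_of_mem hq k hk)
  have huniq : ∀ {y} {m n : ℤ}, y ≠ 0 → U (x ^ m * y) → U (x ^ n * y) → m = n := by
    have key : ∀ {y} {m n : ℤ}, y ≠ 0 → U (x ^ m * y) → U (x ^ n * y) → ¬ m < n := by
      intro y m n hy hm hn hlt
      obtain ⟨k, hk⟩ : ∃ k : ℕ, n = m + k := ⟨(n - m).toNat, by omega⟩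
      refine hpos k (by omega) ?_
      have := hUmul hn (hUinv hm)
      convert this using 1
      rw [hk, zpow_add₀ hx0, zpow_natCast]
      field_simp
    intro y m n hy hm hn
    have h1 := key hy hm hn
    have h2 := key hy hn hm
    omega
  -- If no `x ^ n s` is a unit, then all of them lie in `S`, which again makes `x` almost integral.
  have hexS : ∀ s : S, s ≠ 0 → ∃ n : ℕ, U (x ^ (n : ℤ) * s) ∧ (s ∈ Q → 0 < n) := by
    intro s hs
    have : ∃ n : ℕ, U (x ^ (n : ℤ) * s) := by
      by_contra! hcon
      refine hxS (mem_of_forall_mul_pow_mem hint hs fun n => ?_)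
      induction n with
      | zero => exact ⟨s, by simp⟩
      | succ n ih =>
        obtain ⟨b, hb⟩ := ih
        have hbQ : b ∈ Q := by
          by_contra h
          refine hcon n ?_
          rw [zpow_natCast, mul_comm, hb]
          exact hUS h
        obtain ⟨b', hb'⟩ := (hQx b).1 hbQ
        exact ⟨b', by rw [pow_succ, ← mul_assoc, hb, hb']⟩
    obtain ⟨n, hn⟩ := this
    refine ⟨n, hn, fun hsQ => Nat.pos_of_ne_zero ?_⟩
    rintro rfl
    obtain ⟨s', t, hs', ht, h⟩ := hn
    refine hs' ?_
    have : s' = s * t := by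
      apply Subtype.ext
      push_cast
      rw [← h]
      simp
    rw [this]
    exact Q.mul_mem_right _ hsQ
  have hex : ∀ y : L, ∃ n : ℤ, y ≠ 0 → U (x ^ n * y) := by
    intro y
    by_cases hy : y = 0
    · exact ⟨0, fun h => absurd hy h⟩
    obtain ⟨s, t, ht, hst⟩ := hfrac y
    have ht0 : (t : L) ≠ 0 := fun h => ht (Subtype.ext h)
    have hs : s ≠ 0 := by
      rintro rfl
      exact mul_ne_zero hy ht0 hst
    obtain ⟨n, hn, -⟩ := hexS s hs
    obtain ⟨m, hm, -⟩ := hexS t ht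
    refine ⟨n - m, fun _ => ?_⟩
    convert hUmul hn (hUinv hm) using 1
    rw [← hst, zpow_sub₀ hx0]
    field_simp
  choose w hw using hex
  have hweq : ∀ {y} {n : ℤ}, y ≠ 0 → U (x ^ n * y) → w y = n := fun hy h => huniq hy (hw _ hy) h
  have hmul : ∀ y z, y ≠ 0 → z ≠ 0 → w (y * z) = w y + w z := by
    intro y z hy hz
    refine hweq (mul_ne_zero hy hz) ?_
    convert hUmul (hw y hy) (hw z hz) using 1
    rw [zpow_add₀ hx0]
    ring
  have hnn : ∀ s : S, s ≠ 0 → 0 ≤ w s ∧ (s ∈ Q → 0 < w s) := by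
    intro s hs
    have hs0 : (s : L) ≠ 0 := fun h => hs (Subtype.ext h)
    obtain ⟨n, hn, hn'⟩ := hexS s hs
    rw [hweq hs0 hn]
    exact ⟨by omega, fun h => by have := hn' h; omega⟩
  have hzero : ∀ s : S, s ∉ Q → w s = 0 := fun s hs =>
    hweq (hne s hs) (by rw [zpow_zero, one_mul]; exact hUS hs)
  have hfr : ∀ {y} {s t : S}, y ≠ 0 → t ∉ Q → y * t = (s : L) → 0 ≤ w y := by
    intro y s t hy ht h
    have hs : s ≠ 0 := by
      rintro rfl
      exact mul_ne_zero hy (hne t ht) h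
    have h1 := hmul y t hy (hne t ht)
    rw [h, hzero t ht] at h1
    have := (hnn s hs).1
    omega
  have hwx : ∀ n : ℤ, w (x ^ n) = -n := fun n => hweq (zpow_ne_zero n hx0) (by
    rw [← zpow_add₀ hx0, neg_add_cancel, zpow_zero]
    exact hUS h1Q)
  have hq0 : (q : L) ≠ 0 := by
    intro h
    rw [h, zero_mul] at hqv
    exact hv0 hqv.symm
  have hxinv : x = v / q := by
    rw [← hqv]
    field_simp
  have hfrac' : ∀ y, y ≠ 0 → ∀ k : ℕ, -w y ≤ 0 → k ≤ w y → ∃ s t : S, t ∉ Q ∧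
      x ^ k * y * t = (s : L) := by
    intro y hy k h1 h2
    obtain ⟨s, t, hs, ht, h⟩ := hw y hy
    obtain ⟨j, hj⟩ : ∃ j : ℕ, w y = k + j := ⟨(w y - k).toNat, by omega⟩
    refine ⟨s * q ^ j, t * v ^ j, hmulQ ht (hpowQ j hv), ?_⟩
    push_cast
    rw [← h, hj, zpow_add₀ hx0, zpow_natCast, zpow_natCast, hxinv]
    simp only [div_pow]
    field_simp
  -- multiply by the power of `x` that makes both terms elements of the localization
  have hadd : ∀ y z, y ≠ 0 → z ≠ 0 → y + z ≠ 0 → w y ≤ w z → w y ≤ w (y + z) := by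
    intro y z hy hz hyz hle
    obtain ⟨s, t, hs, ht, h⟩ := hw y hy
    obtain ⟨s', t', hs', ht', h'⟩ := hw z hz
    obtain ⟨j, hj⟩ : ∃ j : ℕ, w z = w y + j := ⟨(w z - w y).toNat, by omega⟩
    have h1 : x ^ (w y) * (y + z) ≠ 0 := mul_ne_zero (zpow_ne_zero _ hx0) hyz
    have h2 : 0 ≤ w (x ^ (w y) * (y + z)) := by
      refine hfr (s := s * t' * v ^ j + s' * q ^ j * t) (t := t * t' * v ^ j) h1
        (hmulQ (hmulQ ht ht') (hpowQ j hv)) ?_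
      push_cast
      rw [← h, ← h', hj, zpow_add₀ hx0, zpow_natCast]
      have : x ^ j * (q : L) ^ j = v ^ j := by rw [← hqv]; ring
      linear_combination (x ^ (w y) * z * t' * t) * (-this)
    rw [hmul _ _ (zpow_ne_zero _ hx0) hyz, hwx] at h2
    omega
  refine ⟨w, ⟨hmul, ?_, fun s hs => (hnn s hs).1, ?_, ?_, x⁻¹, inv_ne_zero hx0, ?_⟩⟩
  · intro y z hy hz hyz
    rcases le_total (w y) (w z) with h | h
    · exact (min_le_left _ _).trans (hadd y z hy hz hyz h)
    · rw [add_comm] at hyz ⊢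
      exact (min_le_right _ _).trans (hadd z y hz hy hyz h)
  · intro s hs
    refine ⟨fun h => by_contra fun h' => ?_, (hnn s hs).2⟩
    rw [hzero s h'] at h
    omega
  · intro y hy h
    obtain ⟨s, t, ht, hst⟩ := hfrac' y hy 0 (by omega) (by simpa using h)
    exact ⟨s, t, ht, by simpa using hst⟩
  · simpa using hwx (-1)

/-- The centre of a discrete valuation whose valuation ring is the localization has height one. -/
theorem IsDiscreteAt.le_of_isPrime {Q : Ideal S} {w : L → ℤ} (h : IsDiscreteAt S Q w)
    {P : Ideal S} (hP : P.IsPrime) (hPQ : P ≤ Q) {p : S} (hp : p ∈ P) (hp0 : p ≠ 0) : Q ≤ P := by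
  have hp0' : (p : L) ≠ 0 := fun h => hp0 (Subtype.ext h)
  intro a ha
  by_cases ha0 : a = 0
  · rw [ha0]
    exact P.zero_mem
  have ha0' : (a : L) ≠ 0 := fun h => ha0 (Subtype.ext h)
  -- a high power of `a` is a multiple of `p` locally at `Q`
  have h1 := (h.pos_iff a ha0).2 ha
  have h2 := h.nonneg p hp0
  obtain ⟨s, t, ht, hst⟩ := h.exists_frac ((a : L) ^ (w p).toNat / p)
    (div_ne_zero (pow_ne_zero _ ha0') hp0') (by
      rw [h.map_div (pow_ne_zero _ ha0') hp0', h.map_pow ha0']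
      have : (w p).toNat = w p := Int.toNat_of_nonneg h2
      rw [this]
      nlinarith)
  have h3 : a ^ (w p).toNat * t = p * s := by
    apply Subtype.ext
    push_cast
    rw [← hst]
    field_simp
  have h4 : a ^ (w p).toNat * t ∈ P := by
    rw [h3]
    exact P.mul_mem_right _ hp
  rcases hP.mem_or_mem h4 with h5 | h5
  · exact hP.mem_of_pow_mem _ h5
  · exact absurd (hPQ h5) ht

/-- An element of `S[1/τ]` which is nonnegative at all associated primes of `(τ)` lies in `S`. -/
theorem mem_of_forall_associatedPrimes_nonneg [IsNoetherianRing S] {τ : S} (hτ : τ ≠ 0) {x : L}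
    {n : ℕ} (hn : (τ : L) ^ n * x ∈ S)
    (h : x ≠ 0 → ∀ Q ∈ associatedPrimes S (S ⧸ Ideal.span {τ}), ∃ w, IsDiscreteAt S Q w ∧ 0 ≤ w x) :
    x ∈ S := by
  have hτ' : (τ : L) ≠ 0 := fun h => hτ (Subtype.ext h)
  induction n with
  | zero => simpa using hn
  | succ n ih =>
    refine ih ?_
    by_contra hcon
    have hx0 : x ≠ 0 := by
      rintro rfl
      exact hcon (by simp)
    -- If `τ ^ n x ∉ S`, then `y = τ ^ (n + 1) x` is nonzero modulo `τ`, and an associated prime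
    -- contains its annihilator; but `τ ^ n x` lies in the localization there.
    set y : S := ⟨_, hn⟩
    have hy : Ideal.Quotient.mk (Ideal.span {τ}) y ≠ 0 := by
      rw [Ne, Ideal.Quotient.eq_zero_iff_mem, Ideal.mem_span_singleton]
      rintro ⟨b, hb⟩
      refine hcon ?_
      have h1 : (τ : L) ^ (n + 1) * x = τ * b := congrArg Subtype.val hb
      have h2 : (τ : L) ^ n * x = b := mul_left_cancel₀ hτ' (by rw [← h1]; ring)
      rw [h2]
      exact b.2
    obtain ⟨Q, hQ, hle⟩ := exists_le_isAssociatedPrime_of_isNoetherianRing S _ hy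
    obtain ⟨w, hw, hwx⟩ := h hx0 Q hQ
    have hτQ : τ ∈ Q := by
      refine hle ?_
      rw [Submodule.mem_colon_singleton, Submodule.mem_bot]
      change Ideal.Quotient.mk (Ideal.span {τ}) (τ * y) = 0
      rw [Ideal.Quotient.eq_zero_iff_mem, Ideal.mem_span_singleton]
      exact dvd_mul_right _ _
    obtain ⟨s, t, ht, hst⟩ := hw.exists_frac ((τ : L) ^ n * x)
      (mul_ne_zero (pow_ne_zero _ hτ') hx0) (by
        rw [hw.map_mul _ _ (pow_ne_zero _ hτ') hx0, hw.map_pow hτ']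
        have := hw.nonneg τ hτ
        positivity)
    refine ht (hle ?_)
    rw [Submodule.mem_colon_singleton, Submodule.mem_bot]
    change Ideal.Quotient.mk (Ideal.span {τ}) (t * y) = 0
    rw [Ideal.Quotient.eq_zero_iff_mem, Ideal.mem_span_singleton]
    refine ⟨s, Subtype.ext ?_⟩
    push_cast
    rw [← hst]
    change (t : L) * (τ ^ (n + 1) * x) = _
    ring

end DiscreteAt

/-! ### The normalized extended Rees algebra -/

section NormalizedRees

variable {A : Type u} [CommRing A] [IsDomain A] {I : Ideal A}

local notation "K" => FractionRing A

theorem C_mul_zpow_mul (a b : K) (m n : ℤ) :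
    (RatFunc.C a * RatFunc.X ^ m) * (RatFunc.C b * RatFunc.X ^ n) =
      RatFunc.C (a * b) * RatFunc.X ^ (m + n) := by
  rw [zpow_add₀ RatFunc.X_ne_zero, map_mul]
  ring

theorem extendedRees_le_normalizedRees : extendedRees I ≤ normalizedRees I := fun x hx =>
  (integralClosure (extendedRees I) (RatFunc K)).algebraMap_mem ⟨x, hx⟩

omit [IsDomain A] in
theorem mem_reesPiece_of_nonpos {n : ℤ} (hn : n ≤ 0) (a : A) : algebraMap A K a ∈ reesPiece I n :=
  ⟨a, by rw [Int.toNat_of_nonpos hn]; simp, rfl⟩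

theorem exists_mul_mem_extendedRees (I : Ideal A) (f : LaurentPolynomial K) :
    ∃ b : A, b ≠ 0 ∧ ∃ N : ℕ, (RatFunc.C (algebraMap A K b) * RatFunc.X ^ (-N : ℤ)) *
      laurentToRatFunc K f ∈ extendedRees I := by
  obtain ⟨b, hb⟩ := IsLocalization.exist_integer_multiples
    (nonZeroDivisors A) f.coeff.support f.coeff
  refine ⟨b, nonZeroDivisors.ne_zero b.2, ∑ n ∈ f.coeff.support, n.toNat, ?_⟩
  rw [laurent_eq_sum, Finset.mul_sum]
  refine sum_mem fun n hn => ?_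
  rw [C_mul_zpow_mul]
  apply laurentToRatFunc_single_mem_extendedRees
  obtain ⟨a, ha⟩ := hb n hn
  rw [← Algebra.smul_def]
  change (b : A) • f.coeff n ∈ _
  erw [← ha]
  refine mem_reesPiece_of_nonpos ?_ a
  have := Finset.single_le_sum (f := fun n : ℤ => n.toNat) (fun _ _ => Nat.zero_le _) hn
  have h2 := Int.self_le_toNat n
  push_cast at this ⊢
  have : ((n.toNat : ℕ) : ℤ) ≤ ((∑ x ∈ f.coeff.support, x.toNat : ℕ) : ℤ) := by exact_mod_cast this
  push_cast at this
  omega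

/-- The leading term of an element of the normalized extended Rees algebra is almost integral over
the extended Rees algebra, hence integral. -/
theorem top_mem_normalizedRees [IsNoetherianRing A] {f : LaurentPolynomial K} {m : ℤ}
    (hf : laurentToRatFunc K f ∈ normalizedRees I) (hm : ∀ i, m < i → f.coeff i = 0) :
    RatFunc.C (f.coeff m) * RatFunc.X ^ m ∈ normalizedRees I := by
  obtain ⟨b, hb, N, hbN⟩ := exists_mul_mem_extendedRees I f
  have hr : RatFunc.C (algebraMap A K b) * RatFunc.X ^ (-N : ℤ) ∈ extendedRees I :=
    laurentToRatFunc_single_mem_extendedRees (mem_reesPiece_of_nonpos (by omega) b)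
  have hr0 : RatFunc.C (algebraMap A K b) * RatFunc.X ^ (-N : ℤ) ≠ 0 := by
    refine mul_ne_zero ?_ (zpow_ne_zero _ RatFunc.X_ne_zero)
    rw [Ne, map_eq_zero, map_eq_zero_iff _ (IsFractionRing.injective A K)]
    exact hb
  -- a nonzero `r` that multiplies all powers of `f` into the extended Rees algebra
  obtain ⟨r, hr1, hr2⟩ := (mem_normalizedRees_iff.1 hf).isAlmostIntegral_of_exists_smul_mem_range
    ⟨⟨_, hr⟩, mem_nonZeroDivisors_of_ne_zero fun h => hr0 (congrArg Subtype.val h), ⟨_, hbN⟩, rfl⟩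
  obtain ⟨g, hg, hgr⟩ := mem_extendedRees_iff.1 r.2
  have hg0 : g.coeff.support.Nonempty := by
    rw [Finsupp.support_nonempty_iff]
    intro h
    have h1 : g = 0 := by
      ext n
      rw [h]
      rfl
    refine nonZeroDivisors.ne_zero hr1 (Subtype.ext ?_)
    rw [← hgr, h1, map_zero]
    rfl
  -- The leading term of `r` does the same for the leading term of `f`.
  set M := g.coeff.support.max' hg0 with hM
  have hgM : g.coeff M ≠ 0 := Finsupp.mem_support_iff.1 (Finset.max'_mem _ hg0)
  have hgtop : ∀ i, M < i → g.coeff i = 0 := fun i hi => by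
    by_contra h
    exact absurd (Finset.le_max' _ i (Finsupp.mem_support_iff.2 h)) (not_le.2 hi)
  have hr' : RatFunc.C (g.coeff M) * RatFunc.X ^ M ∈ extendedRees I :=
    laurentToRatFunc_single_mem_extendedRees (hg M)
  refine mem_normalizedRees_iff.2 (IsAlmostIntegral.isIntegral ⟨⟨_, hr'⟩, ?_, fun k => ?_⟩)
  · refine mem_nonZeroDivisors_of_ne_zero fun h => ?_
    have h' : RatFunc.C (g.coeff M) * RatFunc.X ^ M = 0 := congrArg Subtype.val h
    rw [mul_eq_zero, map_eq_zero] at h'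
    exact h'.elim hgM (zpow_ne_zero _ RatFunc.X_ne_zero)
  · obtain ⟨y, hy⟩ := hr2 k
    obtain ⟨h, hh, hhy⟩ := mem_extendedRees_iff.1 y.2
    have hgf : g * f ^ k = h := by
      apply laurentToRatFunc_injective
      rw [hhy, map_mul, map_pow, hgr]
      exact hy.symm
    have hcoeff := (coeff_mul_of_top hgtop (coeff_pow_of_top hm k).2).1
    rw [hgf, (coeff_pow_of_top hm k).1] at hcoeff
    have hz : RatFunc.C (h.coeff (M + k * m)) * RatFunc.X ^ (M + k * m) ∈ extendedRees I :=
      laurentToRatFunc_single_mem_extendedRees (hh _)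
    refine ⟨⟨_, hz⟩, ?_⟩
    change RatFunc.C (h.coeff (M + k * m)) * RatFunc.X ^ (M + k * m) =
      (RatFunc.C (g.coeff M) * RatFunc.X ^ M) * (RatFunc.C (f.coeff m) * RatFunc.X ^ m) ^ k
    rw [hcoeff, mul_pow, ← map_pow RatFunc.C, ← zpow_natCast (RatFunc.X ^ m), ← zpow_mul,
      C_mul_zpow_mul,
      mul_comm m]

/-- The normalized extended Rees algebra is a graded subring of the Laurent polynomials. -/
theorem component_mem_normalizedRees [IsNoetherianRing A] {f : LaurentPolynomial K}
    (hf : laurentToRatFunc K f ∈ normalizedRees I) (n : ℤ) :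
    RatFunc.C (f.coeff n) * RatFunc.X ^ n ∈ normalizedRees I := by
  classical
  induction h : f.coeff.support.card using Nat.strong_induction_on generalizing f with
  | _ k ih =>
    by_cases h0 : f.coeff.support.Nonempty
    · set M := f.coeff.support.max' h0 with hM
      have htop : ∀ i, M < i → f.coeff i = 0 := fun i hi => by
        by_contra h
        exact absurd (Finset.le_max' _ i (Finsupp.mem_support_iff.2 h)) (not_le.2 hi)
      have hlead := top_mem_normalizedRees hf htop
      by_cases hn : n = M
      · rw [hn]
        exact hlead
      -- Subtract the leading term.
      have hco : ∀ i, (f - .single M (f.coeff M) : LaurentPolynomial K).coeff i =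
          if i = M then 0 else f.coeff i := by
        intro i
        rw [AddMonoidAlgebra.coeff_sub, AddMonoidAlgebra.coeff_single, Finsupp.sub_apply,
          Finsupp.single_apply]
        by_cases hi : i = M
        · subst hi
          simp
        · rw [if_neg (Ne.symm hi), if_neg hi, sub_zero]
      have h1 := ih (f - .single M (f.coeff M) : LaurentPolynomial K).coeff.support.card ?_
        (f := f - .single M (f.coeff M)) ?_ rfl
      · rw [hco, if_neg hn] at h1
        exact h1
      · rw [← h]
        refine Finset.card_lt_card (Finset.ssubset_iff_of_subset ?_ |>.2 ⟨M, ?_, ?_⟩)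
        · intro i hi
          rw [Finsupp.mem_support_iff, hco] at hi
          rw [Finsupp.mem_support_iff]
          split_ifs at hi with h2
          · exact absurd rfl hi
          · exact hi
        · exact Finset.max'_mem _ h0
        · rw [Finsupp.mem_support_iff, hco, if_pos rfl]
          exact fun h => h rfl
      · rw [map_sub, laurentToRatFunc_single]
        exact sub_mem hf hlead
    · have : f.coeff n = 0 := by
        rw [Finset.not_nonempty_iff_eq_empty, Finsupp.support_eq_empty] at h0
        rw [h0]
        rfl
      rw [this, map_zero, zero_mul]
      exact zero_mem _

theorem isIntegral_of_mem_normalizedRees {c : K} {n : ℤ}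
    (h : RatFunc.C c * RatFunc.X ^ n ∈ normalizedRees I) : IsIntegral A c := by
  obtain ⟨t, ht, a, ha, hac⟩ := exists_equation_of_mem_normalizedRees h
  have : ∀ i, ∃ b : A, i ∈ Finset.Icc 1 t → algebraMap A K b = a i := by
    intro i
    by_cases hi : i ∈ Finset.Icc 1 t
    · obtain ⟨b, -, hb⟩ := mem_reesPiece.1 (ha i hi)
      exact ⟨b, fun _ => hb⟩
    · exact ⟨0, fun h => absurd h hi⟩
  choose b hb using this
  refine ⟨Polynomial.X ^ t + ∑ i ∈ Finset.Icc 1 t,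
    Polynomial.C (b i) * Polynomial.X ^ (t - i), ?_, ?_⟩
  · refine Polynomial.monic_X_pow_add ?_
    refine lt_of_le_of_lt (Polynomial.degree_sum_le _ _) ?_
    rw [Finset.sup_lt_iff (by exact WithBot.bot_lt_coe t)]
    intro i hi
    rw [Finset.mem_Icc] at hi
    refine lt_of_le_of_lt (Polynomial.degree_C_mul_X_pow_le _ _) ?_
    exact_mod_cast (show t - i < t by omega)
  · rw [← hac, Polynomial.eval₂_add, Polynomial.eval₂_X_pow, Polynomial.eval₂_finsetSum]
    congr 1
    refine Finset.sum_congr rfl fun i hi => ?_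
    rw [Polynomial.eval₂_mul, Polynomial.eval₂_C, Polynomial.eval₂_X_pow, hb i hi]

omit [IsDomain A] in
theorem mem_pow_of_mem_idealIntegralClosure {B : ℕ}
    (hB : ∀ (J : Ideal A) (n : ℕ), idealIntegralClosure (J ^ (n + B)) ⊆ (J ^ n : Ideal A))
    {n : ℕ} {x : A} (hx : x ∈ idealIntegralClosure (I ^ n)) : x ∈ I ^ (n - B) := by
  rcases le_total B n with h | h
  · refine hB I (n - B) ?_
    rwa [Nat.sub_add_cancel h]
  · rw [Nat.sub_eq_zero_of_le h]
    simp

theorem mem_pow_of_smul_mem_normalizedRees {B : ℕ}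
    (hB : ∀ (J : Ideal A) (n : ℕ), idealIntegralClosure (J ^ (n + B)) ⊆ (J ^ n : Ideal A))
    {c y : A} {x : K} (hxy : algebraMap A K c * x = algebraMap A K y) {n : ℤ}
    (hx : RatFunc.C x * RatFunc.X ^ n ∈ normalizedRees I) : y ∈ I ^ (n.toNat - B) := by
  refine mem_pow_of_mem_idealIntegralClosure hB ?_
  obtain ⟨t, ht, a, ha, hac⟩ := exists_equation_of_mem_normalizedRees hx
  have : ∀ i, ∃ b : A, i ∈ Finset.Icc 1 t → b ∈ I ^ (i * n).toNat ∧ algebraMap A K b = a i := by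
    intro i
    by_cases hi : i ∈ Finset.Icc 1 t
    · obtain ⟨b, hb, hb'⟩ := mem_reesPiece.1 (ha i hi)
      exact ⟨b, fun _ => ⟨hb, hb'⟩⟩
    · exact ⟨0, fun h => absurd h hi⟩
  choose b hb using this
  refine ⟨t, ht, fun i => c ^ i * b i, fun i hi => ?_, ?_⟩
  · have h1 := (hb i hi).1
    have h2 : ((i : ℤ) * n).toNat = n.toNat * i := by
      rcases le_total 0 n with h | h
      · obtain ⟨k, rfl⟩ := Int.eq_ofNat_of_zero_le h
        rw [Int.toNat_natCast, mul_comm]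
        exact_mod_cast Int.toNat_natCast _
      · rw [Int.toNat_of_nonpos h, zero_mul, Int.toNat_of_nonpos]
        exact mul_nonpos_of_nonneg_of_nonpos (by positivity) h
    rw [h2, pow_mul] at h1
    exact Ideal.mul_mem_left _ _ h1
  · apply IsFractionRing.injective A K
    have : algebraMap A K c ^ t * (x ^ t + ∑ i ∈ Finset.Icc 1 t, a i * x ^ (t - i)) = 0 := by
      rw [hac, mul_zero]
    rw [map_zero, ← this, map_add, map_pow, ← hxy, mul_add, mul_pow, map_sum, Finset.mul_sum]
    congr 1
    refine Finset.sum_congr rfl fun i hi => ?_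
    rw [map_mul, map_mul, map_pow, map_pow, (hb i hi).2, ← hxy, mul_pow]
    rw [Finset.mem_Icc] at hi
    rw [← Nat.sub_add_cancel hi.2, Nat.add_sub_cancel, pow_add]
    ring

/-- The Briançon–Skoda property in terms of the normalized extended Rees algebra; it yields nothing
for `n ≤ B`, where the exponent is `0`. -/
theorem mem_pow_of_mem_normalizedRees {B : ℕ}
    (hB : ∀ (J : Ideal A) (n : ℕ), idealIntegralClosure (J ^ (n + B)) ⊆ (J ^ n : Ideal A))
    {x : A} {n : ℤ}
    (hx : RatFunc.C (algebraMap A K x) * RatFunc.X ^ n ∈ normalizedRees I) :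
    x ∈ I ^ (n.toNat - B) :=
  mem_pow_of_smul_mem_normalizedRees hB (c := 1) (by rw [map_one, one_mul]) hx

/-- A conductor for the integral closure of `A` and a Briançon–Skoda exponent give a conductor for
the normalized extended Rees algebra. -/
theorem conductor_mul_mem_extendedRees [IsNoetherianRing A] {B : ℕ}
    (hB : ∀ (J : Ideal A) (n : ℕ), idealIntegralClosure (J ^ (n + B)) ⊆ (J ^ n : Ideal A))
    {c : A} (hc : ∀ x : K, IsIntegral A x → ∃ a, algebraMap A K c * x = algebraMap A K a)
    {s : RatFunc K} (hs : s ∈ normalizedRees I) :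
    (RatFunc.C (algebraMap A K c) * RatFunc.X ^ (-B : ℤ)) * s ∈ extendedRees I := by
  obtain ⟨f, rfl⟩ := exists_laurent_of_mem_normalizedRees hs
  rw [laurent_eq_sum, Finset.mul_sum]
  refine sum_mem fun n hn => ?_
  have h1 := component_mem_normalizedRees hs n
  obtain ⟨y, hy⟩ := hc _ (isIntegral_of_mem_normalizedRees h1)
  rw [C_mul_zpow_mul, hy]
  refine laurentToRatFunc_single_mem_extendedRees ⟨y, ?_, rfl⟩
  have := mem_pow_of_smul_mem_normalizedRees hB hy h1
  rwa [show (-(B : ℤ) + n).toNat = n.toNat - B by omega]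

noncomputable instance extendedReesAlgebra (I : Ideal A) :
    Algebra (extendedRees I) (normalizedRees I) :=
  (Subalgebra.inclusion extendedRees_le_normalizedRees).toAlgebra

instance (I : Ideal A) : IsScalarTower (extendedRees I) (normalizedRees I) (RatFunc K) :=
  .of_algebraMap_eq fun _ => rfl

instance (I : Ideal A) : IsScalarTower A (extendedRees I) (normalizedRees I) :=
  .of_algebraMap_eq fun _ => rfl

instance (I : Ideal A) : Algebra.IsIntegral (extendedRees I) (normalizedRees I) where
  isIntegral x := by
    have := mem_normalizedRees_iff.1 x.2
    exact (isIntegral_algebraMap_iff (B := RatFunc K) Subtype.val_injective).1 this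

theorem normalizedRees_integrallyClosed (z : RatFunc K) (hz : IsIntegral (normalizedRees I) z) :
    z ∈ normalizedRees I :=
  mem_normalizedRees_iff.2 (isIntegral_trans z hz)

/-- By the conductor, the normalized algebra embeds as a module into the extended Rees algebra,
which is Noetherian. -/
theorem normalizedRees_finite [IsNoetherianRing A] {B : ℕ}
    (hB : ∀ (J : Ideal A) (n : ℕ), idealIntegralClosure (J ^ (n + B)) ⊆ (J ^ n : Ideal A))
    {c : A} (hc0 : c ≠ 0)
    (hc : ∀ x : K, IsIntegral A x → ∃ a, algebraMap A K c * x = algebraMap A K a) (I : Ideal A) :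
    Module.Finite (extendedRees I) (normalizedRees I) := by
  let g : normalizedRees I →ₗ[extendedRees I] extendedRees I :=
    { toFun := fun s => ⟨_, conductor_mul_mem_extendedRees hB hc s.2⟩
      map_add' := fun x y => Subtype.ext (mul_add _ _ _)
      map_smul' := fun r x => Subtype.ext (mul_left_comm _ (r : RatFunc K) (x : RatFunc K)) }
  refine Module.Finite.of_injective g fun x y hxy => Subtype.ext ?_
  refine mul_left_cancel₀ ?_ (congrArg Subtype.val hxy)
  refine mul_ne_zero ?_ (zpow_ne_zero _ RatFunc.X_ne_zero)
  rwa [Ne, map_eq_zero, map_eq_zero_iff _ (IsFractionRing.injective A K)]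

theorem exists_extendedRees_fraction (I : Ideal A) (z : RatFunc K) :
    ∃ s t : extendedRees I, t ≠ 0 ∧ z * t = (s : RatFunc K) := by
  obtain ⟨b, hb, N, hN⟩ := exists_mul_mem_extendedRees I (Polynomial.toLaurent z.num)
  obtain ⟨b', hb', N', hN'⟩ := exists_mul_mem_extendedRees I (Polynomial.toLaurent z.denom)
  have hne : ∀ (b : A) (N : ℤ), b ≠ 0 → RatFunc.C (algebraMap A K b) * RatFunc.X ^ N ≠ 0 := by
    intro b N hb
    refine mul_ne_zero ?_ (zpow_ne_zero _ RatFunc.X_ne_zero)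
    rwa [Ne, map_eq_zero, map_eq_zero_iff _ (IsFractionRing.injective A K)]
  have hmem : ∀ (b : A) (N : ℕ), RatFunc.C (algebraMap A K b) * RatFunc.X ^ (-N : ℤ) ∈
      extendedRees I := fun b N =>
    laurentToRatFunc_single_mem_extendedRees (mem_reesPiece_of_nonpos (by omega) b)
  rw [laurentToRatFunc_toLaurent] at hN hN'
  have hd : algebraMap (Polynomial K) (RatFunc K) z.denom ≠ 0 := by
    rw [Ne, map_eq_zero_iff _ (RatFunc.algebraMap_injective K)]
    exact z.denom_ne_zero
  refine ⟨⟨_, mul_mem hN (hmem b' N')⟩, ⟨_, mul_mem hN' (hmem b N)⟩, fun h => ?_, ?_⟩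
  · exact mul_ne_zero (mul_ne_zero (hne b' _ hb') hd) (hne b _ hb) (congrArg Subtype.val h)
  · have : z * algebraMap (Polynomial K) (RatFunc K) z.denom = algebraMap _ _ z.num := by
      rw [← eq_div_iff hd, RatFunc.num_div_denom]
    linear_combination (RatFunc.C (algebraMap A K b) * RatFunc.X ^ (-N : ℤ)) *
      (RatFunc.C (algebraMap A K b') * RatFunc.X ^ (-N' : ℤ)) * this

theorem exists_normalizedRees_fraction (I : Ideal A) (z : RatFunc K) :
    ∃ s t : normalizedRees I, t ≠ 0 ∧ z * t = (s : RatFunc K) := by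
  obtain ⟨s, t, ht, h⟩ := exists_extendedRees_fraction I z
  exact ⟨⟨s, extendedRees_le_normalizedRees s.2⟩, ⟨t, extendedRees_le_normalizedRees t.2⟩,
    fun h' => ht (Subtype.ext (congrArg (Subtype.val : normalizedRees I → RatFunc K) h')), h⟩

theorem tInv_ne_zero (I : Ideal A) : tInv I ≠ 0 := fun h =>
  inv_ne_zero RatFunc.X_ne_zero (congrArg Subtype.val h)

end NormalizedRees

/-! ### Exceptional primes and Rees valuations -/

section Exceptional

variable {A : Type u} [CommRing A] [IsDomain A] {I : Ideal A}

local notation "K" => FractionRing A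

/-- The Laurent polynomial representing an element of the normalized extended Rees algebra. -/
noncomputable def laurentOf (s : normalizedRees I) : LaurentPolynomial K :=
  (exists_laurent_of_mem_normalizedRees s.2).choose

theorem laurentToRatFunc_laurentOf (s : normalizedRees I) :
    laurentToRatFunc K (laurentOf s) = s :=
  (exists_laurent_of_mem_normalizedRees s.2).choose_spec

theorem laurentOf_eq {s : normalizedRees I} {f : LaurentPolynomial K}
    (h : laurentToRatFunc K f = s) : laurentOf s = f :=
  laurentToRatFunc_injective ((laurentToRatFunc_laurentOf s).trans h.symm)

theorem laurentOf_add (s t : normalizedRees I) : laurentOf (s + t) = laurentOf s + laurentOf t :=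
  laurentOf_eq (by rw [map_add, laurentToRatFunc_laurentOf, laurentToRatFunc_laurentOf]; rfl)

theorem laurentOf_mul (s t : normalizedRees I) : laurentOf (s * t) = laurentOf s * laurentOf t :=
  laurentOf_eq (by rw [map_mul, laurentToRatFunc_laurentOf, laurentToRatFunc_laurentOf]; rfl)

theorem laurentOf_single {s : normalizedRees I} {c : K} {n : ℤ}
    (h : (s : RatFunc K) = RatFunc.C c * RatFunc.X ^ n) : laurentOf s = .single n c :=
  laurentOf_eq (by rw [laurentToRatFunc_single, h])

variable [IsNoetherianRing A]

/-- The homogeneous component of degree `n` of an element of the normalized extended Rees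
algebra. -/
noncomputable def component (s : normalizedRees I) (n : ℤ) : normalizedRees I :=
  ⟨RatFunc.C ((laurentOf s).coeff n) * RatFunc.X ^ n, component_mem_normalizedRees
    (by rw [laurentToRatFunc_laurentOf]; exact s.2) n⟩

theorem coe_component (s : normalizedRees I) (n : ℤ) :
    (component s n : RatFunc K) = RatFunc.C ((laurentOf s).coeff n) * RatFunc.X ^ n := rfl

theorem sum_component (s : normalizedRees I) :
    ∑ n ∈ (laurentOf s).coeff.support, component s n = s := by
  apply Subtype.ext
  rw [AddSubmonoidClass.coe_finsetSum]
  conv_rhs => rw [← laurentToRatFunc_laurentOf s, laurent_eq_sum]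
  rfl

theorem component_eq_of_single {s : normalizedRees I} {c : K} {n : ℤ}
    (h : (s : RatFunc K) = RatFunc.C c * RatFunc.X ^ n) (m : ℤ) :
    component s m = if m = n then s else 0 := by
  apply Subtype.ext
  rw [coe_component, laurentOf_single h, AddMonoidAlgebra.coeff_single, Finsupp.single_apply]
  by_cases hm : m = n
  · subst hm
    rw [if_pos rfl, if_pos rfl, h]
  · rw [if_neg (Ne.symm hm), if_neg hm, map_zero, zero_mul]
    rfl

theorem component_add (s t : normalizedRees I) (n : ℤ) :
    component (s + t) n = component s n + component t n := by
  apply Subtype.ext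
  change _ = (component s n : RatFunc K) + component t n
  rw [coe_component, laurentOf_add, AddMonoidAlgebra.coeff_add, Finsupp.add_apply, map_add, add_mul]
  rfl

theorem component_mul (s t : normalizedRees I) (n : ℤ) :
    component (s * t) n = ∑ i ∈ (laurentOf s).coeff.support, ∑ j ∈ (laurentOf t).coeff.support,
      if i + j = n then component s i * component t j else 0 := by
  apply Subtype.ext
  rw [coe_component, laurentOf_mul, AddMonoidAlgebra.coeff_mul, AddSubmonoidClass.coe_finsetSum,
    Finsupp.sum, map_sum, Finset.sum_mul]
  refine Finset.sum_congr rfl fun i _ => ?_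
  rw [AddSubmonoidClass.coe_finsetSum, Finsupp.sum, map_sum, Finset.sum_mul]
  refine Finset.sum_congr rfl fun j _ => ?_
  split_ifs with h
  · change _ = (component s i : RatFunc K) * component t j
    rw [coe_component, coe_component, C_mul_zpow_mul, h]
  · rw [map_zero, zero_mul]
    rfl

theorem component_single_mul {s : normalizedRees I} {c : K} {m : ℤ}
    (h : (s : RatFunc K) = RatFunc.C c * RatFunc.X ^ m) (t : normalizedRees I) (n : ℤ) :
    component (s * t) (m + n) = s * component t n := by
  apply Subtype.ext
  change _ = (s : RatFunc K) * component t n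
  rw [coe_component, coe_component, h, laurentOf_mul, laurentOf_single h,
    AddMonoidAlgebra.coeff_single_mul_eq_mul_coeff n
      (by intro a _; constructor <;> intro h <;> omega),
    C_mul_zpow_mul]

omit [IsNoetherianRing A] in
theorem coe_tInv : (tInv I : RatFunc K) = RatFunc.C 1 * RatFunc.X ^ (-1 : ℤ) := by
  rw [map_one, one_mul, zpow_neg_one]
  rfl

/-- The largest homogeneous ideal contained in `Q`. -/
noncomputable def homogeneousCore (Q : Ideal (normalizedRees I)) : Ideal (normalizedRees I) where
  carrier := {s | ∀ n, component s n ∈ Q}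
  add_mem' := by
    intro s t hs ht n
    rw [component_add]
    exact Q.add_mem (hs n) (ht n)
  zero_mem' := by
    intro n
    rw [component_eq_of_single (c := 0) (n := 0) (by simp)]
    split_ifs <;> exact Q.zero_mem
  smul_mem' := by
    intro a s hs n
    rw [smul_eq_mul, component_mul]
    refine sum_mem fun i _ => sum_mem fun j _ => ?_
    split_ifs
    · exact Q.mul_mem_left _ (hs j)
    · exact Q.zero_mem

theorem mem_homogeneousCore {Q : Ideal (normalizedRees I)} {s : normalizedRees I} :
    s ∈ homogeneousCore Q ↔ ∀ n, component s n ∈ Q := Iff.rfl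

theorem homogeneousCore_le (Q : Ideal (normalizedRees I)) : homogeneousCore Q ≤ Q := by
  intro s hs
  rw [← sum_component s]
  exact sum_mem fun n _ => hs n

theorem exists_max_component_notMem {Q : Ideal (normalizedRees I)} {s : normalizedRees I}
    (hs : s ∉ homogeneousCore Q) :
    ∃ m ∈ (laurentOf s).coeff.support, component s m ∉ Q ∧ ∀ i, m < i → component s i ∈ Q := by
  classical
  have hsupp : ∀ i, component s i ∉ Q → i ∈ (laurentOf s).coeff.support := by
    intro i hi
    by_contra h
    refine hi ?_
    have : component s i = 0 := by
      apply Subtype.ext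
      rw [coe_component, Finsupp.notMem_support_iff.1 h, map_zero, zero_mul]
      rfl
    rw [this]
    exact Q.zero_mem
  rw [mem_homogeneousCore] at hs
  push Not at hs
  obtain ⟨n, hn⟩ := hs
  set F := (laurentOf s).coeff.support.filter fun i => component s i ∉ Q
  have hF : F.Nonempty := ⟨n, Finset.mem_filter.2 ⟨hsupp n hn, hn⟩⟩
  have h1 := Finset.mem_filter.1 (F.max'_mem hF)
  refine ⟨F.max' hF, h1.1, h1.2, fun i hi => ?_⟩
  by_contra h
  exact absurd (F.le_max' i (Finset.mem_filter.2 ⟨hsupp i h, h⟩)) (not_le.2 hi)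

theorem homogeneousCore_isPrime {Q : Ideal (normalizedRees I)} (hQ : Q.IsPrime) :
    (homogeneousCore Q).IsPrime := by
  refine ⟨fun h => hQ.ne_top (top_le_iff.1 (h ▸ homogeneousCore_le Q)), ?_⟩
  intro s t hst
  by_contra! hcon
  obtain ⟨m, hm, hm1, hm2⟩ := exists_max_component_notMem hcon.1
  obtain ⟨n, hn, hn1, hn2⟩ := exists_max_component_notMem hcon.2
  have h1 := hst (m + n)
  rw [component_mul, ← Finset.sum_product', ← Finset.add_sum_erase _ _
    (Finset.mk_mem_product hm hn)] at h1
  simp only [if_true] at h1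
  rw [Ideal.add_mem_iff_left] at h1
  · exact (hQ.mem_or_mem h1).elim hm1 hn1
  · refine sum_mem fun ij hij => ?_
    rw [Finset.mem_erase] at hij
    split_ifs with h
    · have : m < ij.1 ∨ n < ij.2 := by
        by_contra! h'
        exact hij.1 (Prod.ext (by dsimp only; omega) (by dsimp only; omega))
      rcases this with h' | h'
      · exact Q.mul_mem_right _ (hm2 _ h')
      · exact Q.mul_mem_left _ (hn2 _ h')
    · exact Q.zero_mem

variable [IsNoetherianRing (normalizedRees I)] {Q : Ideal (normalizedRees I)}

/-- The discrete valuation of `K(T)` at an exceptional prime. -/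
noncomputable def exceptionalVal (Q : Ideal (normalizedRees I)) : RatFunc K → ℤ :=
  Classical.epsilon (IsDiscreteAt (normalizedRees I) Q)

omit [IsNoetherianRing A] in
theorem isDiscreteAt_exceptionalVal (hQ : Q ∈ exceptionalPrimes I) :
    IsDiscreteAt (normalizedRees I) Q (exceptionalVal Q) := by
  obtain ⟨hp, u, hu⟩ := exists_colon_of_mem_associatedPrimes hQ
  exact Classical.epsilon_spec (exists_isDiscreteAt normalizedRees_integrallyClosed
    (exists_normalizedRees_fraction I) (tInv_ne_zero I) hp hu)

omit [IsNoetherianRing A] in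
theorem tInv_mem_of_mem_exceptionalPrimes (hQ : Q ∈ exceptionalPrimes I) : tInv I ∈ Q := by
  obtain ⟨hp, u, hu⟩ := exists_colon_of_mem_associatedPrimes hQ
  exact (hu _).2 (dvd_mul_right _ _)

omit [IsNoetherianRing A] in
theorem exceptionalVal_tInv_pos (hQ : Q ∈ exceptionalPrimes I) :
    0 < exceptionalVal Q (tInv I : RatFunc K) :=
  ((isDiscreteAt_exceptionalVal hQ).pos_iff _ (tInv_ne_zero I)).2
    (tInv_mem_of_mem_exceptionalPrimes hQ)

/-- Exceptional primes are homogeneous: they have height one, and the homogeneous core is a nonzero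
prime. -/
theorem component_mem_of_mem_exceptionalPrimes (hQ : Q ∈ exceptionalPrimes I) {s : normalizedRees I}
    (hs : s ∈ Q) (n : ℤ) : component s n ∈ Q := by
  have h1 : tInv I ∈ homogeneousCore Q := by
    intro n
    rw [component_eq_of_single coe_tInv]
    split_ifs
    · exact tInv_mem_of_mem_exceptionalPrimes hQ
    · exact Q.zero_mem
  exact (isDiscreteAt_exceptionalVal hQ).le_of_isPrime (homogeneousCore_isPrime hQ.1)
    (homogeneousCore_le Q) h1 (tInv_ne_zero I) hs n

omit [IsNoetherianRing A] in
theorem eq_of_exceptionalPrimes_le {Q' : Ideal (normalizedRees I)} (hQ : Q ∈ exceptionalPrimes I)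
    (hQ' : Q' ∈ exceptionalPrimes I) (h : Q ≤ Q') : Q = Q' :=
  le_antisymm h ((isDiscreteAt_exceptionalVal hQ').le_of_isPrime hQ.1 h
    (tInv_mem_of_mem_exceptionalPrimes hQ) (tInv_ne_zero I))

/-- There is a homogeneous element `u` such that `u / T⁻¹` is the inverse of a uniformizer at the
exceptional prime `Q` and is nonnegative at all the other exceptional primes. -/
theorem exists_homogeneous_colon (hQ : Q ∈ exceptionalPrimes I) :
    ∃ (c : K) (n : ℤ), RatFunc.C c * RatFunc.X ^ n ∈ normalizedRees I ∧ c ≠ 0 ∧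
      exceptionalVal Q (RatFunc.C c * RatFunc.X ^ n) = exceptionalVal Q (tInv I : RatFunc K) - 1 ∧
      ∀ Q' ∈ exceptionalPrimes I, Q' ≠ Q → exceptionalVal Q' (tInv I : RatFunc K) ≤
        exceptionalVal Q' (RatFunc.C c * RatFunc.X ^ n) := by
  obtain ⟨hp, u, hu⟩ := exists_colon_of_mem_associatedPrimes hQ
  have hw := isDiscreteAt_exceptionalVal hQ
  have hτ0 : (tInv I : RatFunc K) ≠ 0 := fun h => tInv_ne_zero I (Subtype.ext h)
  have hu0 : u ≠ 0 := by
    rintro rfl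
    exact hp.ne_top ((Ideal.eq_top_iff_one Q).2 ((hu 1).2 (by simp)))
  have hcoe : ∀ s : normalizedRees I, s ≠ 0 → (s : RatFunc K) ≠ 0 := fun s hs h =>
    hs (Subtype.ext h)
  have hdvd : ∀ {Q' : Ideal (normalizedRees I)}, Q' ∈ exceptionalPrimes I →
      ∀ {a b : normalizedRees I}, a ≠ 0 → b ≠ 0 → tInv I ∣ a * b →
      exceptionalVal Q' (tInv I : RatFunc K) ≤ exceptionalVal Q' (a : RatFunc K) +
        exceptionalVal Q' (b : RatFunc K) := by
    rintro Q' hQ' a b ha hb ⟨d, hd⟩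
    have hw' := isDiscreteAt_exceptionalVal hQ'
    have hd0 : d ≠ 0 := by
      rintro rfl
      rw [mul_zero] at hd
      exact (mul_ne_zero ha hb) hd
    have h1 : (a : RatFunc K) * b = tInv I * d := congrArg Subtype.val hd
    rw [← hw'.map_mul _ _ (hcoe a ha) (hcoe b hb), h1, hw'.map_mul _ _ hτ0 (hcoe d hd0)]
    have := hw'.nonneg d hd0
    omega
  obtain ⟨q, hqQ, hq0, hq1⟩ := hw.exists_mem_eq_one
  have hlt : exceptionalVal Q (u : RatFunc K) < exceptionalVal Q (tInv I : RatFunc K) := by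
    by_contra! h
    obtain ⟨s, t, ht, hst⟩ := hw.exists_frac _ (div_ne_zero (hcoe u hu0) hτ0) (by
      rw [hw.map_div (hcoe u hu0) hτ0]
      omega)
    refine ht ((hu t).2 ⟨s, Subtype.ext ?_⟩)
    push_cast
    rw [← hst]
    field_simp
  obtain ⟨n, hn0, hn⟩ : ∃ n, component u n ≠ 0 ∧
      exceptionalVal Q (component u n : RatFunc K) < exceptionalVal Q (tInv I : RatFunc K) := by
    by_contra! hcon
    have h1 := hw.le_map_sum (laurentOf u).coeff.support (fun n => (component u n : RatFunc K))
      (n := exceptionalVal Q (tInv I : RatFunc K))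
      (fun n _ h => hcon n fun h' => h (by rw [h']; rfl))
    rw [← AddSubmonoidClass.coe_finsetSum, sum_component] at h1
    exact absurd (h1 (hcoe u hu0)) (not_le.2 hlt)
  -- `component u n` is annihilated by `Q` modulo `T⁻¹`, as `Q` and `T⁻¹` are homogeneous
  have hann : ∀ a ∈ Q, tInv I ∣ a * component u n := by
    intro a ha
    rw [← sum_component a, Finset.sum_mul]
    refine Finset.dvd_sum fun m _ => ?_
    obtain ⟨b, hb⟩ := (hu _).1 (component_mem_of_mem_exceptionalPrimes hQ ha m)
    rw [← component_single_mul (coe_component a m) u n, hb,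
      show m + n = -1 + (m + n + 1) by ring, component_single_mul coe_tInv]
    exact dvd_mul_right _ _
  refine ⟨(laurentOf u).coeff n, n, (component u n).2, fun h => hn0 (Subtype.ext ?_), ?_, ?_⟩
  · rw [coe_component, h, map_zero, zero_mul]
    rfl
  · rw [← coe_component]
    have := hdvd hQ hq0 hn0 (hann q hqQ)
    omega
  · intro Q' hQ' hne
    rw [← coe_component]
    obtain ⟨a, haQ, haQ'⟩ : ∃ a ∈ Q, a ∉ Q' := by
      by_contra! h
      exact hne (eq_of_exceptionalPrimes_le hQ hQ' h).symm
    have ha0 : a ≠ 0 := fun h => haQ' (h ▸ Q'.zero_mem)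
    have := hdvd hQ' ha0 hn0 (hann a haQ)
    rwa [(isDiscreteAt_exceptionalVal hQ').map_eq_zero haQ', zero_add] at this

omit [IsNoetherianRing A] in
theorem C_ne_zero {x : K} (hx : x ≠ 0) : (RatFunc.C x : RatFunc K) ≠ 0 := by
  rwa [Ne, map_eq_zero]

omit [IsNoetherianRing A] in
theorem exceptionalVal_X (hQ : Q ∈ exceptionalPrimes I) (n : ℤ) :
    exceptionalVal Q (RatFunc.X ^ n) = -n * exceptionalVal Q (tInv I : RatFunc K) := by
  have hw := isDiscreteAt_exceptionalVal hQ
  change _ = -n * exceptionalVal Q RatFunc.X⁻¹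
  rw [hw.map_zpow RatFunc.X_ne_zero, hw.map_inv RatFunc.X_ne_zero]
  ring

omit [IsNoetherianRing A] in
theorem exceptionalVal_C_mul_X (hQ : Q ∈ exceptionalPrimes I) {c : K} (hc : c ≠ 0) (n : ℤ) :
    exceptionalVal Q (RatFunc.C c * RatFunc.X ^ n) =
      exceptionalVal Q (RatFunc.C c) - n * exceptionalVal Q (tInv I : RatFunc K) := by
  have hw := isDiscreteAt_exceptionalVal hQ
  rw [hw.map_mul _ _ (C_ne_zero hc) (zpow_ne_zero _ RatFunc.X_ne_zero), exceptionalVal_X hQ]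
  ring

omit [IsNoetherianRing A] in
theorem exceptionalVal_nonneg (hQ : Q ∈ exceptionalPrimes I) {x : RatFunc K}
    (hx : x ∈ normalizedRees I) (hx0 : x ≠ 0) : 0 ≤ exceptionalVal Q x :=
  (isDiscreteAt_exceptionalVal hQ).nonneg ⟨x, hx⟩ fun h => hx0 (congrArg Subtype.val h)

omit [IsNoetherianRing A] in
theorem mem_normalizedRees_of_forall_nonneg {x : RatFunc K} {n : ℕ}
    (hn : RatFunc.X ^ (-n : ℤ) * x ∈ normalizedRees I)
    (h : x ≠ 0 → ∀ Q ∈ exceptionalPrimes I, 0 ≤ exceptionalVal Q x) : x ∈ normalizedRees I := by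
  refine mem_of_forall_associatedPrimes_nonneg (tInv_ne_zero I) (n := n) ?_
    fun h0 Q hQ => ⟨_, isDiscreteAt_exceptionalVal hQ, h h0 Q hQ⟩
  convert hn using 2
  rw [zpow_neg, zpow_natCast, ← inv_pow]
  rfl

omit [IsNoetherianRing A] in
theorem mem_normalizedRees_of_forall_le {f : A} {n : ℤ} (h : f ≠ 0 → ∀ Q ∈ exceptionalPrimes I,
      n * exceptionalVal Q (tInv I : RatFunc K) ≤
        exceptionalVal Q (RatFunc.C (algebraMap A K f))) :
    RatFunc.C (algebraMap A K f) * RatFunc.X ^ n ∈ normalizedRees I := by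
  by_cases hf : f = 0
  · rw [hf, map_zero, map_zero, zero_mul]
    exact zero_mem _
  have hf' : algebraMap A K f ≠ 0 := by rwa [Ne, map_eq_zero_iff _ (IsFractionRing.injective A K)]
  refine mem_normalizedRees_of_forall_nonneg (n := n.toNat) ?_ fun _ Q hQ => ?_
  · rw [mul_left_comm, ← zpow_add₀ RatFunc.X_ne_zero]
    refine extendedRees_le_normalizedRees (laurentToRatFunc_single_mem_extendedRees
      (mem_reesPiece_of_nonpos ?_ f))
    have := Int.self_le_toNat n
    omega
  · rw [exceptionalVal_C_mul_X hQ hf']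
    have := h hf Q hQ
    omega

omit [IsNoetherianRing A] in
theorem le_exceptionalVal_of_mem_pow (hQ : Q ∈ exceptionalPrimes I) {a : A} (ha : a ≠ 0) {n : ℕ}
    (han : a ∈ I ^ n) : n * exceptionalVal Q (tInv I : RatFunc K) ≤
      exceptionalVal Q (RatFunc.C (algebraMap A K a)) := by
  have ha' : algebraMap A K a ≠ 0 := by rwa [Ne, map_eq_zero_iff _ (IsFractionRing.injective A K)]
  have h1 := extendedRees_le_normalizedRees
    (laurentToRatFunc_single_mem_extendedRees (I := I) (n := n) ⟨a, by simpa using han, rfl⟩)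
  have := exceptionalVal_nonneg hQ h1
    (mul_ne_zero (C_ne_zero ha') (zpow_ne_zero _ RatFunc.X_ne_zero))
  change 0 ≤ exceptionalVal Q (RatFunc.C (algebraMap A K a) * _) at this
  rw [exceptionalVal_C_mul_X hQ ha'] at this
  omega

omit [IsNoetherianRing A] [IsNoetherianRing (normalizedRees I)] in
theorem zero_mem_homogeneousLocalization {Q : Ideal (normalizedRees I)} (hQ : Q ≠ ⊤) :
    (0 : K) ∈ homogeneousLocalization I Q :=
  ⟨0, 0, 1, 0, 1, by simp, by simp, fun h => hQ ((Ideal.eq_top_iff_one Q).2 h), by simp⟩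

/-- The homogeneous localization at an exceptional prime is the valuation ring of the restriction of
its valuation to `K`. -/
theorem mem_homogeneousLocalization_iff (hQ : Q ∈ exceptionalPrimes I) {x : K} (hx : x ≠ 0) :
    x ∈ homogeneousLocalization I Q ↔ 0 ≤ exceptionalVal Q (RatFunc.C x) := by
  have hw := isDiscreteAt_exceptionalVal hQ
  constructor
  · rintro ⟨n, c, d, s, t, hs, ht, htQ, hxcd⟩
    have hd : d ≠ 0 := by
      rintro rfl
      exact hx (by rw [hxcd, div_zero])
    refine hw.nonneg_of_mul_eq (C_ne_zero hx) htQ (s := s) ?_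
    rw [hs, ht, hxcd, ← mul_assoc, ← map_mul, div_mul_cancel₀ _ hd]
  · intro h
    obtain ⟨s, t, ht, hst⟩ := hw.exists_frac _ (C_ne_zero hx) h
    obtain ⟨n, hn⟩ : ∃ n, component t n ∉ Q := by
      by_contra! h'
      exact ht (homogeneousCore_le Q h')
    have hd : (laurentOf t).coeff n ≠ 0 := by
      intro h0
      refine hn ?_
      have : component t n = 0 := by
        apply Subtype.ext
        rw [coe_component, h0, map_zero, zero_mul]
        rfl
      rw [this]
      exact Q.zero_mem
    have hs : laurentOf s = .single 0 x * laurentOf t := by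
      refine laurentOf_eq ?_
      rw [map_mul, laurentToRatFunc_single, zpow_zero, mul_one, laurentToRatFunc_laurentOf, hst]
    refine ⟨n, (laurentOf s).coeff n, (laurentOf t).coeff n, component s n, component t n, rfl, rfl,
      hn, ?_⟩
    rw [hs, AddMonoidAlgebra.coeff_single_mul_eq_mul_coeff n
      (by intro a _; constructor <;> intro h <;> omega), mul_div_cancel_right₀ _ hd]

omit [IsNoetherianRing A] [IsNoetherianRing (normalizedRees I)] in
theorem exists_int_eq_of_ne_zero (ν : AddValuation K (WithTop ℤ)) :
    ∃ v : Kˣ →* Multiplicative ℤ, ∀ x : Kˣ, ν x = ((v x).toAdd : ℤ) := by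
  have h : ∀ x : Kˣ, ∃ n : ℤ, ν x = n := by
    intro x
    have h1 : ν x ≠ ⊤ := fun h => x.ne_zero ((AddValuation.top_iff ν).1 h)
    exact ⟨_, (WithTop.coe_untop _ h1).symm⟩
  choose n hn using h
  refine ⟨MonoidHom.mk' (fun x => Multiplicative.ofAdd (n x)) fun x y => ?_, hn⟩
  rw [← ofAdd_add]
  congr 1
  have := ν.map_mul x y
  rw [← Units.val_mul, hn, hn, hn] at this
  exact_mod_cast this

/-- A Rees valuation is proportional to the valuation of `K(T)` at its exceptional prime. -/
theorem exceptionalVal_eq_mul (hQ : Q ∈ exceptionalPrimes I) {ν : AddValuation K (WithTop ℤ)}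
    (hν : ∃ x, ν x = 1) (h : {x | 0 ≤ ν x} = homogeneousLocalization I Q) :
    ∃ e : ℤ, 0 < e ∧ ∀ x, x ≠ 0 → ∃ n : ℤ, ν x = n ∧ exceptionalVal Q (RatFunc.C x) = e * n := by
  have hw := isDiscreteAt_exceptionalVal hQ
  obtain ⟨y, hy⟩ := hν
  obtain ⟨v, hv⟩ := exists_int_eq_of_ne_zero ν
  have hy0 : y ≠ 0 := by
    rintro rfl
    rw [AddValuation.map_zero] at hy
    exact absurd hy (by decide)
  set y' : Kˣ := Units.mk0 y hy0 with hy'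
  have hiff : ∀ x : Kˣ, 0 ≤ (v x).toAdd ↔ 0 ≤ exceptionalVal Q (RatFunc.C (x : K)) := by
    intro x
    rw [← mem_homogeneousLocalization_iff hQ x.ne_zero, ← h, Set.mem_ofPred_eq, hv]
    exact_mod_cast Iff.rfl
  have hvy : (v y').toAdd = 1 := by
    have h1 := hv y'
    rw [hy', Units.val_mk0, hy] at h1
    exact_mod_cast h1.symm
  have hzero : ∀ x : Kˣ, (v x).toAdd = 0 → exceptionalVal Q (RatFunc.C (x : K)) = 0 := by
    intro x hx
    have h1 := (hiff x).1 hx.ge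
    have h2 := (hiff x⁻¹).1 (by rw [map_inv, toAdd_inv]; omega)
    rw [Units.val_inv_eq_inv_val, map_inv₀, hw.map_inv (C_ne_zero x.ne_zero)] at h2
    omega
  have hmain : ∀ x : Kˣ, exceptionalVal Q (RatFunc.C (x : K)) =
      exceptionalVal Q (RatFunc.C y) * (v x).toAdd := by
    intro x
    have h1 := hzero (x * y' ^ (-(v x).toAdd)) (by
      rw [map_mul, map_zpow, toAdd_mul, toAdd_zpow, hvy]
      simp)
    rw [Units.val_mul, map_mul, Units.val_zpow_eq_zpow_val, map_zpow₀,
      hw.map_mul _ _ (C_ne_zero x.ne_zero) (zpow_ne_zero _ (C_ne_zero y'.ne_zero)),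
      hw.map_zpow (C_ne_zero y'.ne_zero), hy', Units.val_mk0] at h1
    linarith
  refine ⟨exceptionalVal Q (RatFunc.C y), ?_, fun x hx =>
    ⟨_, hv (Units.mk0 x hx), hmain (Units.mk0 x hx)⟩⟩
  have h1 := (hiff y'⁻¹).not.1 (by rw [map_inv, toAdd_inv, hvy]; omega)
  rw [Units.val_inv_eq_inv_val, map_inv₀, hw.map_inv (C_ne_zero y'.ne_zero), hy', Units.val_mk0]
    at h1
  omega

/-- Each exceptional prime of a nonzero ideal gives rise to a Rees valuation. The ideal has to be
nonzero for the valuation of `K(T)` to be nontrivial on `K`. -/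
theorem exists_reesValuation (hI : I ≠ ⊥) (hQ : Q ∈ exceptionalPrimes I) :
    ∃ ν : AddValuation K (WithTop ℤ), (∃ x, ν x = 1) ∧
      {x | 0 ≤ ν x} = homogeneousLocalization I Q := by
  classical
  have hw := isDiscreteAt_exceptionalVal hQ
  obtain ⟨a, haI, ha0⟩ := Submodule.exists_mem_ne_zero_of_ne_bot hI
  have hpos : ∃ k : ℕ, 0 < k ∧ ∃ x : K, x ≠ 0 ∧ exceptionalVal Q (RatFunc.C x) = k := by
    have h1 := le_exceptionalVal_of_mem_pow hQ ha0 (n := 1) (by rwa [pow_one])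
    have h2 := exceptionalVal_tInv_pos hQ
    push_cast at h1
    refine ⟨(exceptionalVal Q (RatFunc.C (algebraMap A K a))).toNat, by omega, algebraMap A K a,
      by rwa [Ne, map_eq_zero_iff _ (IsFractionRing.injective A K)], by omega⟩
  -- the positive generator of the value group of the restriction to `K`
  set e := Nat.find hpos with he
  obtain ⟨he0, y, hy0, hy⟩ := Nat.find_spec hpos
  rw [← he] at he0 hy
  have hdvd : ∀ x : K, x ≠ 0 → (e : ℤ) ∣ exceptionalVal Q (RatFunc.C x) := by
    intro x hx
    by_contra hnd
    set q := exceptionalVal Q (RatFunc.C x) / e with hq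
    have hr := Int.emod_nonneg (exceptionalVal Q (RatFunc.C x)) (b := e) (by omega)
    have hr' := Int.emod_lt_of_pos (exceptionalVal Q (RatFunc.C x)) (b := e) (by omega)
    have hr0 : exceptionalVal Q (RatFunc.C x) % e ≠ 0 := fun h => hnd (Int.dvd_of_emod_eq_zero h)
    have hdm := Int.emod_add_mul_ediv (exceptionalVal Q (RatFunc.C x)) e
    refine Nat.find_min hpos (m := (exceptionalVal Q (RatFunc.C x) % e).toNat) (by omega)
      ⟨by omega, x / y ^ q, div_ne_zero hx (zpow_ne_zero _ hy0), ?_⟩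
    rw [map_div₀, map_zpow₀, hw.map_div (C_ne_zero hx) (zpow_ne_zero _ (C_ne_zero hy0)),
      hw.map_zpow (C_ne_zero hy0), hy, Int.toNat_of_nonneg hr]
    rw [← hq] at hdm
    linarith
  let g : K → WithTop ℤ := fun x =>
    if x = 0 then ⊤ else ((exceptionalVal Q (RatFunc.C x) / e : ℤ) : WithTop ℤ)
  have hg : ∀ {x}, x ≠ 0 → g x = ((exceptionalVal Q (RatFunc.C x) / e : ℤ) : WithTop ℤ) :=
    fun hx => if_neg hx
  have hg0 : g 0 = ⊤ := if_pos rfl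
  let ν : AddValuation K (WithTop ℤ) := AddValuation.of g hg0 (by
      rw [hg one_ne_zero, map_one, hw.map_one]
      simp) (by
      intro x z
      by_cases hx : x = 0
      · simp [hx]
      by_cases hz : z = 0
      · simp [hz]
      by_cases hxz : x + z = 0
      · rw [hxz, hg0]
        exact le_top
      rw [hg hx, hg hz, hg hxz, ← WithTop.coe_min, WithTop.coe_le_coe, map_add]
      have h1 := hw.min_le_map_add _ _ (C_ne_zero hx) (C_ne_zero hz)
        (by rw [← map_add]; exact C_ne_zero hxz)
      rw [min_le_iff] at h1 ⊢
      exact h1.imp (Int.ediv_le_ediv (by omega)) (Int.ediv_le_ediv (by omega))) (by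
      intro x z
      by_cases hx : x = 0
      · simp [hx, hg0]
      by_cases hz : z = 0
      · simp [hz, hg0]
      rw [hg hx, hg hz, hg (mul_ne_zero hx hz), map_mul,
        hw.map_mul _ _ (C_ne_zero hx) (C_ne_zero hz), Int.add_ediv_of_dvd_left (hdvd x hx)]
      exact WithTop.coe_add _ _)
  have hν : ∀ x, ν x = g x := fun _ => rfl
  refine ⟨ν, ⟨y, ?_⟩, ?_⟩
  · rw [hν, hg hy0, hy, Int.ediv_self (by omega)]
    rfl
  · ext x
    by_cases hx : x = 0
    · subst hx
      simp only [Set.mem_ofPred_eq, zero_mem_homogeneousLocalization hQ.1.ne_top, iff_true, hν, hg0]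
      exact le_top
    · rw [mem_homogeneousLocalization_iff hQ hx, Set.mem_ofPred_eq, hν, hg hx]
      rw [← WithTop.coe_zero, WithTop.coe_le_coe]
      exact Int.ediv_nonneg_iff_of_pos (by omega)

end Exceptional

/-! ### Heights of primes in catenary domains -/

section Catenary

theorem isCatenary_of_isLocalization {S S' : Type*} [CommRing S] [CommRing S'] [Algebra S S']
    (M : Submonoid S) [IsLocalization M S'] (h : IsCatenary S) : IsCatenary S' := by
  let f : PrimeSpectrum S' ↪o PrimeSpectrum S :=
    (IsLocalization.primeSpectrumOrderIso M S').toOrderEmbedding.trans (OrderEmbedding.subtype _)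
  have hf : (Set.range f).OrdConnected := by
    refine ⟨?_⟩
    rintro _ ⟨x, rfl⟩ _ ⟨y, rfl⟩ z hz
    have hz' : Disjoint (M : Set S) z.asIdeal :=
      (IsLocalization.primeSpectrumOrderIso M S' y).2.mono_right (show z ≤ _ from hz.2)
    exact ⟨(IsLocalization.primeSpectrumOrderIso M S').symm ⟨z, hz'⟩, by simp [f]⟩
  intro s t h1 h2
  let g : SetRel.Hom {(p, q) : PrimeSpectrum S' × PrimeSpectrum S' | p ⋖ q}
      {(p, q) : PrimeSpectrum S × PrimeSpectrum S | p ⋖ q} := ⟨f, fun hab => CovBy.image f hab hf⟩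
  exact h (s.map g) (t.map g) (by rw [RelSeries.head_map, RelSeries.head_map, h1])
    (by rw [RelSeries.last_map, RelSeries.last_map, h2])

variable {S : Type*} [CommRing S]

theorem length_le_height_last
    (s : RelSeries {(p, q) : PrimeSpectrum S × PrimeSpectrum S | p ⋖ q}) :
    (s.length : ℕ∞) ≤ s.last.asIdeal.height := by
  rw [PrimeSpectrum.height_eq_orderHeight]
  exact Order.length_le_height_last (p := s.ofLE fun _ h => h.1)

variable [IsNoetherianRing S]

instance wellFoundedGT_primeSpectrum : WellFoundedGT (PrimeSpectrum S) :=
  StrictMono.wellFoundedGT (f := PrimeSpectrum.asIdeal) fun _ _ h => h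

instance wellFoundedLT_primeSpectrum : WellFoundedLT (PrimeSpectrum S) := by
  refine StrictMono.wellFoundedLT (f := fun p : PrimeSpectrum S => p.asIdeal.height) ?_
  intro p q h
  exact Ideal.height_strict_mono_of_isPrime (show p.asIdeal < q.asIdeal from h)

theorem exists_covBySeries {p q : PrimeSpectrum S} (h : p ≤ q) :
    ∃ s : RelSeries {(p, q) : PrimeSpectrum S × PrimeSpectrum S | p ⋖ q},
      s.head = p ∧ s.last = q := by
  obtain ⟨a, h0, n, hn, ha⟩ := exists_covBy_seq_of_wellFoundedLT_wellFoundedGT_of_le h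
  exact ⟨⟨n, fun i => a i, fun i => ha i i.2⟩, h0, hn⟩

variable [IsDomain S]

/-- In a catenary Noetherian domain the height of a prime is the length of any saturated chain
that joins it to the zero ideal. -/
theorem height_last_eq_length (hS : IsCatenary S)
    (s : RelSeries {(p, q) : PrimeSpectrum S × PrimeSpectrum S | p ⋖ q}) (hs : s.head = ⊥) :
    s.last.asIdeal.height = s.length := by
  refine le_antisymm ?_ (length_le_height_last s)
  obtain ⟨r, hr, hlen⟩ := s.last.asIdeal.exists_ltSeries_length_eq_height
  obtain ⟨t, i, hit, hi0, hi1⟩ := r.exists_relSeries_covBy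
  have hrt : r.length ≤ t.length := by
    have := Fintype.card_le_of_embedding i
    simpa using this
  have hth : t.last = s.last := by
    have h1 : t (i (Fin.last _)) = r (Fin.last _) := congrFun hit _
    rw [hi1] at h1
    exact h1.trans hr
  obtain ⟨a, ha0, ha1⟩ := exists_covBySeries (bot_le : (⊥ : PrimeSpectrum S) ≤ t.head)
  have := hS (a.smash t ha1) s (by rw [RelSeries.head_smash, ha0, hs])
    (by rw [RelSeries.last_smash, hth])
  rw [← hlen, ← this]
  exact_mod_cast hrt.trans (Nat.le_add_left _ _)

theorem height_eq_height_add_one_of_covBy (hS : IsCatenary S) {p q : PrimeSpectrum S}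
    (h : p ⋖ q) : q.asIdeal.height = p.asIdeal.height + 1 := by
  obtain ⟨a, ha0, rfl⟩ := exists_covBySeries (bot_le : (⊥ : PrimeSpectrum S) ≤ p)
  have := height_last_eq_length hS (a.snoc q h) (by rw [RelSeries.head_snoc, ha0])
  rw [RelSeries.last_snoc] at this
  rw [this, height_last_eq_length hS a ha0]
  rfl

/-- In a catenary Noetherian domain two comparable primes are joined by a chain of primes whose
length is the difference of their heights. -/
theorem exists_chain_of_le (hS : IsCatenary S) {p q : PrimeSpectrum S} (h : p ≤ q) :
    ∃ (P : ℕ → PrimeSpectrum S) (r : ℕ), P 0 = p ∧ P r = q ∧ (∀ i < r, P i < P (i + 1)) ∧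
      q.asIdeal.height = p.asIdeal.height + r := by
  obtain ⟨P, h0, r, hr, hP⟩ := exists_covBy_seq_of_wellFoundedLT_wellFoundedGT_of_le h
  refine ⟨P, r, h0, hr, fun i hi => (hP i hi).1, ?_⟩
  rw [← h0, ← hr]
  have : ∀ i ≤ r, (P i).asIdeal.height = (P 0).asIdeal.height + i := by
    intro i
    induction i with
    | zero => simp
    | succ i ih =>
      intro hi
      rw [height_eq_height_add_one_of_covBy hS (hP i hi), ih (by omega)]
      push_cast
      rw [add_assoc]
  exact this r le_rfl

end Catenary

/-! ### Heights of primes in polynomial rings -/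

section PolynomialHeights

variable {A : Type*} [CommRing A]

theorem isMaximal_of_isIntegral_mod {C : Type*} [CommRing C] [Algebra A C] (P : Ideal C)
    [P.IsPrime] (hint : ∀ x : C, ∃ q : Polynomial A, q.Monic ∧ Polynomial.aeval x q ∈ P)
    (hmax : (P.comap (algebraMap A C)).IsMaximal) : P.IsMaximal := by
  have : Algebra.IsIntegral A (C ⧸ P) := by
    refine ⟨fun y => ?_⟩
    obtain ⟨x, rfl⟩ := Ideal.Quotient.mk_surjective y
    obtain ⟨q, hq, hx⟩ := hint x
    refine ⟨q, hq, ?_⟩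
    have := Polynomial.aeval_algHom_apply (Ideal.Quotient.mkₐ A P) x q
    rw [← Polynomial.aeval_def]
    refine this.trans ?_
    exact Ideal.Quotient.eq_zero_iff_mem.2 hx
  rw [← Ideal.bot_quotient_isMaximal_iff]
  refine Ideal.isMaximal_of_isIntegral_of_isMaximal_comap (R := A) (⊥ : Ideal (C ⧸ P)) ?_
  convert hmax
  ext x
  rw [Ideal.mem_comap, Ideal.mem_comap, Ideal.mem_bot,
    IsScalarTower.algebraMap_apply A C (C ⧸ P)]
  exact Ideal.Quotient.eq_zero_iff_mem

/-- A maximal ideal of a polynomial ring in `N` variables over a Noetherian ring with residue field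
integral over the base has height `N` more than its contraction. -/
theorem height_add_le_height [IsNoetherianRing A] (N : ℕ) (P : Ideal (MvPolynomial (Fin N) A))
    [P.IsPrime]
    (hint : ∀ x : MvPolynomial (Fin N) A, ∃ q : Polynomial A, q.Monic ∧ Polynomial.aeval x q ∈ P)
    (hmax : (P.comap (algebraMap A (MvPolynomial (Fin N) A))).IsMaximal) :
    (P.comap (algebraMap A (MvPolynomial (Fin N) A))).height + N ≤ P.height := by
  induction N with
  | zero =>
    have := RingEquiv.height_comap (MvPolynomial.isEmptyAlgEquiv A (Fin 0)).symm.toRingEquiv P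
    simp only [Nat.cast_zero, add_zero]
    rw [← this]
    apply le_of_eq
    congr 1
  | succ n ih =>
    have hPm := isMaximal_of_isIntegral_mod P hint hmax
    let e := MvPolynomial.finSuccEquiv A n
    -- Split off one variable: the maximal ideal `P` has height one more than its contraction `P2`.
    let P1 : Ideal (Polynomial (MvPolynomial (Fin n) A)) := P.comap e.symm
    have hP1 : P1.IsMaximal := Ideal.comap_isMaximal_of_equiv e.symm
    let g : MvPolynomial (Fin n) A →ₐ[A] MvPolynomial (Fin (n + 1)) A :=
      e.symm.toAlgHom.comp (Algebra.ofId _ _ |>.restrictScalars A)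
    let P2 : Ideal (MvPolynomial (Fin n) A) := P.comap g
    have hP2 : P2.IsPrime := Ideal.IsPrime.comap _
    have hl : P1.LiesOver P2 := ⟨rfl⟩
    have h1 := Polynomial.height_eq_height_add_one P2 P1
    have h2 : P1.height = P.height := RingEquiv.height_comap e.symm.toRingEquiv P
    have h3 : P2.comap (algebraMap A _) = P.comap (algebraMap A _) := by
      ext x
      simp only [P2, Ideal.mem_comap, AlgHom.commutes]
    have h4 := ih P2 (fun x => by
      obtain ⟨q, hq, hx⟩ := hint (g x)
      refine ⟨q, hq, ?_⟩
      rw [Polynomial.aeval_algHom_apply] at hx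
      exact hx) (by rw [h3]; exact hmax)
    rw [h3] at h4
    rw [← h2, h1]
    push_cast
    rw [← add_assoc]
    gcongr

attribute [local instance] MvPolynomial.algebraMvPolynomial in
/-- The kernel of a map from a polynomial ring over `A` in `N` variables to a field extension of
the fraction field `K` has height less than `N` if its image contains an element transcendental
over `K`. -/
theorem height_ker_add_one_le [IsDomain A] {K L : Type*} [Field K] [Field L] [Algebra A K]
    [IsFractionRing A K] [Algebra K L] [Algebra A L] [IsScalarTower A K L] {N : ℕ}
    (φ : MvPolynomial (Fin N) A →ₐ[A] L) {y : MvPolynomial (Fin N) A}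
    (hy : Transcendental K (φ y)) : (RingHom.ker φ).height + 1 ≤ N := by
  let ψ : MvPolynomial (Fin N) K →ₐ[K] L := MvPolynomial.aeval fun i => φ (MvPolynomial.X i)
  have hψ : ∀ x, ψ (algebraMap (MvPolynomial (Fin N) A) (MvPolynomial (Fin N) K) x) = φ x := by
    intro x
    have : ((ψ.restrictScalars A).comp (MvPolynomial.mapAlgHom (Algebra.ofId A K))) = φ := by
      ext i
      simp [ψ]
    rw [← this]
    rfl
  have hker : RingHom.ker φ =
      (RingHom.ker ψ).under (MvPolynomial (Fin N) A) := by
    ext x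
    rw [RingHom.mem_ker, Ideal.under, Ideal.mem_comap, RingHom.mem_ker, hψ]
  have : IsLocalization ((nonZeroDivisors A).map (MvPolynomial.C (σ := Fin N)))
    (MvPolynomial (Fin N) K) := MvPolynomial.isLocalization _ _
  rw [hker, IsLocalization.height_under
    ((nonZeroDivisors A).map (MvPolynomial.C (σ := Fin N))) (RingHom.ker ψ)]
  have hprime : (RingHom.ker ψ).IsPrime := RingHom.ker_isPrime _
  -- By the Nullstellensatz, a maximal kernel would make the image algebraic over `K`.
  have hnm : ¬ (RingHom.ker ψ).IsMaximal := by
    intro hm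
    let F := MvPolynomial (Fin N) K ⧸ RingHom.ker ψ
    let : Field F := Ideal.Quotient.field _
    have : Module.Finite K F := finite_of_finite_type_of_isJacobsonRing K F
    have h1 : IsAlgebraic K (Ideal.Quotient.mk (RingHom.ker ψ)
      (algebraMap (MvPolynomial (Fin N) A) (MvPolynomial (Fin N) K) y) : F) :=
      Algebra.IsAlgebraic.isAlgebraic _
    have h2 := h1.algHom (Ideal.kerLiftAlg ψ)
    rw [Ideal.kerLiftAlg_mk, hψ] at h2
    exact hy h2
  obtain ⟨M, hM, hle⟩ := Ideal.exists_le_maximal _ hprime.ne_top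
  have hlt : RingHom.ker ψ < M := lt_of_le_of_ne hle fun h => hnm (h ▸ hM)
  have h1 := Ideal.height_add_one_le_of_lt_of_isPrime hlt
  have h2 : (M.height : WithBot ℕ∞) ≤ _ := Ideal.height_le_ringKrullDim_of_ne_top hM.ne_top
  rw [MvPolynomial.ringKrullDim_of_isNoetherianRing, ringKrullDim_eq_zero_of_field, zero_add,
    Nat.card_fin] at h2
  exact h1.trans (by exact_mod_cast h2)

end PolynomialHeights

/-! ### The irrelevant ideal and chains of primes above an exceptional prime -/

section Irrelevant

variable {A : Type u} [CommRing A] [IsDomain A] {I : Ideal A}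

local notation "K" => FractionRing A

/-- The element `a T` of the extended Rees algebra, for `a ∈ I`. -/
noncomputable def mulT (a : I) : extendedRees I :=
  ⟨RatFunc.C (algebraMap A K a) * RatFunc.X, by
    have := C_mul_X_pow_mem_extendedRees 1 (I := I) (by rw [pow_one]; exact a.2)
    rwa [pow_one] at this⟩

/-- The ideal of the extended Rees algebra generated by `I T` and by the contraction of `Q`. -/
noncomputable def irrelevantIdeal (Q : Ideal (normalizedRees I)) : Ideal (extendedRees I) :=
  Q.comap (algebraMap (extendedRees I) (normalizedRees I)) ⊔ Ideal.span (Set.range mulT)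

theorem algebraMap_mem_of_mem_ideal {Q : Ideal (normalizedRees I)} (hQ : tInv I ∈ Q) {a : A}
    (ha : a ∈ I) : algebraMap A (normalizedRees I) a ∈ Q := by
  have : algebraMap A (normalizedRees I) a =
      algebraMap (extendedRees I) (normalizedRees I) (mulT ⟨a, ha⟩) * tInv I := by
    apply Subtype.ext
    change (algebraMap A (RatFunc K) a) = (RatFunc.C (algebraMap A K a) * RatFunc.X) * RatFunc.X⁻¹
    rw [mul_assoc, mul_inv_cancel₀ RatFunc.X_ne_zero, mul_one]
    rw [IsScalarTower.algebraMap_apply A K (RatFunc K)]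
    rfl
  rw [this]
  exact Q.mul_mem_left _ hQ

theorem exists_sub_mem_irrelevantIdeal {Q : Ideal (normalizedRees I)} (hQ : tInv I ∈ Q)
    (x : extendedRees I) : ∃ a : A, x - algebraMap A (extendedRees I) a ∈ irrelevantIdeal Q := by
  obtain ⟨x, hx⟩ := x
  refine Algebra.adjoin_induction (p := fun x hx => ∃ a : A,
    (⟨x, hx⟩ : extendedRees I) - algebraMap A (extendedRees I) a ∈ irrelevantIdeal Q)
    ?_ ?_ ?_ ?_ hx
  · rintro x (rfl | ⟨a, ha, rfl⟩)
    · refine ⟨0, ?_⟩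
      rw [map_zero, sub_zero]
      exact Ideal.mem_sup_left hQ
    · refine ⟨0, ?_⟩
      rw [map_zero, sub_zero]
      exact Ideal.mem_sup_right (Ideal.subset_span ⟨⟨a, ha⟩, rfl⟩)
  · intro a
    refine ⟨a, ?_⟩
    convert (irrelevantIdeal Q).zero_mem
    exact sub_self (algebraMap A (extendedRees I) a)
  · rintro x y hx hy ⟨a, ha⟩ ⟨b, hb⟩
    refine ⟨a + b, ?_⟩
    convert (irrelevantIdeal Q).add_mem ha hb using 1
    rw [map_add]
    change (⟨x, hx⟩ : extendedRees I) + ⟨y, hy⟩ - _ = _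
    ring
  · rintro x y hx hy ⟨a, ha⟩ ⟨b, hb⟩
    refine ⟨a * b, ?_⟩
    convert (irrelevantIdeal Q).add_mem ((irrelevantIdeal Q).mul_mem_right ⟨y, hy⟩ ha)
      ((irrelevantIdeal Q).mul_mem_left (algebraMap A (extendedRees I) a) hb) using 1
    rw [map_mul]
    change (⟨x, hx⟩ : extendedRees I) * ⟨y, hy⟩ - _ = _
    ring

variable [IsNoetherianRing A] [IsNoetherianRing (normalizedRees I)] {Q : Ideal (normalizedRees I)}

theorem component_zero_mem_of_mem_irrelevantIdeal (hQ : Q ∈ exceptionalPrimes I)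
    {x : extendedRees I} (hx : x ∈ irrelevantIdeal Q) :
    component (algebraMap (extendedRees I) (normalizedRees I) x) 0 ∈ Q := by
  have hτ := tInv_mem_of_mem_exceptionalPrimes hQ
  obtain ⟨p, hp, y, hy, rfl⟩ := Submodule.mem_sup.1 hx
  rw [map_add, component_add]
  refine Q.add_mem (component_mem_of_mem_exceptionalPrimes hQ hp 0) ?_
  have : ∀ r : extendedRees I,
      component (algebraMap (extendedRees I) (normalizedRees I) (r * y)) 0 ∈ Q := by
    refine Submodule.span_induction (p := fun y _ => ∀ r : extendedRees I,
      component (algebraMap (extendedRees I) (normalizedRees I) (r * y)) 0 ∈ Q) ?_ ?_ ?_ ?_ hy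
    · rintro _ ⟨a, rfl⟩ r
      have h1 : ((algebraMap (extendedRees I) (normalizedRees I) (mulT a) : normalizedRees I) :
          RatFunc K) = RatFunc.C (algebraMap A K a) * RatFunc.X ^ (1 : ℤ) := by
        rw [zpow_one]
        rfl
      -- the component of degree `0` of `r a T` is `b a` with `b T⁻¹` the component of degree `-1`
      -- of `r`, and `a` is `a T` times `T⁻¹ ∈ Q`
      rw [mul_comm, map_mul]
      have h2 := component_single_mul h1 (algebraMap (extendedRees I) (normalizedRees I) r) (-1)
      rw [show (1 : ℤ) + -1 = 0 by norm_num] at h2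
      rw [h2]
      obtain ⟨f, hf, hfr⟩ := mem_extendedRees_iff.1 r.2
      obtain ⟨b, -, hb⟩ := mem_reesPiece.1 (mem_laurentRees.1 hf (-1))
      have h3 : laurentOf (algebraMap (extendedRees I) (normalizedRees I) r) = f :=
        laurentOf_eq hfr
      have h4 : algebraMap (extendedRees I) (normalizedRees I) (mulT a) *
          component (algebraMap (extendedRees I) (normalizedRees I) r) (-1) =
          algebraMap A (normalizedRees I) b * algebraMap A (normalizedRees I) a := by
        apply Subtype.ext
        change (RatFunc.C (algebraMap A K a) * RatFunc.X) *
          (component (algebraMap (extendedRees I) (normalizedRees I) r) (-1) : RatFunc K) =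
          algebraMap A (RatFunc K) b * algebraMap A (RatFunc K) a
        rw [coe_component, h3, ← hb, IsScalarTower.algebraMap_apply A K (RatFunc K),
          IsScalarTower.algebraMap_apply A K (RatFunc K), zpow_neg_one]
        change _ = RatFunc.C _ * RatFunc.C _
        have : (RatFunc.X : RatFunc K) ≠ 0 := RatFunc.X_ne_zero
        field_simp
      rw [h4]
      exact Q.mul_mem_left _ (algebraMap_mem_of_mem_ideal hτ a.2)
    · intro r
      rw [mul_zero, map_zero]
      exact component_mem_of_mem_exceptionalPrimes hQ Q.zero_mem 0
    · intro x y _ _ hx hy r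
      rw [mul_add, map_add, component_add]
      exact Q.add_mem (hx r) (hy r)
    · intro s x _ hx r
      rw [smul_eq_mul, ← mul_assoc]
      exact hx _
  simpa using this 1

theorem one_notMem_irrelevantIdeal (hQ : Q ∈ exceptionalPrimes I) : 1 ∉ irrelevantIdeal Q := by
  intro h
  have h1 := component_zero_mem_of_mem_irrelevantIdeal hQ h
  rw [component_eq_of_single (c := 1) (n := 0) (by simp), if_pos rfl, map_one] at h1
  exact hQ.1.ne_top ((Ideal.eq_top_iff_one Q).2 h1)

end Irrelevant

section Chain

variable {A : Type u} [CommRing A] [IsDomain A] [IsLocalRing A] [IsNoetherianRing A]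

open IsLocalRing (maximalIdeal)

variable [IsNoetherianRing (normalizedRees (maximalIdeal A))]
  {Q : Ideal (normalizedRees (maximalIdeal A))}

theorem irrelevantIdeal_isMaximal (hQ : Q ∈ exceptionalPrimes (maximalIdeal A)) :
    (irrelevantIdeal Q).IsMaximal := by
  have hτ := tInv_mem_of_mem_exceptionalPrimes hQ
  refine Ideal.isMaximal_iff.2 ⟨one_notMem_irrelevantIdeal hQ, fun J x hJ hx hxJ => ?_⟩
  obtain ⟨a, ha⟩ := exists_sub_mem_irrelevantIdeal hτ x
  have haJ : algebraMap A (extendedRees (maximalIdeal A)) a ∈ J := by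
    have := J.sub_mem hxJ (hJ ha)
    rwa [sub_sub_cancel] at this
  have hu : IsUnit a := by
    by_contra h
    refine hx ?_
    have h1 : algebraMap A (extendedRees (maximalIdeal A)) a ∈ irrelevantIdeal Q :=
      Ideal.mem_sup_left (algebraMap_mem_of_mem_ideal hτ ((IsLocalRing.mem_maximalIdeal a).2 h))
    have := (irrelevantIdeal Q).add_mem ha h1
    rwa [sub_add_cancel] at this
  exact (Ideal.eq_top_iff_one J).1 (Ideal.eq_top_of_isUnit_mem J haJ (hu.map _))

theorem comap_irrelevantIdeal (hQ : Q ∈ exceptionalPrimes (maximalIdeal A)) :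
    (irrelevantIdeal Q).comap (algebraMap A (extendedRees (maximalIdeal A))) = maximalIdeal A := by
  have hτ := tInv_mem_of_mem_exceptionalPrimes hQ
  refine ((IsLocalRing.maximalIdeal.isMaximal A).eq_of_le ?_ fun a ha => ?_).symm
  · exact (Ideal.IsPrime.comap (hK := (irrelevantIdeal_isMaximal hQ).isPrime) _).ne_top
  · exact Ideal.mem_sup_left (algebraMap_mem_of_mem_ideal hτ ha)

omit [IsNoetherianRing A] in
theorem exists_monic_aeval_mem (hQ : Q ∈ exceptionalPrimes (maximalIdeal A))
    {n : Ideal (normalizedRees (maximalIdeal A))}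
    (hn : n.comap (algebraMap (extendedRees (maximalIdeal A)) (normalizedRees (maximalIdeal A))) =
      irrelevantIdeal Q)
    (x : normalizedRees (maximalIdeal A)) :
    ∃ q : Polynomial A, q.Monic ∧ Polynomial.aeval x q ∈ n := by
  have hτ := tInv_mem_of_mem_exceptionalPrimes hQ
  let f : A →+* extendedRees (maximalIdeal A) ⧸ irrelevantIdeal Q :=
    (Ideal.Quotient.mk _).comp (algebraMap A (extendedRees (maximalIdeal A)))
  have hf : f.IsIntegral := by
    refine RingHom.isIntegral_of_surjective _ fun y => ?_
    obtain ⟨y, rfl⟩ := Ideal.Quotient.mk_surjective y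
    obtain ⟨a, ha⟩ := exists_sub_mem_irrelevantIdeal hτ y
    exact ⟨a, (Ideal.Quotient.eq.2 ha).symm⟩
  let g : extendedRees (maximalIdeal A) ⧸ irrelevantIdeal Q →+*
      normalizedRees (maximalIdeal A) ⧸ n :=
    Ideal.quotientMap n
      (algebraMap (extendedRees (maximalIdeal A)) (normalizedRees (maximalIdeal A)))
      hn.ge
  have hg : g.IsIntegral := by
    refine RingHom.IsIntegral.tower_top (Ideal.Quotient.mk _) g ?_
    have : g.comp (Ideal.Quotient.mk _) =
      (Ideal.Quotient.mk n).comp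
        (algebraMap (extendedRees (maximalIdeal A)) (normalizedRees (maximalIdeal A))) := by
      ext; rfl
    rw [this]
    exact RingHom.IsIntegral.trans _ _ (algebraMap_isIntegral_iff.2 inferInstance)
      (RingHom.isIntegral_of_surjective _ Ideal.Quotient.mk_surjective)
  obtain ⟨q, hq, hqx⟩ := RingHom.IsIntegral.trans f g hf hg (Ideal.Quotient.mk n x)
  refine ⟨q, hq, Ideal.Quotient.eq_zero_iff_mem.1 ?_⟩
  rw [← hqx, Polynomial.aeval_def, Polynomial.hom_eval₂]
  rfl

/-- Above the contraction of an exceptional prime of the maximal ideal to the extended Rees algebra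
there is a chain of primes of length at least `dim A` that ends in the irrelevant ideal. The
exceptional prime has height one, and the extended Rees algebra has the dimension one would expect
because `A` is universally catenary. -/
theorem exists_chain_of_mem_exceptionalPrimes
    [Module.Finite (extendedRees (maximalIdeal A)) (normalizedRees (maximalIdeal A))]
    (hcat : ∀ N : ℕ, IsCatenary (MvPolynomial (Fin N) A))
    (hQ : Q ∈ exceptionalPrimes (maximalIdeal A)) :
    ∃ (P : ℕ → Ideal (extendedRees (maximalIdeal A))) (r : ℕ), (∀ i ≤ r, (P i).IsPrime) ∧
      (∀ i < r, P i < P (i + 1)) ∧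
      P 0 = Q.comap (algebraMap (extendedRees (maximalIdeal A)) (normalizedRees (maximalIdeal A))) ∧
      P r = irrelevantIdeal Q ∧ (maximalIdeal A).height ≤ r := by
  have hQp : Q.IsPrime := hQ.1
  have := (irrelevantIdeal_isMaximal hQ).isPrime
  -- a prime of the normalized algebra above `Q` and over the irrelevant ideal, by going up
  obtain ⟨n, hQn, hnp, hn⟩ := Ideal.exists_ideal_over_prime_of_isIntegral (irrelevantIdeal Q) Q
    le_sup_left
  have := extendedRees_finiteType (maximalIdeal A)
  -- Write the normalized algebra as a quotient of a polynomial ring over `A`.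
  have hft : Algebra.FiniteType A (normalizedRees (maximalIdeal A)) :=
    Algebra.FiniteType.trans (S := extendedRees (maximalIdeal A)) inferInstance inferInstance
  obtain ⟨N, Φ, hΦ⟩ := Algebra.FiniteType.iff_quotient_mvPolynomial''.1 hft
  have hcomapmap : ∀ P : PrimeSpectrum (MvPolynomial (Fin N) A), RingHom.ker Φ ≤ P.asIdeal →
      (P.asIdeal.map Φ).IsPrime ∧ (P.asIdeal.map Φ).comap Φ = P.asIdeal := by
    intro P hP
    refine ⟨Ideal.map_isPrime_of_surjective hΦ hP, ?_⟩
    rw [Ideal.comap_map_of_surjective Φ hΦ]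
    exact sup_eq_left.2 hP
  let q0 : PrimeSpectrum (MvPolynomial (Fin N) A) := ⟨RingHom.ker Φ, RingHom.ker_isPrime _⟩
  let q1 : PrimeSpectrum (MvPolynomial (Fin N) A) := ⟨Q.comap Φ, inferInstance⟩
  let q2 : PrimeSpectrum (MvPolynomial (Fin N) A) := ⟨n.comap Φ, inferInstance⟩
  -- `Q` has height one
  have hcov : q0 ⋖ q1 := by
    constructor
    · obtain ⟨y, hy⟩ := hΦ (tInv (maximalIdeal A))
      change q0.asIdeal < q1.asIdeal
      refine SetLike.lt_iff_le_and_exists.2 ⟨fun x hx => ?_, y, ?_, ?_⟩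
      · have hx' : Φ x = 0 := hx
        change Φ x ∈ Q
        rw [hx']
        exact Q.zero_mem
      · change Φ y ∈ Q
        rw [hy]
        exact tInv_mem_of_mem_exceptionalPrimes hQ
      · intro h
        exact tInv_ne_zero (maximalIdeal A) (hy.symm.trans h)
    · intro P h1 h2
      obtain ⟨x, hxP, hx⟩ := SetLike.exists_of_lt (show q0.asIdeal < P.asIdeal from h1)
      obtain ⟨hP1, hP2⟩ := hcomapmap P h1.le
      have h3 : P.asIdeal.map Φ ≤ Q := Ideal.map_le_iff_le_comap.2 h2.le
      have h4 := (isDiscreteAt_exceptionalVal hQ).le_of_isPrime hP1 h3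
        (Ideal.mem_map_of_mem Φ hxP) hx
      refine h2.not_ge ?_
      change Q.comap Φ ≤ P.asIdeal
      rw [← hP2]
      exact Ideal.comap_mono h4
  -- a chain between the preimages of `Q` and `n`, of length the difference of their heights
  obtain ⟨P, r, hP0, hPr, hPlt, hht⟩ := exists_chain_of_le (hcat N)
    (show q1 ≤ q2 from Ideal.comap_mono hQn)
  have hmono : ∀ i ≤ r, q1 ≤ P i := by
    intro i
    induction i with
    | zero => exact fun _ => hP0.ge
    | succ i ih => exact fun hi => (ih (by omega)).trans (hPlt i hi).le
  have hker : ∀ i ≤ r, RingHom.ker Φ ≤ (P i).asIdeal := fun i hi => hcov.1.le.trans (hmono i hi)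
  refine ⟨fun i => ((P i).asIdeal.map Φ).comap
    (algebraMap (extendedRees (maximalIdeal A)) (normalizedRees (maximalIdeal A))), r,
      fun i hi => ?_, fun i hi => ?_, ?_, ?_, ?_⟩
  · have := (hcomapmap _ (hker i hi)).1
    infer_instance
  · obtain ⟨h1, h2⟩ := hcomapmap _ (hker i hi.le)
    obtain ⟨h3, h4⟩ := hcomapmap _ (hker (i + 1) hi)
    have h5 : (P i).asIdeal.map Φ < (P (i + 1)).asIdeal.map Φ := by
      refine lt_of_le_of_ne (Ideal.map_mono (hPlt i hi).le) fun h => ?_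
      refine (hPlt i hi).ne (PrimeSpectrum.ext ?_)
      rw [← h2, h, h4]
    obtain ⟨x, hx1, hx2⟩ := SetLike.exists_of_lt h5
    exact Ideal.comap_lt_comap_of_integral_mem_sdiff h5.le ⟨hx1, hx2⟩
      (Algebra.IsIntegral.isIntegral x)
  · change ((P 0).asIdeal.map Φ).comap _ = _
    rw [hP0]
    exact congrArg _ (Ideal.map_comap_of_surjective Φ hΦ Q)
  · change ((P r).asIdeal.map Φ).comap _ = _
    rw [hPr, ← hn]
    exact congrArg _ (Ideal.map_comap_of_surjective Φ hΦ n)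
  · have hmax : q2.asIdeal.comap (algebraMap A (MvPolynomial (Fin N) A)) = maximalIdeal A := by
      rw [← comap_irrelevantIdeal hQ, ← hn]
      ext a
      change Φ (algebraMap A _ a) ∈ n ↔ _
      rw [AlgHom.commutes]
      rfl
    -- The height of `n` in the polynomial ring is at least `dim A + N`, that of `Q` at most `N`.
    have h1 := height_add_le_height N q2.asIdeal (fun x => by
      obtain ⟨q, hq, hx⟩ := exists_monic_aeval_mem hQ hn (Φ x)
      refine ⟨q, hq, ?_⟩
      rw [Polynomial.aeval_algHom_apply] at hx
      exact hx) (by rw [hmax]; exact IsLocalRing.maximalIdeal.isMaximal A)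
    rw [hmax] at h1
    obtain ⟨y, hy⟩ := hΦ (tInv (maximalIdeal A))
    have h2 := height_ker_add_one_le (K := FractionRing A)
      ((normalizedRees (maximalIdeal A)).val.comp Φ) (y := y) (by
        change Transcendental (FractionRing A) (Φ y : RatFunc (FractionRing A))
        rw [hy]
        change Transcendental (FractionRing A) (RatFunc.X⁻¹ : RatFunc (FractionRing A))
        intro h
        have := h.inv
        rw [inv_inv] at this
        exact RatFunc.transcendental_X this)
    have h3 : RingHom.ker ((normalizedRees (maximalIdeal A)).val.comp Φ) = q0.asIdeal := by
      ext x
      exact ⟨fun h => Subtype.ext h, fun h => congrArg Subtype.val h⟩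
    rw [h3, ← height_eq_height_add_one_of_covBy (hcat N) hcov] at h2
    rw [hht] at h1
    have h4 : (maximalIdeal A).height + (N : ℕ∞) ≤ r + N := by
      refine h1.trans ?_
      rw [add_comm]
      gcongr
    exact (ENat.add_le_add_iff_right (ENat.natCast_ne_top N)).1 h4

end Chain

/-! ### The Hilbert function of an exceptional prime -/

open Polynomial in
theorem HasPoly.natDegree_le_of_diff {f c : ℕ → ℕ∞} {p pc : ℚ[X]} (hf : HasPoly f p)
    (hc : HasPoly c pc) (h : ∀ n, f (n + 1) = c n + f n) : p.natDegree ≤ pc.natDegree + 1 := by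
  rcases Nat.eq_zero_or_pos p.natDegree with h0 | h0
  · omega
  obtain ⟨t, ht⟩ : ∃ t, p.natDegree = t + 1 := ⟨p.natDegree - 1, by omega⟩
  have h1 : HasPoly (fun n => c (n - 1)) (p - p.comp (X - C ((1 : ℕ) : ℚ))) := by
    refine hf.sub (hf.shift_sub 1) ?_
    filter_upwards [eventually_ge_atTop 1] with n hn
    obtain ⟨n, rfl⟩ : ∃ k, n = k + 1 := ⟨n - 1, by omega⟩
    exact (h n).symm
  have h2 := h1.natDegree_mono (hc.shift_sub 1) (Eventually.of_forall fun n => le_rfl)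
  have h3 : (pc.comp (X - C ((1 : ℕ) : ℚ))).natDegree ≤ pc.natDegree := by
    refine natDegree_comp_le.trans ?_
    rw [natDegree_X_sub_C, mul_one]
  obtain ⟨-, h4⟩ := natDegree_comp_X_add_C_sub_lt ht.le ((1 : ℕ) : ℚ)
  have h5 : t ≤ (p - p.comp (X - C ((1 : ℕ) : ℚ))).natDegree := by
    refine le_natDegree_of_ne_zero ?_
    rw [h4, ← ht]
    have : p.leadingCoeff ≠ 0 := by
      rw [Ne, leadingCoeff_eq_zero]
      rintro rfl
      simp at ht
    rw [coeff_natDegree]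
    have ht' : ((t : ℚ) + 1) ≠ 0 := by positivity
    simp only [Nat.cast_one, mul_one]
    exact mul_ne_zero ht' this
  omega

section ValPiece

variable {A : Type u} [CommRing A] [IsDomain A] {I : Ideal A}

local notation "K" => FractionRing A

/-- The map `s ↦ s T ^ n` from `I ^ n` to the extended Rees algebra. -/
noncomputable def monomialMap (I : Ideal A) (n : ℕ) : (I ^ n : Ideal A) →ₗ[A] extendedRees I where
  toFun s := ⟨RatFunc.C (algebraMap A K s) * RatFunc.X ^ n, C_mul_X_pow_mem_extendedRees n s.2⟩
  map_add' s t := by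
    apply Subtype.ext
    change RatFunc.C (algebraMap A K (s + t : A)) * RatFunc.X ^ n = _ + _
    rw [map_add, map_add, add_mul]
  map_smul' a s := by
    apply Subtype.ext
    change RatFunc.C (algebraMap A K (a * s : A)) * RatFunc.X ^ n = a • (_ : RatFunc K)
    rw [extendedRees_smul, map_mul, map_mul, mul_assoc]

/-- The ideal of all `s ∈ I ^ n` such that `s T ^ n` lies in `Q`. -/
noncomputable def valPiece (Q : Ideal (normalizedRees I)) (n : ℕ) : Ideal A :=
  Submodule.map (Submodule.subtype (I ^ n)) (Submodule.comap (monomialMap I n)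
    ((Q.comap (algebraMap (extendedRees I) (normalizedRees I))).restrictScalars A))

theorem mem_valPiece {Q : Ideal (normalizedRees I)} {n : ℕ} {s : A} : s ∈ valPiece Q n ↔
    ∃ h : s ∈ I ^ n, algebraMap (extendedRees I) (normalizedRees I)
      (monomialMap I n ⟨s, h⟩) ∈ Q := by
  constructor
  · rintro ⟨s, hs, rfl⟩
    exact ⟨s.2, hs⟩
  · rintro ⟨h, hs⟩
    exact ⟨⟨s, h⟩, hs, rfl⟩

theorem valPiece_le (Q : Ideal (normalizedRees I)) (n : ℕ) : valPiece Q n ≤ I ^ n := fun _ h =>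
  (mem_valPiece.1 h).1

theorem pow_succ_le_valPiece {Q : Ideal (normalizedRees I)} (hQ : tInv I ∈ Q) (n : ℕ) :
    I ^ (n + 1) ≤ valPiece Q n := by
  intro s hs
  refine mem_valPiece.2 ⟨Ideal.pow_le_pow_right n.le_succ hs, ?_⟩
  convert Q.mul_mem_left (algebraMap (extendedRees I) (normalizedRees I)
    (monomialMap I (n + 1) ⟨s, hs⟩)) hQ
  apply Subtype.ext
  change RatFunc.C (algebraMap A K s) * RatFunc.X ^ n =
    (RatFunc.C (algebraMap A K s) * RatFunc.X ^ (n + 1)) * RatFunc.X⁻¹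
  rw [pow_succ, mul_assoc, mul_assoc, mul_inv_cancel₀ RatFunc.X_ne_zero, mul_one]

/-- The filtration by the ideals `valPiece Q n`. -/
noncomputable def valFiltration {Q : Ideal (normalizedRees I)} (hQ : tInv I ∈ Q) :
    I.Filtration A where
  N := valPiece Q
  mono n := (valPiece_le Q (n + 1)).trans (pow_succ_le_valPiece hQ n)
  smul_le n := by
    rw [Submodule.smul_le]
    intro a ha s hs
    obtain ⟨h, hs⟩ := mem_valPiece.1 hs
    have has : a * s ∈ I ^ (n + 1) := by
      rw [pow_succ']
      exact Ideal.mul_mem_mul ha h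
    refine mem_valPiece.2 ⟨has, ?_⟩
    convert Q.mul_mem_left (algebraMap (extendedRees I) (normalizedRees I) (mulT ⟨a, ha⟩)) hs
    apply Subtype.ext
    change RatFunc.C (algebraMap A K (a * s)) * RatFunc.X ^ (n + 1) =
      (RatFunc.C (algebraMap A K a) * RatFunc.X) * (RatFunc.C (algebraMap A K s) * RatFunc.X ^ n)
    rw [map_mul, map_mul]
    ring

theorem length_quotient_le_relLen_restrictScalars {A B : Type*} [CommRing A] [CommRing B]
    [Algebra A B] (N : Ideal B) :
    Module.length B (B ⧸ N) ≤ relLen (N.restrictScalars A) ⊤ := by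
  rw [relLen_top]
  have h := Submodule.length_le_length_restrictScalars A (⊤ : Submodule B (B ⧸ N))
  rw [Module.length_top, Submodule.restrictScalars_top, Module.length_top] at h
  exact h.trans (Submodule.Quotient.restrictScalarsEquiv A N).symm.length_eq.le

theorem length_quotient_ne_top_of_isMaximal {B : Type*} [CommRing B] {N : Ideal B}
    (hN : N.IsMaximal) : Module.length B (B ⧸ N) ≠ ⊤ := by
  have : IsSimpleModule B (B ⧸ N) := isSimpleModule_iff_isCoatom.2 hN.1
  rw [Module.length_eq_one]
  exact ENat.one_ne_top

/-- The length of the degree `n` part of the quotient of the extended Rees algebra by the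
contraction of `Q`. -/
noncomputable def valHilbert (Q : Ideal (normalizedRees I)) (n : ℕ) : ℕ∞ :=
  relLen (valPiece Q n) (I ^ n)

theorem relLen_range_monomialMap_le {Q : Ideal (normalizedRees I)} {n : ℕ}
    {U : Submodule A (extendedRees I)}
    (hU : (Q.comap (algebraMap (extendedRees I) (normalizedRees I))).restrictScalars A ≤ U) :
    relLen U (U ⊔ LinearMap.range (monomialMap I n)) ≤ valHilbert Q n := by
  have h1 := relLen_sup_map (Submodule.subtype (I ^ n)) ⊤ (valPiece Q n)
  rw [Submodule.map_top, Submodule.range_subtype, sup_eq_right.2 (valPiece_le Q n), top_inf_eq,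
    valPiece, Submodule.comap_map_eq_of_injective (Submodule.subtype_injective _)] at h1
  rw [valHilbert, valPiece, h1, ← Submodule.map_top, relLen_sup_map, top_inf_eq]
  exact relLen_anti _ (Submodule.comap_mono hU)

theorem monomialMap_mem_irrelevantIdeal_pow (Q : Ideal (normalizedRees I)) (n : ℕ)
    (s : (I ^ n : Ideal A)) : monomialMap I n s ∈ irrelevantIdeal Q ^ n := by
  obtain ⟨s, hs⟩ := s
  induction n generalizing s with
  | zero => rw [pow_zero, Ideal.one_eq_top]; trivial
  | succ n ih =>
    have key : ∃ h : s ∈ I ^ (n + 1),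
        monomialMap I (n + 1) ⟨s, h⟩ ∈ irrelevantIdeal Q ^ (n + 1) := by
      have hs' := hs
      rw [pow_succ] at hs'
      refine Submodule.mul_induction_on hs' ?_ ?_
      · intro x hx y hy
        refine ⟨by rw [pow_succ]; exact Ideal.mul_mem_mul hx hy, ?_⟩
        rw [pow_succ]
        have hT : mulT ⟨y, hy⟩ ∈ irrelevantIdeal Q :=
          Ideal.mem_sup_right (Ideal.subset_span ⟨⟨y, hy⟩, rfl⟩)
        convert Ideal.mul_mem_mul (ih x hx) hT
        apply Subtype.ext
        change RatFunc.C (algebraMap A K (x * y)) * RatFunc.X ^ (n + 1) =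
          (RatFunc.C (algebraMap A K x) * RatFunc.X ^ n) *
            (RatFunc.C (algebraMap A K y) * RatFunc.X)
        rw [map_mul, map_mul]
        ring
      · rintro x y ⟨hx, hx'⟩ ⟨hy, hy'⟩
        refine ⟨add_mem hx hy, ?_⟩
        have := Ideal.add_mem _ hx' hy'
        rwa [← map_add] at this
    exact key.2

variable [IsNoetherianRing A]

theorem valHilbert_ne_top {Q : Ideal (normalizedRees I)} (hQ : tInv I ∈ Q)
    (hI : Module.length A (A ⧸ I) ≠ ⊤) (n : ℕ) : valHilbert Q n ≠ ⊤ := by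
  have := relLen_pow_smul_ne_top (M := A) hI n
  simp only [smul_eq_mul, Ideal.mul_top] at this
  exact ne_top_of_le_ne_top this (relLen_anti _ (pow_succ_le_valPiece hQ n))

theorem exists_hasPoly_valHilbert {Q : Ideal (normalizedRees I)} (hQ : tInv I ∈ Q)
    (hI : Module.length A (A ⧸ I) ≠ ⊤) : ∃ p, HasPoly (valHilbert Q) p := by
  obtain ⟨T, hT⟩ := IsNoetherian.noetherian I
  have hN : ∀ n, (I.stableFiltration (⊤ : Submodule A A)).N n = I ^ n := by
    intro n
    change I ^ n • (⊤ : Submodule A A) = I ^ n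
    rw [smul_eq_mul, Ideal.mul_top]
  obtain ⟨p, hp⟩ := exists_hasPoly_relLen T ⊥ (by rw [bot_sup_eq]; exact hT.symm)
    (I.stableFiltration (⊤ : Submodule A A)) (valFiltration hQ) (I.stableFiltration_stable ⊤)
    (fun n => by rw [hN]; exact valPiece_le Q n) (by
      intro n u hu y _
      rw [(Submodule.mem_bot A).1 hu, zero_smul]
      exact zero_mem _) (fun n => by rw [hN]; exact valHilbert_ne_top hQ hI n)
  refine ⟨p, hp.congr (Eventually.of_forall fun n => ?_)⟩
  rw [hN]
  rfl

omit [IsNoetherianRing A] in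
theorem sup_iSup_range_monomialMap_eq_top {Q : Ideal (normalizedRees I)} (hQ : tInv I ∈ Q) (n : ℕ) :
    (Q.comap (algebraMap (extendedRees I) (normalizedRees I)) ⊔
      irrelevantIdeal Q ^ n).restrictScalars A ⊔
      ⨆ i ∈ Finset.range n, LinearMap.range (monomialMap I i) = ⊤ := by
  rw [eq_top_iff]
  rintro ⟨x, hx⟩ -
  obtain ⟨f, hf, rfl⟩ := mem_extendedRees_iff.1 hx
  have hmem : ∀ i : ℤ, RatFunc.C (f.coeff i) * RatFunc.X ^ i ∈ extendedRees I := fun i =>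
    laurentToRatFunc_single_mem_extendedRees (hf i)
  have hsum : (⟨laurentToRatFunc K f, hx⟩ : extendedRees I) =
      ∑ i ∈ f.coeff.support, ⟨_, hmem i⟩ := by
    apply Subtype.ext
    rw [AddSubmonoidClass.coe_finsetSum]
    exact laurent_eq_sum f
  rw [hsum]
  refine sum_mem fun i _ => ?_
  obtain ⟨a, ha, hai⟩ := mem_reesPiece.1 (hf i)
  rcases lt_or_ge i 0 with hi | hi
  · refine Submodule.mem_sup_left (Ideal.mem_sup_left ?_)
    obtain ⟨j, rfl⟩ : ∃ j : ℕ, i = -(j + 1 : ℕ) := ⟨(-i - 1).toNat, by omega⟩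
    have : algebraMap (extendedRees I) (normalizedRees I) ⟨_, hmem (-(j + 1 : ℕ))⟩ =
        (algebraMap A (normalizedRees I) a * tInv I ^ j) * tInv I := by
      apply Subtype.ext
      change RatFunc.C (f.coeff (-(j + 1 : ℕ))) * RatFunc.X ^ (-(j + 1 : ℕ) : ℤ) =
        (algebraMap A (RatFunc K) a * RatFunc.X⁻¹ ^ j) * RatFunc.X⁻¹
      rw [← hai, IsScalarTower.algebraMap_apply A K (RatFunc K), zpow_neg, zpow_natCast, mul_assoc,
        ← pow_succ, inv_pow]
      rfl
    rw [Ideal.mem_comap, this]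
    exact Q.mul_mem_left _ hQ
  · obtain ⟨j, rfl⟩ := Int.eq_ofNat_of_zero_le hi
    have hx' : (⟨_, hmem j⟩ : extendedRees I) = monomialMap I j ⟨a, ha⟩ := by
      apply Subtype.ext
      change RatFunc.C (f.coeff j) * RatFunc.X ^ (j : ℤ) = RatFunc.C (algebraMap A K a) * _
      rw [hai, zpow_natCast]
    rw [hx']
    rcases lt_or_ge j n with hj | hj
    · exact Submodule.mem_sup_right (Submodule.mem_iSup_of_mem j
        (Submodule.mem_iSup_of_mem (Finset.mem_range.2 hj) ⟨_, rfl⟩))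
    · exact Submodule.mem_sup_left (Ideal.mem_sup_right
        (Ideal.pow_le_pow_right hj (monomialMap_mem_irrelevantIdeal_pow Q j _)))

/-- A shortcut for the synthesis of instances. -/
noncomputable instance (N : Ideal (extendedRees I)) :
    Module (extendedRees I) (extendedRees I ⧸ N) :=
  Submodule.Quotient.module N

omit [IsNoetherianRing A] in
theorem length_quotient_irrelevantIdeal_le {Q : Ideal (normalizedRees I)} (hQ : tInv I ∈ Q)
    (n : ℕ) : Module.length (extendedRees I) (extendedRees I ⧸
      (Q.comap (algebraMap (extendedRees I) (normalizedRees I)) ⊔ irrelevantIdeal Q ^ n)) ≤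
    ∑ i ∈ Finset.range n, valHilbert Q i := by
  set N := Q.comap (algebraMap (extendedRees I) (normalizedRees I)) ⊔ irrelevantIdeal Q ^ n with hN
  refine (length_quotient_le_relLen_restrictScalars (A := A) N).trans ?_
  rw [← sup_iSup_range_monomialMap_eq_top hQ n, ← hN]
  have : ∀ k, relLen (N.restrictScalars A) (N.restrictScalars A ⊔
      ⨆ i ∈ Finset.range k, LinearMap.range (monomialMap I i)) ≤
      ∑ i ∈ Finset.range k, valHilbert Q i := by
    intro k
    induction k with
    | zero => simp [relLen_eq_zero]
    | succ k ih =>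
      have h2 : N.restrictScalars A ⊔
          ⨆ i ∈ Finset.range (k + 1), LinearMap.range (monomialMap I i) = (N.restrictScalars A ⊔
          ⨆ i ∈ Finset.range k, LinearMap.range (monomialMap I i)) ⊔
          LinearMap.range (monomialMap I k) := by
        rw [Finset.range_add_one, Finset.iSup_insert, sup_assoc, sup_comm (LinearMap.range _)]
      rw [h2, ← relLen_add le_sup_left le_sup_left, Finset.sum_range_succ]
      refine add_le_add ih (relLen_range_monomialMap_le (le_trans ?_ le_sup_left))
      exact le_sup_left (a := Q.comap (algebraMap (extendedRees I) (normalizedRees I)))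
  exact this n

variable [IsNoetherianRing (normalizedRees I)] {Q : Ideal (normalizedRees I)}

omit [IsNoetherianRing A] in
theorem mem_valPiece_iff_lt (hQ : Q ∈ exceptionalPrimes I) {n : ℕ} {s : A} (hs : s ∈ I ^ n)
    (hs0 : s ≠ 0) : s ∈ valPiece Q n ↔ n * exceptionalVal Q (tInv I : RatFunc K) <
      exceptionalVal Q (RatFunc.C (algebraMap A K s)) := by
  have hs0' : algebraMap A K s ≠ 0 := by rwa [Ne, map_eq_zero_iff _ (IsFractionRing.injective A K)]
  have h0 : algebraMap (extendedRees I) (normalizedRees I) (monomialMap I n ⟨s, hs⟩) ≠ 0 := by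
    intro h
    exact mul_ne_zero (C_ne_zero hs0') (pow_ne_zero n RatFunc.X_ne_zero) (congrArg Subtype.val h)
  rw [mem_valPiece, exists_prop_of_true hs,
    ← (isDiscreteAt_exceptionalVal hQ).pos_iff _ h0]
  change 0 < exceptionalVal Q (RatFunc.C (algebraMap A K s) * RatFunc.X ^ n) ↔ _
  rw [← zpow_natCast, exceptionalVal_C_mul_X hQ hs0', sub_pos]

end ValPiece

section Local

variable {A : Type u} [CommRing A] [IsDomain A] [IsLocalRing A] [IsNoetherianRing A]

open IsLocalRing (maximalIdeal)

variable [IsNoetherianRing (normalizedRees (maximalIdeal A))]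
  {Q : Ideal (normalizedRees (maximalIdeal A))}
  [Module.Finite (extendedRees (maximalIdeal A)) (normalizedRees (maximalIdeal A))]

/-- Some element `x` of the maximal ideal satisfies `w (x T) = 0`, because the contraction of `Q`
is not the irrelevant ideal. -/
theorem exists_exceptionalVal_eq_tInv (hcat : ∀ N : ℕ, IsCatenary (MvPolynomial (Fin N) A))
    (hm : maximalIdeal A ≠ ⊥) (hQ : Q ∈ exceptionalPrimes (maximalIdeal A)) :
    ∃ x ∈ maximalIdeal A, x ≠ 0 ∧ exceptionalVal Q (RatFunc.C (algebraMap A (FractionRing A) x)) =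
      exceptionalVal Q (tInv (maximalIdeal A) : RatFunc (FractionRing A)) := by
  obtain ⟨P, r, hP, hlt, hP0, hPr, hr⟩ := exists_chain_of_mem_exceptionalPrimes hcat hQ
  by_contra! hcon
  -- Otherwise `Q` contains all `x T`, the chain is constant, and `dim A = 0`.
  have hle : irrelevantIdeal Q ≤
      Q.comap (algebraMap (extendedRees (maximalIdeal A)) (normalizedRees (maximalIdeal A))) := by
    refine sup_le le_rfl (Ideal.span_le.2 ?_)
    rintro _ ⟨⟨a, ha⟩, rfl⟩
    have ha1 : a ∈ maximalIdeal A ^ 1 := by rwa [pow_one]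
    have h1 : a ∈ valPiece Q 1 := by
      by_cases ha0 : a = 0
      · rw [ha0]
        exact zero_mem _
      · rw [mem_valPiece_iff_lt hQ ha1 ha0]
        refine lt_of_le_of_ne (le_exceptionalVal_of_mem_pow hQ ha0 ha1) fun h => ?_
        refine hcon a ha ha0 ?_
        rw [← h, Nat.cast_one, one_mul]
    have h2 := (mem_valPiece.1 h1).2
    have h3 : mulT ⟨a, ha⟩ = monomialMap (maximalIdeal A) 1 ⟨a, ha1⟩ := by
      apply Subtype.ext
      exact congrArg (RatFunc.C (algebraMap A (FractionRing A) a) * ·) (pow_one RatFunc.X).symm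
    rw [h3]
    exact h2
  have h0 : r = 0 := by
    by_contra h0
    have hmono : ∀ i, i + 1 ≤ r → P 0 < P (i + 1) := by
      intro i
      induction i with
      | zero => exact fun hi => hlt 0 hi
      | succ i ih => exact fun hi => (ih (by omega)).trans (hlt (i + 1) hi)
    have := hmono (r - 1) (by omega)
    rw [Nat.sub_add_cancel (by omega), hP0, hPr] at this
    exact this.not_ge hle
  rw [h0, Nat.cast_zero, nonpos_iff_eq_zero, Ideal.height_eq_zero_iff_eq_bot] at hr
  exact hm hr

/-- The Hilbert polynomial of an exceptional prime is nonzero of degree at least `dim A - 1`. -/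
theorem exists_hasPoly_valHilbert_of_mem_exceptionalPrimes
    (hcat : ∀ N : ℕ, IsCatenary (MvPolynomial (Fin N) A))
    (hm : maximalIdeal A ≠ ⊥) (hQ : Q ∈ exceptionalPrimes (maximalIdeal A)) :
    ∃ p, HasPoly (valHilbert Q) p ∧ p ≠ 0 ∧ (maximalIdeal A).height ≤ p.natDegree + 1 := by
  have hτ := tInv_mem_of_mem_exceptionalPrimes hQ
  have hlen := length_quotient_ne_top_of_isMaximal (IsLocalRing.maximalIdeal.isMaximal A)
  obtain ⟨p, hp⟩ := exists_hasPoly_valHilbert hτ hlen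
  refine ⟨p, hp, ?_, ?_⟩
  · rintro rfl
    -- the powers of some `x T` avoid `Q`, so that no value of the Hilbert function vanishes
    obtain ⟨x, hx, hx0, hxw⟩ := exists_exceptionalVal_eq_tInv hcat hm hQ
    obtain ⟨n, m, hn, hmn⟩ := hp.exists
    rw [Polynomial.eval_zero, Nat.cast_eq_zero] at hmn
    rw [hmn, Nat.cast_zero, valHilbert, relLen, Module.length_eq_zero_iff,
      Submodule.Quotient.subsingleton_iff, Submodule.submoduleOf_eq_top] at hn
    have h1 : x ^ n ∈ maximalIdeal A ^ n := Ideal.pow_mem_pow hx n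
    have h2 := (mem_valPiece_iff_lt hQ h1 (pow_ne_zero n hx0)).1 (hn h1)
    rw [map_pow, map_pow, (isDiscreteAt_exceptionalVal hQ).map_pow
      (C_ne_zero (by rwa [Ne, map_eq_zero_iff _ (IsFractionRing.injective A _)])), hxw] at h2
    exact lt_irrefl _ h2
  · obtain ⟨P, r, hP, hlt, hP0, hPr, hr⟩ := exists_chain_of_mem_exceptionalPrimes hcat hQ
    have hmax := irrelevantIdeal_isMaximal hQ
    have hlen' := length_quotient_ne_top_of_isMaximal hmax
    obtain ⟨p1, hp1⟩ := exists_hasPoly_length_sup hlen'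
      (Q.comap (algebraMap (extendedRees (maximalIdeal A)) (normalizedRees (maximalIdeal A))))
    -- The sum of the Hilbert function bounds the Hilbert–Samuel function of the irrelevant ideal
    -- modulo `Q`, whose degree is at least the length of the chain.
    have h1 := length_le_natDegree_of_chain hmax.ne_top hlen' r P _ hP hlt hP0.ge hPr.le p1 hp1
    have hsum : ∀ n, ∑ i ∈ Finset.range n, valHilbert Q i ≠ ⊤ := fun n =>
      WithTop.sum_ne_top.2 fun i _ => valHilbert_ne_top hτ hlen i
    have hstep : ∀ n, ∑ i ∈ Finset.range (n + 1), valHilbert Q i =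
        valHilbert Q n + ∑ i ∈ Finset.range n, valHilbert Q i := fun n => by
      rw [Finset.sum_range_succ, add_comm]
    obtain ⟨p2, hp2⟩ := HasPoly.of_diff (k := fun _ => 0) (pk := 0) hsum hp
      (Eventually.of_forall fun n => ⟨0, by simp, by simp⟩) (fun n => by
        rw [add_zero]; exact hstep n)
    have h2 := hp1.natDegree_mono hp2 (Eventually.of_forall fun n =>
      length_quotient_irrelevantIdeal_le hτ n)
    have h3 := hp2.natDegree_le_of_diff hp hstep
    refine hr.trans ?_
    exact_mod_cast (h1.trans h2).trans h3

end Local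

/-! ### The multiplicity of a hypersurface -/

section Multiplicity

open IsLocalRing (maximalIdeal)

open Polynomial

theorem length_quotient_maximalIdeal_pow_ne_top (A : Type*) [CommRing A] [IsLocalRing A]
    [IsNoetherianRing A] (n : ℕ) : Module.length A (A ⧸ maximalIdeal A ^ n) ≠ ⊤ :=
  length_quotient_pow_ne_top
    (length_quotient_ne_top_of_isMaximal (IsLocalRing.maximalIdeal.isMaximal A)) n

/-- The Hilbert–Samuel polynomial of a local ring is controlled by the colength of an ideal
generated by parameters. -/
theorem exists_hasPoly_length_pow {A : Type*} [CommRing A] [IsLocalRing A] [IsNoetherianRing A]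
    {d k₀ : ℕ} (S : Finset A) (hS : S.card ≤ d) (hSm : Ideal.span (S : Set A) ≤ maximalIdeal A)
    (hk : Module.length A (A ⧸ Ideal.span (S : Set A)) ≤ k₀) :
    ∃ p : ℚ[X], HasPoly (fun n => Module.length A (A ⧸ maximalIdeal A ^ n)) p ∧ p.natDegree ≤ d ∧
      p.coeff d ≤ k₀ / d.factorial := by
  obtain ⟨p, hp⟩ := exists_hasPoly_length_sup (length_quotient_ne_top_of_isMaximal
    (IsLocalRing.maximalIdeal.isMaximal A)) ⊥
  replace hp := hp.congr (g := fun n => Module.length A (A ⧸ maximalIdeal A ^ n))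
    (Eventually.of_forall fun n => by rw [bot_sup_eq])
  obtain ⟨q, hq, hqd, hqc⟩ := hasPoly_multichoose S.card k₀
  have hle : ∀ᶠ n in atTop, Module.length A (A ⧸ maximalIdeal A ^ n) ≤
      ((Nat.multichoose (S.card + 1) (n - 1) * k₀ : ℕ) : ℕ∞) := by
    filter_upwards [eventually_ge_atTop 1] with n hn
    obtain ⟨n, rfl⟩ : ∃ k, n = k + 1 := ⟨n - 1, by omega⟩
    have h1 := length_quotient_pow_succ_le S rfl n
    have h2 : Module.length A (A ⧸ maximalIdeal A ^ (n + 1)) ≤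
        Module.length A (A ⧸ Ideal.span (S : Set A) ^ (n + 1)) := by
      rw [← relLen_top, ← relLen_top]
      exact relLen_anti _ (Ideal.pow_right_mono hSm _)
    refine h2.trans (h1.trans ?_)
    rw [Nat.add_sub_cancel, Nat.cast_mul]
    gcongr
  obtain ⟨h1, h2⟩ := coeff_comp_X_sub_C hqd ((1 : ℕ) : ℚ)
  have h3 := hq.shift_sub 1
  have h4 : p.natDegree ≤ S.card := (hp.natDegree_mono h3 hle).trans h1
  refine ⟨p, hp, h4.trans hS, ?_⟩
  rcases hS.lt_or_eq with h | h
  · rw [coeff_eq_zero_of_natDegree_lt (h4.trans_lt h)]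
    positivity
  · have := hp.coeff_le h3 hle h4 h1
    rwa [h2, hqc, h] at this

/-- Multiplication by `f` gives an exact sequence whose kernel term is `A / (J : f)`. -/
theorem length_quotient_sup_span_singleton {A : Type*} [CommRing A] (J : Ideal A) (f : A) :
    Module.length A (A ⧸ Submodule.comap (LinearMap.mulLeft A f) J) +
      Module.length A (A ⧸ (Ideal.span {f} ⊔ J)) = Module.length A (A ⧸ J) := by
  have h1 := relLen_sup_map (LinearMap.mulLeft A f) ⊤ J
  have h2 : Submodule.map (LinearMap.mulLeft A f) ⊤ = Ideal.span {f} := by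
    rw [Submodule.map_top]
    ext x
    rw [Ideal.mem_span_singleton']
    exact ⟨fun ⟨y, hy⟩ => ⟨y, by rw [← hy, LinearMap.mulLeft_apply, mul_comm]⟩,
      fun ⟨y, hy⟩ => ⟨y, by rw [← hy, LinearMap.mulLeft_apply, mul_comm]⟩⟩
  rw [top_inf_eq, relLen_top, h2] at h1
  have h3 := relLen_add (le_sup_left : J ≤ J ⊔ Ideal.span {f}) le_top
  rw [relLen_top, relLen_top] at h3
  rw [← h3, ← h1, sup_comm]

variable {A : Type u} [CommRing A] [IsLocalRing A] [IsNoetherianRing A]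

/-- If the multiplication by `f` lowers the order by at most `D`, then `length (A / (f, mⁿ))` is at
most the difference of the Hilbert–Samuel function at `n` and `n - D`. -/
theorem natDegree_le_and_coeff_le_of_colon_le {d D : ℕ} {f : A} {p pf : ℚ[X]}
    (hp : HasPoly (fun n => Module.length A (A ⧸ maximalIdeal A ^ n)) p) (hd : p.natDegree ≤ d + 1)
    (hpf : HasPoly (fun n => Module.length A (A ⧸ (Ideal.span {f} ⊔ maximalIdeal A ^ n))) pf)
    (hD : ∀ k y, f * y ∈ maximalIdeal A ^ k → y ∈ maximalIdeal A ^ (k - D)) :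
    pf.natDegree ≤ d ∧ pf.coeff d ≤ (d + 1) * D * p.coeff (d + 1) := by
  have hfin := length_quotient_maximalIdeal_pow_ne_top A
  have hmono : ∀ n, Module.length A (A ⧸ maximalIdeal A ^ (n - D)) ≤
      Module.length A (A ⧸ maximalIdeal A ^ n) := by
    intro n
    rw [← relLen_top, ← relLen_top]
    exact relLen_anti _ (Ideal.pow_le_pow_right (Nat.sub_le _ _))
  have h1 : HasPoly (fun n => Module.length A (A ⧸ maximalIdeal A ^ n) -
      Module.length A (A ⧸ maximalIdeal A ^ (n - D))) (p - p.comp (X - C (D : ℚ))) :=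
    hp.sub (hp.shift_sub D) (Eventually.of_forall fun n => tsub_add_cancel_of_le (hmono n))
  have hle : ∀ᶠ n in atTop, Module.length A (A ⧸ (Ideal.span {f} ⊔ maximalIdeal A ^ n)) ≤
      Module.length A (A ⧸ maximalIdeal A ^ n) -
      Module.length A (A ⧸ maximalIdeal A ^ (n - D)) := by
    refine Eventually.of_forall fun n => ?_
    refine ENat.le_sub_of_add_le_right (hfin _) ?_
    rw [← length_quotient_sup_span_singleton (maximalIdeal A ^ n) f, add_comm]
    gcongr
    rw [← relLen_top, ← relLen_top]
    exact relLen_anti _ fun y hy => hD n y hy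
  obtain ⟨h2, h3⟩ := natDegree_comp_X_add_C_sub_lt hd (D : ℚ)
  have h4 := (hpf.natDegree_mono h1 hle).trans h2
  exact ⟨h4, (hpf.coeff_le h1 hle h4 h2).trans h3.le⟩

variable [IsDomain A]

/-- The multiplicity of a hypersurface is given by the coefficient of degree `dim A - 1` of its
Hilbert–Samuel polynomial, and it is bounded by `D * k₀` if multiplication by `f` lowers the order
by at most `D`. -/
theorem exists_hasPoly_hilbertSamuelMultiplicity {d k₀ : ℕ} (hdim : ringKrullDim A = (d + 1 : ℕ))
    (S : Finset A) (hS : S.card ≤ d + 1) (hSm : Ideal.span (S : Set A) ≤ maximalIdeal A)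
    (hk : Module.length A (A ⧸ Ideal.span (S : Set A)) ≤ k₀) {f : A} (hf : f ∈ maximalIdeal A)
    (hf0 : f ≠ 0) :
    ∃ pf : ℚ[X], HasPoly (fun n => Module.length A (A ⧸ (Ideal.span {f} ⊔ maximalIdeal A ^ n))) pf ∧
      pf.natDegree ≤ d ∧
      hilbertSamuelMultiplicity A (maximalIdeal A) (A ⧸ Ideal.span {f}) =
        d.factorial * pf.coeff d ∧
      ∀ D : ℕ, (∀ k y, f * y ∈ maximalIdeal A ^ k → y ∈ maximalIdeal A ^ (k - D)) →
        hilbertSamuelMultiplicity A (maximalIdeal A) (A ⧸ Ideal.span {f}) ≤ D * k₀ := by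
  obtain ⟨p, hp, hpd, hpc⟩ := exists_hasPoly_length_pow S hS hSm hk
  obtain ⟨pf, hpf⟩ := exists_hasPoly_length_sup (length_quotient_ne_top_of_isMaximal
    (IsLocalRing.maximalIdeal.isMaximal A)) (Ideal.span {f})
  -- The degree bound needs only some linear control of the colon ideals, given by Artin–Rees.
  obtain ⟨c, hc⟩ := exists_colon_le_pow_sub (maximalIdeal A) (P := ⊥) (x := f) hf0
  simp only [bot_sup_eq] at hc
  have hdeg := (natDegree_le_and_coeff_le_of_colon_le hp hpd hpf hc).1
  have hdim' : Module.supportDim A (A ⧸ Ideal.span {f}) = (d : ℕ) := by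
    rw [Module.supportDim_quotient_eq_ringKrullDim]
    have h1 := ringKrullDim_quotient_span_singleton_succ_eq_ringKrullDim_of_mem_nonZeroDivisors
      (mem_nonZeroDivisors_of_ne_zero hf0) hf
    rw [hdim, Nat.cast_add, Nat.cast_one] at h1
    exact ENat.WithBot.add_one_cancel.1 h1
  have hmul : hilbertSamuelMultiplicity A (maximalIdeal A) (A ⧸ Ideal.span {f}) =
        d.factorial * pf.coeff d := by
    rw [hilbertSamuelMultiplicity, hdim']
    refine Tendsto.limUnder_eq ?_
    have h1 := (hpf.tendsto hdeg).const_mul (d.factorial : ℝ)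
    refine h1.congr fun n => ?_
    rw [length_quotient_quotient_pow_smul, mul_div_assoc]
    rfl
  refine ⟨pf, hpf, hdeg, hmul, fun D hD => ?_⟩
  have h1 := (natDegree_le_and_coeff_le_of_colon_le hp hpd hpf hD).2
  have h2 : (d.factorial : ℚ) * pf.coeff d ≤ D * k₀ := by
    calc (d.factorial : ℚ) * pf.coeff d
        ≤ d.factorial * ((d + 1) * D * (k₀ / (d + 1).factorial)) := by
          gcongr
          exact h1.trans (by gcongr)
      _ = D * k₀ := by
          rw [Nat.factorial_succ]
          have : (d.factorial : ℚ) ≠ 0 := by exact_mod_cast d.factorial_ne_zero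
          push_cast
          field_simp
  rw [hmul]
  exact_mod_cast h2

end Multiplicity

/-! ### Valuation ideals and the lower bound for the multiplicity -/

section RelLenMap

variable {B : Type*} [CommRing B] {M M' : Type*} [AddCommGroup M] [Module B M] [AddCommGroup M']
  [Module B M']

theorem relLen_le_of_map {N P : Submodule B M} {N' P' : Submodule B M'} (f : M →ₗ[B] M')
    (hP : P.map f ≤ P') (hN : P ⊓ N'.comap f ≤ N) : relLen N P ≤ relLen N' P' := by
  refine (relLen_anti P hN).trans ?_
  rw [← relLen_sup_map, relLen_sup_right]
  exact relLen_mono _ hP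

theorem relLen_map_le {N P : Submodule B M} (h : N ≤ P) (f : M →ₗ[B] M') :
    relLen (N.map f) (P.map f) ≤ relLen N P := by
  rw [← relLen_sup_right, relLen_sup_map]
  exact relLen_anti _ (le_inf h (Submodule.le_comap_map f N))

theorem relLen_comap_mulLeft_eq {A : Type*} [CommRing A] {J : Ideal A}
    (hJ : Module.length A (A ⧸ J) ≠ ⊤) (f : A) :
    relLen J (Submodule.comap (LinearMap.mulLeft A f) J) =
      Module.length A (A ⧸ (Ideal.span {f} ⊔ J)) := by
  have h1 := length_quotient_sup_span_singleton J f
  have hle : J ≤ Submodule.comap (LinearMap.mulLeft A f) J := fun x hx => J.mul_mem_left f hx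
  have h2 := relLen_add hle le_top
  rw [relLen_top, relLen_top, ← h1, add_comm (Module.length A (A ⧸ Submodule.comap _ _)) _] at h2
  refine ENat.add_left_injective_of_ne_top ?_ h2
  rw [← h1] at hJ
  exact fun h => hJ (by rw [h, top_add])

end RelLenMap

section ValuationIdeal

variable {A : Type u} [CommRing A] [IsDomain A] [IsNoetherianRing A] {I : Ideal A}
  [IsNoetherianRing (normalizedRees I)]

local notation "K" => FractionRing A

theorem algebraMap_fractionRing_ne_zero {A : Type*} [CommRing A] {x : A} (hx : x ≠ 0) :
    algebraMap A (FractionRing A) x ≠ 0 := by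
  rwa [Ne, map_eq_zero_iff _ (IsFractionRing.injective A (FractionRing A))]

omit [IsNoetherianRing A] in
theorem exceptionalVal_C_mul {Q : Ideal (normalizedRees I)} (hQ : Q ∈ exceptionalPrimes I) {x y : K}
    (hx : x ≠ 0) (hy : y ≠ 0) : exceptionalVal Q (RatFunc.C (x * y)) =
      exceptionalVal Q (RatFunc.C x) + exceptionalVal Q (RatFunc.C y) := by
  rw [map_mul, (isDiscreteAt_exceptionalVal hQ).map_mul _ _ (C_ne_zero hx) (C_ne_zero hy)]

omit [IsNoetherianRing A] in
theorem exceptionalVal_algebraMap_nonneg {Q : Ideal (normalizedRees I)}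
    (hQ : Q ∈ exceptionalPrimes I) {x : A} (hx : x ≠ 0) :
    0 ≤ exceptionalVal Q (RatFunc.C (algebraMap A K x)) :=
  exceptionalVal_nonneg hQ (extendedRees_le_normalizedRees (C_mem_extendedRees x))
    (C_ne_zero (algebraMap_fractionRing_ne_zero hx))

/-- The ideal of all elements whose value at each exceptional prime `Q` is at least `t Q`. -/
noncomputable def valuationIdeal (I : Ideal A) [IsNoetherianRing (normalizedRees I)]
    (t : Ideal (normalizedRees I) → ℤ) : Ideal A where
  carrier := {x | x ≠ 0 → ∀ Q ∈ exceptionalPrimes I,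
    t Q ≤ exceptionalVal Q (RatFunc.C (algebraMap A K x))}
  zero_mem' := fun h => absurd rfl h
  add_mem' := by
    intro x y hx hy hxy Q hQ
    by_cases hx0 : x = 0
    · subst hx0
      rw [zero_add] at hxy ⊢
      exact hy hxy Q hQ
    by_cases hy0 : y = 0
    · subst hy0
      rw [add_zero] at hxy ⊢
      exact hx hxy Q hQ
    have h1 := (isDiscreteAt_exceptionalVal hQ).min_le_map_add
      (RatFunc.C (algebraMap A K x)) (RatFunc.C (algebraMap A K y))
      (C_ne_zero (algebraMap_fractionRing_ne_zero hx0))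
      (C_ne_zero (algebraMap_fractionRing_ne_zero hy0)) (by
        rw [← map_add, ← map_add]
        exact C_ne_zero (algebraMap_fractionRing_ne_zero hxy))
    rw [map_add, map_add]
    exact (le_min (hx hx0 Q hQ) (hy hy0 Q hQ)).trans h1
  smul_mem' := by
    intro r x hx hrx Q hQ
    rw [smul_eq_mul] at hrx ⊢
    have hr0 := left_ne_zero_of_mul hrx
    have hx0 := right_ne_zero_of_mul hrx
    rw [map_mul, exceptionalVal_C_mul hQ (algebraMap_fractionRing_ne_zero hr0)
      (algebraMap_fractionRing_ne_zero hx0)]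
    linarith [hx hx0 Q hQ, exceptionalVal_algebraMap_nonneg hQ hr0]

omit [IsNoetherianRing A] in
theorem valuationIdeal_anti {s t : Ideal (normalizedRees I) → ℤ}
    (h : ∀ Q ∈ exceptionalPrimes I, s Q ≤ t Q) : valuationIdeal I t ≤ valuationIdeal I s :=
  fun _ hx hx0 Q hQ => (h Q hQ).trans (hx hx0 Q hQ)

omit [IsNoetherianRing A] in
theorem pow_le_valuationIdeal (I : Ideal A) [IsNoetherianRing (normalizedRees I)] (k : ℕ) :
    I ^ k ≤ valuationIdeal I fun Q => k * exceptionalVal Q (tInv I : RatFunc K) :=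
  fun _ hx hx0 _ hQ => le_exceptionalVal_of_mem_pow hQ hx0 hx

omit [IsNoetherianRing A] in
/-- The length of a step between two valuation ideals that differ by one in their bound at `Q`: if
`a T ^ j` has value one less than `T⁻¹` at `Q`, and `c` is a conductor, then multiplication with
`c a ^ h` embeds a graded piece of the extended Rees algebra modulo `Q` into the step. -/
theorem valHilbert_le_relLen_valuationIdeal {c : A} (hc0 : c ≠ 0)
    (hc : ∀ x : K, IsIntegral A x → ∃ b, algebraMap A K c * x = algebraMap A K b)
    {Q : Ideal (normalizedRees I)} (hQ : Q ∈ exceptionalPrimes I) {a : K} {j : ℤ}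
    (haS : RatFunc.C a * RatFunc.X ^ j ∈ normalizedRees I) (ha0 : a ≠ 0)
    (haQ : exceptionalVal Q (RatFunc.C a * RatFunc.X ^ j) =
      exceptionalVal Q (tInv I : RatFunc K) - 1)
    (haQ' : ∀ Q' ∈ exceptionalPrimes I, Q' ≠ Q → exceptionalVal Q' (tInv I : RatFunc K) ≤
      exceptionalVal Q' (RatFunc.C a * RatFunc.X ^ j))
    {k k' h i : ℕ} (hh : (h : ℤ) = i + 1 + exceptionalVal Q (RatFunc.C (algebraMap A K c)))
    (hk : (k' : ℤ) = k - h * (j + 1)) {s t : Ideal (normalizedRees I) → ℤ}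
    (hs : k * exceptionalVal Q (tInv I : RatFunc K) - i ≤ s Q)
    (ht : t Q ≤ k * exceptionalVal Q (tInv I : RatFunc K) - (i + 1))
    (ht' : ∀ Q' ∈ exceptionalPrimes I, Q' ≠ Q → t Q' ≤ k * exceptionalVal Q' (tInv I : RatFunc K))
    (hst : valuationIdeal I s ≤ valuationIdeal I t) :
    valHilbert Q k' ≤ relLen (valuationIdeal I s) (valuationIdeal I t) := by
  let ι : A →ₗ[A] K := Algebra.linearMap A K
  refine le_trans ?_ (relLen_map_le hst ι)
  have hcK := algebraMap_fractionRing_ne_zero hc0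
  have hval : ∀ Q' ∈ exceptionalPrimes I, ∀ x : A, x ≠ 0 →
      exceptionalVal Q' (RatFunc.C (algebraMap A K c * (a ^ h * algebraMap A K x))) =
      exceptionalVal Q' (RatFunc.C (algebraMap A K c)) + (h * exceptionalVal Q' (RatFunc.C a) +
        exceptionalVal Q' (RatFunc.C (algebraMap A K x))) := by
    intro Q' hQ' x hx
    have hxK := algebraMap_fractionRing_ne_zero hx
    rw [exceptionalVal_C_mul hQ' hcK (mul_ne_zero (pow_ne_zero _ ha0) hxK),
      exceptionalVal_C_mul hQ' (pow_ne_zero _ ha0) hxK, map_pow,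
      (isDiscreteAt_exceptionalVal hQ').map_pow (C_ne_zero ha0)]
  rw [exceptionalVal_C_mul_X hQ ha0] at haQ
  -- Inside `K`, the map `s ↦ c a ^ h s` on `I ^ k'` takes values in the larger valuation ideal, and
  -- only elements of `valPiece Q k'` are mapped into the smaller one.
  refine relLen_le_of_map ((LinearMap.mulLeft A (algebraMap A K c * a ^ h)).comp ι) ?_ ?_
  · rintro _ ⟨x, hx, rfl⟩
    have hint : IsIntegral A (a ^ h * algebraMap A K x) := by
      refine isIntegral_of_mem_normalizedRees (I := I) (n := h * j + k') ?_
      have h1 := mul_mem (pow_mem haS h)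
        (extendedRees_le_normalizedRees (C_mul_X_pow_mem_extendedRees k' hx))
      convert h1 using 1
      rw [map_mul, map_pow, mul_pow, ← zpow_natCast (RatFunc.X ^ j), ← zpow_mul,
        zpow_add₀ RatFunc.X_ne_zero, zpow_natCast, mul_comm (h : ℤ)]
      ring
    obtain ⟨b, hb⟩ := hc _ hint
    refine ⟨b, ?_, ?_⟩
    · intro hb0 Q' hQ'
      have hx0 : x ≠ 0 := by
        rintro rfl
        rw [map_zero, mul_zero, mul_zero] at hb
        exact hb0 ((map_eq_zero_iff _ (IsFractionRing.injective A K)).1 hb.symm)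
      have hxv := le_exceptionalVal_of_mem_pow hQ' hx0 hx
      rw [← hb, hval Q' hQ' x hx0]
      by_cases hQQ : Q' = Q
      · subst hQQ
        refine ht.trans ?_
        have e : exceptionalVal Q' (RatFunc.C a) =
          (j + 1) * exceptionalVal Q' (tInv I : RatFunc K) - 1 := by linear_combination haQ
        rw [e]
        rw [hk] at hxv
        linear_combination hxv + hh
      · have h1 := haQ' Q' hQ' hQQ
        rw [exceptionalVal_C_mul_X hQ' ha0] at h1
        refine (ht' Q' hQ' hQQ).trans ?_
        have h2 := exceptionalVal_algebraMap_nonneg hQ' hc0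
        rw [hk] at hxv
        have h3 := mul_le_mul_of_nonneg_left h1 (Nat.cast_nonneg (α := ℤ) h)
        linear_combination hxv + h2 + h3
    · change algebraMap A K b = (algebraMap A K c * a ^ h) * algebraMap A K x
      rw [← hb, mul_assoc]
  · rintro x ⟨hx, b, hb, hbx⟩
    by_cases hx0 : x = 0
    · rw [hx0]
      exact zero_mem _
    rw [mem_valPiece_iff_lt hQ hx hx0, hk]
    change algebraMap A K b = (algebraMap A K c * a ^ h) * algebraMap A K x at hbx
    rw [mul_assoc] at hbx
    have hb0 : b ≠ 0 := by
      rintro rfl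
      rw [map_zero] at hbx
      exact mul_ne_zero hcK (mul_ne_zero (pow_ne_zero _ ha0)
        (algebraMap_fractionRing_ne_zero hx0)) hbx.symm
    have h1 := hs.trans (hb hb0 Q hQ)
    rw [hbx, hval Q hQ x hx0] at h1
    have e : exceptionalVal Q (RatFunc.C a) =
      (j + 1) * exceptionalVal Q (tInv I : RatFunc K) - 1 := by linear_combination haQ
    rw [e] at h1
    refine Int.lt_of_add_one_le ?_
    linear_combination h1 - hh

/-- The multiplication by `f` passes through `w_Q f` steps between valuation ideals. -/
theorem sum_valHilbert_le (hI : Module.length A (A ⧸ I) ≠ ⊤) {c : A} (hc0 : c ≠ 0)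
    (hc : ∀ x : K, IsIntegral A x → ∃ b, algebraMap A K c * x = algebraMap A K b)
    {Q : Ideal (normalizedRees I)} (hQ : Q ∈ exceptionalPrimes I) {f : A} (hf : f ≠ 0) {W : ℕ}
    (hW : exceptionalVal Q (RatFunc.C (algebraMap A K f)) = W) :
    ∃ z : ℕ → ℤ, ∀ᶠ k : ℕ in atTop, ∑ i ∈ Finset.range W, valHilbert Q (k - z i).toNat ≤
      Module.length A (A ⧸ (Ideal.span {f} ⊔ I ^ k)) := by
  classical
  obtain ⟨a, j, haS, ha0, haQ, haQ'⟩ := exists_homogeneous_colon hQ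
  obtain ⟨g, hg⟩ := Int.eq_ofNat_of_zero_le (exceptionalVal_algebraMap_nonneg hQ hc0)
  -- the shift at the step `i`: the power of `a T ^ j` needed is `i + 1` plus the value of the
  -- conductor
  let z : ℕ → ℤ := fun i => (i + 1 + g : ℕ) * (j + 1)
  refine ⟨z, ?_⟩
  have hev : ∀ᶠ k : ℕ in atTop, ∀ i ∈ Finset.range W, z i ≤ k := by
    rw [Filter.eventually_all_finset]
    intro i _
    filter_upwards [eventually_ge_atTop (z i).toNat] with k hk
    omega
  filter_upwards [hev] with k hk
  let J : Ideal A := valuationIdeal I fun Q' => k * exceptionalVal Q' (tInv I : RatFunc K)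
  -- At `Q` the bound is lowered to `k w(T⁻¹) - i`; at the other exceptional primes it is lowered by
  -- the value of `f` right away. All elements of the last ideal are multiplied by `f` into `J`.
  let t : ℕ → Ideal (normalizedRees I) → ℤ := fun i Q' =>
    if Q' = Q then k * exceptionalVal Q' (tInv I : RatFunc K) - i else
      k * exceptionalVal Q' (tInv I : RatFunc K) -
        exceptionalVal Q' (RatFunc.C (algebraMap A K f))
  have hmono : ∀ i, valuationIdeal I (t i) ≤ valuationIdeal I (t (i + 1)) := by
    intro i
    refine valuationIdeal_anti fun Q' _ => ?_
    by_cases hQ' : Q' = Q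
    · simp only [t, if_pos hQ', Nat.cast_add, Nat.cast_one]
      linarith
    · simp [t, hQ']
  have hstep : ∀ i ∈ Finset.range W, valHilbert Q (k - z i).toNat ≤
      relLen (valuationIdeal I (t i)) (valuationIdeal I (t (i + 1))) := by
    intro i hi
    refine valHilbert_le_relLen_valuationIdeal hc0 hc hQ haS ha0 haQ haQ' (k := k)
      (h := i + 1 + g) (i := i) (by rw [hg]; push_cast; ring) ?_ ?_ ?_ ?_ (hmono i)
    · rw [Int.toNat_of_nonneg (sub_nonneg.2 (hk i hi))]
    · simp [t]
    · simp [t]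
    · intro Q' hQ' hne
      simp only [t, if_neg hne]
      linarith [exceptionalVal_algebraMap_nonneg hQ' hf]
  have hsum : ∀ n, valuationIdeal I (t 0) ≤ valuationIdeal I (t n) ∧
      ∑ i ∈ Finset.range n, relLen (valuationIdeal I (t i)) (valuationIdeal I (t (i + 1))) =
      relLen (valuationIdeal I (t 0)) (valuationIdeal I (t n)) := by
    intro n
    induction n with
    | zero => exact ⟨le_rfl, by simp [relLen_eq_zero]⟩
    | succ n ih =>
      refine ⟨ih.1.trans (hmono n), ?_⟩
      rw [Finset.sum_range_succ, ih.2, relLen_add ih.1 (hmono n)]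
  refine (Finset.sum_le_sum hstep).trans ?_
  rw [(hsum W).2]
  have hpow : I ^ k ≤ J := pow_le_valuationIdeal I k
  have hJ : Module.length A (A ⧸ J) ≠ ⊤ := by
    refine ne_top_of_le_ne_top (length_quotient_pow_ne_top hI k) ?_
    rw [← relLen_top, ← relLen_top]
    exact relLen_anti _ hpow
  have h0 : J ≤ valuationIdeal I (t 0) := by
    refine valuationIdeal_anti fun Q' hQ' => ?_
    by_cases h : Q' = Q
    · simp [t, h]
    · simp only [t, if_neg h]
      linarith [exceptionalVal_algebraMap_nonneg hQ' hf]
  have hWJ : valuationIdeal I (t W) ≤ Submodule.comap (LinearMap.mulLeft A f) J := by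
    intro x hx hfx Q' hQ'
    rw [LinearMap.mulLeft_apply] at hfx ⊢
    have hx0 := right_ne_zero_of_mul hfx
    rw [map_mul, exceptionalVal_C_mul hQ' (algebraMap_fractionRing_ne_zero hf)
      (algebraMap_fractionRing_ne_zero hx0)]
    have h1 := hx hx0 Q' hQ'
    by_cases h : Q' = Q
    · subst h
      simp only [t, if_pos rfl] at h1
      rw [hW]
      linarith
    · simp only [t, if_neg h] at h1
      linarith
  calc relLen (valuationIdeal I (t 0)) (valuationIdeal I (t W))
      ≤ relLen J (Submodule.comap (LinearMap.mulLeft A f) J) :=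
        (relLen_anti _ h0).trans (relLen_mono _ hWJ)
    _ = Module.length A (A ⧸ (Ideal.span {f} ⊔ J)) := relLen_comap_mulLeft_eq hJ f
    _ ≤ _ := by
        rw [← relLen_top, ← relLen_top]
        exact relLen_anti _ (sup_le_sup_left hpow _)

end ValuationIdeal

section LowerBound

open Polynomial

open IsLocalRing (maximalIdeal)

theorem HasPoly.shift_int {f : ℕ → ℕ∞} {p : ℚ[X]} (hf : HasPoly f p) (z : ℤ) :
    HasPoly (fun n => f ((n - z : ℤ)).toNat) (p.comp (X - C (z : ℚ))) := by
  rcases le_total 0 z with hz | hz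
  · obtain ⟨c, rfl⟩ := Int.eq_ofNat_of_zero_le hz
    have := hf.shift_sub c
    refine (this.congr (Eventually.of_forall fun n => ?_) : _)
    congr 1
    omega
  · obtain ⟨c, hc⟩ := Int.eq_ofNat_of_zero_le (neg_nonneg.2 hz)
    obtain rfl : z = -c := by rw [← hc, neg_neg]
    have h1 := hf.shift c
    have h2 : (X - C (((-c : ℤ)) : ℚ) : ℚ[X]) = X + C (c : ℚ) := by
      push_cast
      rw [C_neg, sub_neg_eq_add]
    rw [h2]
    refine h1.congr (Eventually.of_forall fun n => ?_)
    congr 1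
    omega

theorem HasPoly.sum {f : ℕ → ℕ → ℕ∞} {p : ℕ → ℚ[X]} (hf : ∀ i, HasPoly (f i) (p i)) (W : ℕ) :
    HasPoly (fun n => ∑ i ∈ Finset.range W, f i n) (∑ i ∈ Finset.range W, p i) := by
  induction W with
  | zero => exact Eventually.of_forall fun n => ⟨0, by simp, by simp⟩
  | succ W ih =>
    simp only [Finset.sum_range_succ]
    exact ih.add (hf W)

variable {A : Type u} [CommRing A] [IsDomain A] [IsLocalRing A] [IsNoetherianRing A]
  [IsNoetherianRing (normalizedRees (maximalIdeal A))]
  {Q : Ideal (normalizedRees (maximalIdeal A))}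
  [Module.Finite (extendedRees (maximalIdeal A)) (normalizedRees (maximalIdeal A))]

/-- The values of `f` at the exceptional primes are at most the multiplicity of `A / f`. -/
theorem exceptionalVal_le_factorial_mul_coeff (hcat : ∀ N : ℕ, IsCatenary (MvPolynomial (Fin N) A))
    {c : A} (hc0 : c ≠ 0)
    (hc : ∀ x : FractionRing A, IsIntegral A x →
      ∃ b, algebraMap A (FractionRing A) c * x = algebraMap A (FractionRing A) b)
    {d : ℕ} (hdim : ringKrullDim A = (d + 1 : ℕ)) (hQ : Q ∈ exceptionalPrimes (maximalIdeal A))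
    {f : A} (hf : f ∈ maximalIdeal A) (hf0 : f ≠ 0) {pf : ℚ[X]}
    (hpf : HasPoly (fun n => Module.length A (A ⧸ (Ideal.span {f} ⊔ maximalIdeal A ^ n))) pf)
    (hdeg : pf.natDegree ≤ d) :
    (exceptionalVal Q (RatFunc.C (algebraMap A (FractionRing A) f)) : ℚ) ≤
      d.factorial * pf.coeff d := by
  have hm : maximalIdeal A ≠ ⊥ := fun h => hf0 (by rw [h] at hf; exact hf)
  obtain ⟨p, hp, hp0, hpd⟩ := exists_hasPoly_valHilbert_of_mem_exceptionalPrimes hcat hm hQ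
  have hpd' : d ≤ p.natDegree := by
    have h1 := IsLocalRing.maximalIdeal_height_eq_ringKrullDim (R := A)
    rw [hdim] at h1
    have h2 : (maximalIdeal A).height = (d + 1 : ℕ) := by exact_mod_cast h1
    rw [h2] at hpd
    have h3 : d + 1 ≤ p.natDegree + 1 := by exact_mod_cast hpd
    omega
  obtain ⟨W, hW⟩ := Int.eq_ofNat_of_zero_le (exceptionalVal_algebraMap_nonneg hQ hf0)
  have hWpos : 0 < W := by
    have h1 := le_exceptionalVal_of_mem_pow (n := 1) hQ hf0 (by rwa [pow_one])
    have h2 := exceptionalVal_tInv_pos hQ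
    rw [hW] at h1
    rw [Nat.cast_one, one_mul] at h1
    exact_mod_cast h2.trans_le h1
  obtain ⟨z, hz⟩ := sum_valHilbert_le (length_quotient_ne_top_of_isMaximal
    (IsLocalRing.maximalIdeal.isMaximal A)) hc0 hc hQ hf0 hW
  -- the degree is at most `d`, since a single term of the sum is bounded by the Hilbert polynomial
  -- of `f`
  have hterm : p.natDegree ≤ d := by
    have h1 : ∀ᶠ k : ℕ in atTop, valHilbert Q (k - z 0 : ℤ).toNat ≤
        Module.length A (A ⧸ (Ideal.span {f} ⊔ maximalIdeal A ^ k)) := by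
      filter_upwards [hz] with k hk
      exact le_trans (Finset.single_le_sum (f := fun i => valHilbert Q (k - z i : ℤ).toNat)
        (fun _ _ => zero_le) (Finset.mem_range.2 hWpos)) hk
    have h2 := ((hp.shift_int (z 0)).natDegree_mono hpf h1).trans hdeg
    rwa [natDegree_comp, natDegree_X_sub_C, mul_one] at h2
  have hd : p.natDegree = d := le_antisymm hterm hpd'
  have hsum := HasPoly.sum (fun i => hp.shift_int (z i)) W
  have hdegs : (∑ i ∈ Finset.range W, p.comp (X - C (z i : ℚ))).natDegree ≤ d :=
    natDegree_sum_le_of_forall_le _ _ fun i _ => (coeff_comp_X_sub_C hterm _).1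
  -- Compare the coefficients of degree `d`; the shifts do not change them.
  have h1 := hsum.coeff_le hpf hz hdegs hdeg
  rw [finsetSum_coeff, Finset.sum_congr rfl fun i _ => (coeff_comp_X_sub_C hterm (z i : ℚ)).2,
    Finset.sum_const, Finset.card_range, nsmul_eq_mul] at h1
  have h2 := hp.one_le_factorial_mul_leadingCoeff hp0
  rw [leadingCoeff, hd] at h2
  rw [hW]
  calc ((W : ℤ) : ℚ) = W * 1 := by simp
    _ ≤ W * (d.factorial * p.coeff d) := by gcongr
    _ = d.factorial * (W * p.coeff d) := by ring
    _ ≤ d.factorial * pf.coeff d := by gcongr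

end LowerBound

/-! ### Comparison of the two criteria -/

section LocalComparison

open IsLocalRing (maximalIdeal)

variable {A : Type u} [CommRing A] [IsDomain A] [IsLocalRing A] [IsNoetherianRing A]
  [IsNoetherianRing (normalizedRees (maximalIdeal A))]

local notation "K" => FractionRing A

theorem reesValuation_eq_zero_of_isUnit {ν : AddValuation K (WithTop ℤ)}
    (hν : IsReesValuation (maximalIdeal A) ν) {a : A} (ha : IsUnit a) :
    ν (algebraMap A K a) = 0 := by
  obtain ⟨h1, Q, hQ, hν⟩ := hν
  obtain ⟨e, he, h⟩ := exceptionalVal_eq_mul hQ h1 hν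
  obtain ⟨b, hab⟩ := ha.exists_right_inv
  have ha0 := ha.ne_zero
  have hb0 : b ≠ 0 := right_ne_zero_of_mul (hab ▸ one_ne_zero)
  obtain ⟨n, hn, hen⟩ := h _ (algebraMap_fractionRing_ne_zero ha0)
  have h2 := exceptionalVal_C_mul hQ (algebraMap_fractionRing_ne_zero ha0)
    (algebraMap_fractionRing_ne_zero hb0)
  rw [← map_mul, hab, map_one, map_one, (isDiscreteAt_exceptionalVal hQ).map_one] at h2
  have h3 := exceptionalVal_algebraMap_nonneg hQ ha0
  have h4 := exceptionalVal_algebraMap_nonneg hQ hb0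
  have h5 : e * n = 0 := by linarith
  rw [hn, (mul_eq_zero.1 h5).resolve_left he.ne']
  rfl

variable [Module.Finite (extendedRees (maximalIdeal A)) (normalizedRees (maximalIdeal A))]

/-- If the Rees valuations of the maximal ideal are comparable with constant `E`, then
multiplication by an element of order `n` lowers the order by at most a linear function of `n`: by
the Briançon–Skoda property, some Rees valuation of `f` is small, hence all of them are. -/
theorem mem_pow_sub_of_mul_mem_pow (hcat : ∀ N : ℕ, IsCatenary (MvPolynomial (Fin N) A)) {B : ℕ}
    (hB : ∀ (J : Ideal A) (n : ℕ), idealIntegralClosure (J ^ (n + B)) ⊆ (J ^ n : Ideal A))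
    (hm : maximalIdeal A ≠ ⊥) {E : ℕ}
    (hE : ∀ ν₁ ν₂ : AddValuation K (WithTop ℤ), IsReesValuation (maximalIdeal A) ν₁ →
      IsReesValuation (maximalIdeal A) ν₂ → ∀ f : A, f ≠ 0 →
        ν₁ (algebraMap A K f) ≤ E • ν₂ (algebraMap A K f))
    {f : A} (hf0 : f ≠ 0) {n : ℕ} (hfn : f ∉ maximalIdeal A ^ (n + 1)) (k : ℕ) (y : A)
    (hy : f * y ∈ maximalIdeal A ^ k) :
    y ∈ maximalIdeal A ^ (k - (E * E * (n + 1 + B) + B)) := by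
  have key : ∀ Q ∈ exceptionalPrimes (maximalIdeal A),
      exceptionalVal Q (RatFunc.C (algebraMap A K f)) ≤
      (E * E * (n + 1 + B) : ℕ) * exceptionalVal Q (tInv (maximalIdeal A) : RatFunc K) := by
    -- Otherwise `f T ^ (n + 1 + B)` lies in the normalized algebra, and `f` in `m ^ (n + 1)`.
    obtain ⟨Q₀, hQ₀, h₀⟩ : ∃ Q₀ ∈ exceptionalPrimes (maximalIdeal A),
        exceptionalVal Q₀ (RatFunc.C (algebraMap A K f)) <
        (n + 1 + B : ℕ) * exceptionalVal Q₀ (tInv (maximalIdeal A) : RatFunc K) := by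
      by_contra! hcon
      have h1 := mem_normalizedRees_of_forall_le (n := (n + 1 + B : ℕ))
        (fun (_ : f ≠ 0) Q hQ => hcon Q hQ)
      have h2 := mem_pow_of_mem_normalizedRees hB h1
      rw [Int.toNat_natCast, Nat.add_sub_cancel] at h2
      exact hfn h2
    intro Q hQ
    obtain ⟨ν₀, hν₀, hν₀'⟩ := exists_reesValuation hm hQ₀
    obtain ⟨ν, hν, hν'⟩ := exists_reesValuation hm hQ
    obtain ⟨e₀, he₀, hev₀⟩ := exceptionalVal_eq_mul hQ₀ hν₀ hν₀'
    obtain ⟨e, he, hev⟩ := exceptionalVal_eq_mul hQ hν hν'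
    -- The comparison is applied to `f` and to an `x` with the same value as `T⁻¹` at `Q`; therefore
    -- the constant is squared.
    obtain ⟨x, hx, hx0, hxw⟩ := exists_exceptionalVal_eq_tInv hcat hm hQ
    obtain ⟨a₀, ha₀, ha₀'⟩ := hev₀ _ (algebraMap_fractionRing_ne_zero hf0)
    obtain ⟨a, ha, ha'⟩ := hev _ (algebraMap_fractionRing_ne_zero hf0)
    obtain ⟨b₀, hb₀, hb₀'⟩ := hev₀ _ (algebraMap_fractionRing_ne_zero hx0)
    obtain ⟨b, hb, hb'⟩ := hev _ (algebraMap_fractionRing_ne_zero hx0)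
    have h1 : a ≤ E * a₀ := by
      have := hE ν ν₀ ⟨hν, Q, hQ, hν'⟩ ⟨hν₀, Q₀, hQ₀, hν₀'⟩ f hf0
      rw [ha, ha₀, ← WithTop.coe_nsmul, nsmul_eq_mul, WithTop.coe_le_coe] at this
      exact this
    have h2 : b₀ ≤ E * b := by
      have := hE ν₀ ν ⟨hν₀, Q₀, hQ₀, hν₀'⟩ ⟨hν, Q, hQ, hν'⟩ x hx0
      rw [hb, hb₀, ← WithTop.coe_nsmul, nsmul_eq_mul, WithTop.coe_le_coe] at this
      exact this
    have h3 := le_exceptionalVal_of_mem_pow (n := 1) hQ₀ hx0 (by rwa [pow_one])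
    rw [Nat.cast_one, one_mul, hb₀'] at h3
    rw [ha₀'] at h₀
    have h4 : a₀ ≤ (n + 1 + B : ℕ) * b₀ := by
      have h5 : e₀ * a₀ < e₀ * ((n + 1 + B : ℕ) * b₀) := by
        refine h₀.trans_le ?_
        calc _ ≤ ((n + 1 + B : ℕ) : ℤ) * (e₀ * b₀) := by gcongr
          _ = _ := by ring
      exact (lt_of_mul_lt_mul_left h5 he₀.le).le
    rw [ha', ← hxw, hb']
    calc e * a ≤ e * (E * ((n + 1 + B : ℕ) * (E * b))) := by
          gcongr
          exact h1.trans (by gcongr; exact h4.trans (by gcongr))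
      _ = _ := by push_cast; ring
  by_cases hy0 : y = 0
  · rw [hy0]
    exact zero_mem _
  have h1 : RatFunc.C (algebraMap A K y) * RatFunc.X ^ ((k : ℤ) - (E * E * (n + 1 + B) : ℕ)) ∈
      normalizedRees (maximalIdeal A) := by
    refine mem_normalizedRees_of_forall_le fun _ Q hQ => ?_
    have h2 := le_exceptionalVal_of_mem_pow hQ (mul_ne_zero hf0 hy0) hy
    rw [map_mul, exceptionalVal_C_mul hQ (algebraMap_fractionRing_ne_zero hf0)
      (algebraMap_fractionRing_ne_zero hy0)] at h2
    linear_combination h2 + key Q hQ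
  have h2 := mem_pow_of_mem_normalizedRees hB h1
  rwa [show ((k : ℤ) - (E * E * (n + 1 + B) : ℕ)).toNat - B = k - (E * E * (n + 1 + B) + B) by
    omega] at h2

/-- If the values of `f` at the exceptional primes are at most `C n`, and `f` has order at least
`n`, then `C` bounds the quotients of the Rees valuations of `f`. -/
theorem reesValuation_le_of_exceptionalVal_le
    (hcat : ∀ N : ℕ, IsCatenary (MvPolynomial (Fin N) A)) (hm : maximalIdeal A ≠ ⊥) {C n : ℕ}
    {f : A}
    (hf0 : f ≠ 0) (hfn : f ∈ maximalIdeal A ^ n)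
    (hC : ∀ Q ∈ exceptionalPrimes (maximalIdeal A),
      exceptionalVal Q (RatFunc.C (algebraMap A K f)) ≤ (C * n : ℕ))
    {ν₁ ν₂ : AddValuation K (WithTop ℤ)} (hν₁ : IsReesValuation (maximalIdeal A) ν₁)
    (hν₂ : IsReesValuation (maximalIdeal A) ν₂) :
    ν₁ (algebraMap A K f) ≤ C • ν₂ (algebraMap A K f) := by
  obtain ⟨h1, Q₁, hQ₁, h1'⟩ := hν₁
  obtain ⟨h2, Q₂, hQ₂, h2'⟩ := hν₂
  obtain ⟨e₁, he₁, hev₁⟩ := exceptionalVal_eq_mul hQ₁ h1 h1'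
  obtain ⟨e₂, he₂, hev₂⟩ := exceptionalVal_eq_mul hQ₂ h2 h2'
  obtain ⟨x, hx, hx0, hxw⟩ := exists_exceptionalVal_eq_tInv hcat hm hQ₂
  obtain ⟨a₁, ha₁, ha₁'⟩ := hev₁ _ (algebraMap_fractionRing_ne_zero hf0)
  obtain ⟨a₂, ha₂, ha₂'⟩ := hev₂ _ (algebraMap_fractionRing_ne_zero hf0)
  obtain ⟨b, hb, hb'⟩ := hev₂ _ (algebraMap_fractionRing_ne_zero hx0)
  have hb1 : 1 ≤ b := by
    have := exceptionalVal_tInv_pos hQ₂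
    rw [← hxw, hb'] at this
    exact pos_of_mul_pos_right this he₂.le
  have h3 : n ≤ a₂ := by
    have := le_exceptionalVal_of_mem_pow hQ₂ hf0 hfn
    rw [ha₂', ← hxw, hb'] at this
    have h4 : e₂ * (n * b) ≤ e₂ * a₂ := by linear_combination this
    have h5 := le_of_mul_le_mul_left h4 he₂
    exact (le_mul_of_one_le_right (by positivity) hb1).trans h5
  have h4 : a₁ ≤ (C * n : ℕ) := by
    have h5 := hC Q₁ hQ₁
    have h6 := exceptionalVal_algebraMap_nonneg hQ₁ hf0
    rw [ha₁'] at h5 h6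
    exact (le_mul_of_one_le_left (nonneg_of_mul_nonneg_right h6 he₁) he₁).trans h5
  rw [ha₁, ha₂, ← WithTop.coe_nsmul, nsmul_eq_mul, WithTop.coe_le_coe]
  refine h4.trans ?_
  push_cast
  gcongr

end LocalComparison

section Global

open IsLocalRing (maximalIdeal)

variable {R : Type u} [CommRing R]

theorem mem_symbolicPower_iff {p : Ideal R} [p.IsPrime] {n : ℕ} {f : R} : f ∈ symbolicPower p n ↔
    algebraMap R (Localization.AtPrime p) f ∈ maximalIdeal (Localization.AtPrime p) ^ n := by
  rw [symbolicPower, Ideal.mem_comap, Ideal.map_pow, Localization.AtPrime.map_eq_maximalIdeal]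

attribute [local instance] MvPolynomial.algebraMvPolynomial in
theorem isCatenary_mvPolynomial_localization (hR : IsUniversallyCatenary R) (p : Ideal R)
    [p.IsPrime]
    (N : ℕ) : IsCatenary (MvPolynomial (Fin N) (Localization.AtPrime p)) := by
  have : IsLocalization (p.primeCompl.map (MvPolynomial.C (σ := Fin N)))
    (MvPolynomial (Fin N) (Localization.AtPrime p)) := MvPolynomial.isLocalization _ _
  exact isCatenary_of_isLocalization (p.primeCompl.map (MvPolynomial.C (σ := Fin N)))
    (hR (MvPolynomial (Fin N) R))

variable [IsDomain R]

theorem algebraMap_localization_ne_zero (p : Ideal R) [p.IsPrime] {f : R} (hf : f ≠ 0) :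
    algebraMap R (Localization.AtPrime p) f ≠ 0 := by
  rwa [Ne, map_eq_zero_iff _ (IsLocalization.injective _ p.primeCompl_le_nonZeroDivisors)]

theorem ordAt_spec [IsNoetherianRing R] (p : Ideal R) [p.IsPrime] {f : R} (hf : f ∈ p)
    (hf0 : f ≠ 0) :
    1 ≤ ordAt p f ∧
    algebraMap R (Localization.AtPrime p) f ∈ maximalIdeal (Localization.AtPrime p) ^ ordAt p f ∧
    algebraMap R (Localization.AtPrime p) f ∉
      maximalIdeal (Localization.AtPrime p) ^ (ordAt p f + 1) := by
  have hbdd : BddAbove {n : ℕ | f ∈ symbolicPower p n} := by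
    obtain ⟨N, hN⟩ : ∃ N, algebraMap R (Localization.AtPrime p) f ∉
        maximalIdeal (Localization.AtPrime p) ^ N := by
      by_contra! hcon
      have h1 := Ideal.iInf_pow_eq_bot_of_isLocalRing (maximalIdeal (Localization.AtPrime p))
        (IsLocalRing.maximalIdeal.isMaximal _).ne_top
      have h2 : algebraMap R (Localization.AtPrime p) f ∈
          ⨅ i, maximalIdeal (Localization.AtPrime p) ^ i := (Submodule.mem_iInf _).2 hcon
      rw [h1] at h2
      exact algebraMap_localization_ne_zero p hf0 h2
    refine ⟨N, fun n hn => ?_⟩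
    by_contra! hlt
    exact hN (Ideal.pow_le_pow_right hlt.le (mem_symbolicPower_iff.1 hn))
  have h1 : f ∈ symbolicPower p 1 := by
    rw [mem_symbolicPower_iff, pow_one]
    exact (IsLocalization.AtPrime.to_map_mem_maximal_iff _ p f).2 hf
  refine ⟨le_csSup hbdd h1, mem_symbolicPower_iff.1 (Nat.sSup_mem ⟨1, h1⟩ hbdd), fun h => ?_⟩
  have := le_csSup hbdd (mem_symbolicPower_iff.2 h)
  exact absurd this (Nat.not_succ_le_self _)

theorem exists_ringKrullDim_eq_add_one {A : Type*} [CommRing A] [IsDomain A] [IsLocalRing A]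
    [IsNoetherianRing A] (hm : maximalIdeal A ≠ ⊥) : ∃ d : ℕ, ringKrullDim A = (d + 1 : ℕ) := by
  rw [← IsLocalRing.maximalIdeal_height_eq_ringKrullDim]
  obtain ⟨n, hn⟩ := ENat.ne_top_iff_exists.1 (maximalIdeal A).height_ne_top_of_isPrime
  rw [← hn]
  obtain ⟨d, rfl⟩ : ∃ d, n = d + 1 := by
    refine ⟨n - 1, (Nat.succ_pred_eq_of_ne_zero ?_).symm⟩
    rintro rfl
    exact hm (Ideal.height_eq_zero_iff_eq_bot.1 hn.symm)
  exact ⟨d, rfl⟩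

/-- The structure of an `R_p`-algebra on the fraction field of `R_p` found by instance search is the
one induced by `R → Frac(R_p)`; on elements of `R` it agrees with the standard one. -/
theorem algebraMap_fractionRing_localization (p : Ideal R) [p.IsPrime] (f : R) :
    algebraMap (Localization.AtPrime p) (FractionRing (Localization.AtPrime p))
      (algebraMap R (Localization.AtPrime p) f) =
    @algebraMap (Localization.AtPrime p) (FractionRing (Localization.AtPrime p)) _ _
      OreLocalization.instAlgebra (algebraMap R (Localization.AtPrime p) f) :=
  IsLocalization.lift_eq _ _

/-- Comparable Rees valuations bound the multiplicities: with `k₀` the bound for parameter ideals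
and `B` the Briançon–Skoda exponent, the constant is `(E² (2 + B) + B) k₀`. -/
theorem multiplicityCriterion_of_valuationCriterion (hR : IsExcellent R)
    (hBS : UniformBrianconSkoda R) (h : ValuationCriterion R) : MultiplicityCriterion R := by
  have := hR.isNoetherianRing
  obtain ⟨B, hB⟩ := hBS
  obtain ⟨E, hE⟩ := h
  obtain ⟨k₀, hk₀⟩ := exists_hasParameterIdealOfColengthLE hR
  obtain ⟨c, hc0, hc⟩ := exists_conductor hR hB
  refine ⟨(E * E * (2 + B) + B) * k₀, fun p _ f hf hf0 => ?_⟩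
  let A := Localization.AtPrime p
  -- a local instance, for instance search to prefer it to the one induced by `R → Frac(R_p)`
  let : Algebra (Localization.AtPrime p) (FractionRing (Localization.AtPrime p)) :=
    OreLocalization.instAlgebra
  have hBA := fun J n => idealIntegralClosure_localization_subset p hB J n
  have : Module.Finite (extendedRees (maximalIdeal A)) (normalizedRees (maximalIdeal A)) :=
    normalizedRees_finite hBA (algebraMap_localization_ne_zero p hc0)
      (fun x hx => conductor_localization p hc x hx) _
  have : IsNoetherianRing (normalizedRees (maximalIdeal A)) :=
    IsNoetherianRing.of_finite (extendedRees (maximalIdeal A)) _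
  have hcat := isCatenary_mvPolynomial_localization hR.isUniversallyCatenary p
  have hfA0 := algebraMap_localization_ne_zero p hf0
  have hfA : algebraMap R A f ∈ maximalIdeal A :=
    (IsLocalization.AtPrime.to_map_mem_maximal_iff _ p f).2 hf
  have hm : maximalIdeal A ≠ ⊥ := fun h => hfA0 (by rw [h] at hfA; exact hfA)
  obtain ⟨d, hd⟩ := exists_ringKrullDim_eq_add_one hm
  obtain ⟨S, hS, hSm, hSk⟩ := hk₀ p
  rw [hd] at hS
  obtain ⟨hn1, hn, hn'⟩ := ordAt_spec p hf hf0
  -- every element of `R_p` is a unit times an element of `R`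
  have hEA : ∀ ν₁ ν₂ : AddValuation (FractionRing (Localization.AtPrime p)) (WithTop ℤ),
      IsReesValuation (maximalIdeal A) ν₁ → IsReesValuation (maximalIdeal A) ν₂ →
      ∀ a : Localization.AtPrime p, a ≠ 0 →
        ν₁ (algebraMap (Localization.AtPrime p) (FractionRing (Localization.AtPrime p)) a) ≤
          E • ν₂
            (algebraMap (Localization.AtPrime p) (FractionRing (Localization.AtPrime p)) a) := by
    intro ν₁ ν₂ h₁ h₂ a ha
    obtain ⟨⟨r, s⟩, hrs⟩ := IsLocalization.surj p.primeCompl a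
    have hs : IsUnit (algebraMap R A s) := IsLocalization.map_units A s
    have hr0 : r ≠ 0 := by
      rintro rfl
      dsimp only at hrs
      rw [map_zero] at hrs
      exact mul_ne_zero ha hs.ne_zero hrs
    have h3 := hE p ν₁ ν₂ h₁ h₂ r hr0
    rw [algebraMap_fractionRing_localization] at h3
    dsimp only at hrs
    rw [← hrs, map_mul, AddValuation.map_mul, AddValuation.map_mul,
      reesValuation_eq_zero_of_isUnit h₁ hs, reesValuation_eq_zero_of_isUnit h₂ hs, add_zero,
      add_zero] at h3
    exact h3
  obtain ⟨pf, -, -, -, hbound⟩ := exists_hasPoly_hilbertSamuelMultiplicity hd S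
    (by exact_mod_cast hS) hSm hSk hfA hfA0
  refine (hbound _ fun k y hy =>
    mem_pow_sub_of_mul_mem_pow hcat hBA hm hEA hfA0 hn' k y hy).trans ?_
  have h1 : E * E * (ordAt p f + 1 + B) + B ≤ (E * E * (2 + B) + B) * ordAt p f := by
    have h2 : ordAt p f + 1 + B ≤ (2 + B) * ordAt p f := by nlinarith
    calc E * E * (ordAt p f + 1 + B) + B ≤ E * E * ((2 + B) * ordAt p f) + B * ordAt p f := by
          gcongr
          exact Nat.le_mul_of_pos_right B hn1
      _ = _ := by ring
  calc (((E * E * (ordAt p f + 1 + B) + B : ℕ) : ℝ)) * k₀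
      ≤ (((E * E * (2 + B) + B) * ordAt p f : ℕ) : ℝ) * k₀ := by gcongr
    _ = _ := by push_cast; ring

/-- A bound for the multiplicities bounds the quotients of Rees valuations by the same constant. If
`f ∉ p`, then all Rees valuations of `f` vanish. -/
theorem valuationCriterion_of_multiplicityCriterion (hR : IsExcellent R)
    (hBS : UniformBrianconSkoda R) (h : MultiplicityCriterion R) : ValuationCriterion R := by
  have := hR.isNoetherianRing
  obtain ⟨B, hB⟩ := hBS
  obtain ⟨C, hC⟩ := h
  obtain ⟨k₀, hk₀⟩ := exists_hasParameterIdealOfColengthLE hR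
  obtain ⟨c, hc0, hc⟩ := exists_conductor hR hB
  refine ⟨C, fun p _ ν₁ ν₂ hν₁ hν₂ f hf0 => ?_⟩
  rw [algebraMap_fractionRing_localization]
  let A := Localization.AtPrime p
  -- a local instance, for instance search to prefer it to the one induced by `R → Frac(R_p)`
  let : Algebra (Localization.AtPrime p) (FractionRing (Localization.AtPrime p)) :=
    OreLocalization.instAlgebra
  have hBA := fun J n => idealIntegralClosure_localization_subset p hB J n
  have hcA := fun (x : FractionRing (Localization.AtPrime p)) hx => conductor_localization p hc x hx
  have : Module.Finite (extendedRees (maximalIdeal A)) (normalizedRees (maximalIdeal A)) :=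
    normalizedRees_finite hBA (algebraMap_localization_ne_zero p hc0) hcA _
  have : IsNoetherianRing (normalizedRees (maximalIdeal A)) :=
    IsNoetherianRing.of_finite (extendedRees (maximalIdeal A)) _
  have hcat := isCatenary_mvPolynomial_localization hR.isUniversallyCatenary p
  have hfA0 := algebraMap_localization_ne_zero p hf0
  by_cases hf : f ∈ p
  · have hfA : algebraMap R A f ∈ maximalIdeal A :=
      (IsLocalization.AtPrime.to_map_mem_maximal_iff _ p f).2 hf
    have hm : maximalIdeal A ≠ ⊥ := fun h => hfA0 (by rw [h] at hfA; exact hfA)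
    obtain ⟨d, hd⟩ := exists_ringKrullDim_eq_add_one hm
    obtain ⟨S, hS, hSm, hSk⟩ := hk₀ p
    rw [hd] at hS
    obtain ⟨-, hn, -⟩ := ordAt_spec p hf hf0
    obtain ⟨pf, hpf, hdeg, hmul, -⟩ := exists_hasPoly_hilbertSamuelMultiplicity hd S
      (by exact_mod_cast hS) hSm hSk hfA hfA0
    refine reesValuation_le_of_exceptionalVal_le hcat hm hfA0 hn (fun Q hQ => ?_) hν₁ hν₂
    have h1 := exceptionalVal_le_factorial_mul_coeff hcat
      (algebraMap_localization_ne_zero p hc0) hcA hd hQ hfA hfA0 hpf hdeg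
    have h2 : multiplicityAt p f ≤ C * ordAt p f := hC p f hf hf0
    rw [multiplicityAt, hmul] at h2
    have h3 : (d.factorial : ℚ) * pf.coeff d ≤ C * ordAt p f := by exact_mod_cast h2
    exact_mod_cast h1.trans h3
  · have hu : IsUnit (algebraMap R A f) := IsLocalization.map_units A (⟨f, hf⟩ : p.primeCompl)
    rw [reesValuation_eq_zero_of_isUnit hν₁ hu, reesValuation_eq_zero_of_isUnit hν₂ hu, smul_zero]

end Global

end IzumiRees

theorem mainTheorem7 {R : Type u} [CommRing R] [IsDomain R]
    (hR : IzumiRees.IsExcellent R) (hBS : IzumiRees.UniformBrianconSkoda R) :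
    IzumiRees.ValuationCriterion R ↔ IzumiRees.MultiplicityCriterion R :=
  ⟨IzumiRees.multiplicityCriterion_of_valuationCriterion hR hBS,
    IzumiRees.valuationCriterion_of_multiplicityCriterion hR hBS⟩
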